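/- Let $\alpha,\beta\ge -1/2$ and let $$d\mu^+(\theta)=d\mu^+_{\alpha,\beta}(\theta)=\Big(\sin\frac\theta2\Big)^{2\alpha+1}\Big(\cos\frac\theta2\Big)^{2\beta+1}d\theta\quad\text{on }(0,\pi),\qquad \lambda_n=\Big(n+\frac{\alpha+\beta+1}{2}\Big)^2 .$$ Let $P_n^{\alpha,\beta}$ be the classical Jacobi polynomials (Rodrigues formula), $\mathcal P_n(\theta)=c_nP_n^{\alpha,\beta}(\cos\theta)$ with $c_n=\|P_n^{\alpha,\beta}\circ\cos\|_{L^2(d\mu^+)}^{-1}$, and $$\Phi_{2n}=\tfrac1{\sqrt2}\mathcal P_n,\qquad \Phi_{2n+1}=-\tfrac1{\sqrt2}(\lambda_{n+1}-\lambda_0)^{-1/2}\,\delta\mathcal P_{n+1}\qquad(n\ge0),$$ where $\delta=\frac{d}{d\theta}$. Let $\delta^*=-\frac{d}{d\theta}-(\alpha+\frac12)\cot\frac\theta2+(\beta+\frac12)\tan\frac\theta2$, and let $\delta_N^{\mathrm{even}}=\cdots\delta\delta^*\delta$ and $\delta_N^{\mathrm{odd}}=\cdots\delta^*\delta\delta^*$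 ($N$ factors each; the identity for $N=0$). For complex-valued $f\in L^2(d\mu^+)$ write $\langle f,g\rangle=\int_0^\pi f\overline g\,d\mu^+$ and put $$H_t^+f(\theta)=\sum_{n\ge0}e^{-t\sqrt{\lambda_n}}\langle f,\Phi_{2n}\rangle\Phi_{2n}(\theta),\qquad \widetilde H_t^+f(\theta)=\sum_{n\ge0}e^{-t\sqrt{\lambda_{n+1}}}\langle f,\Phi_{2n+1}\rangle\Phi_{2n+1}(\theta).$$ Consider the following operators on $L^2(d\mu^+)$. (i) For $N\ge1$, the Riesz transforms $$R_N^+f=\sum_{n\ge0}\lambda_n^{-N/2}\langle f,\Phi_{2n}\rangle\,\delta_N^{\mathrm{even}}\Phi_{2n},\qquad \widetilde R_N^+f=\sum_{n\ge0}\lambda_{n+1}^{-N/2}\langle f,\Phi_{2n+1}\rangle\,\delta_N^{\mathrm{odd}}\Phi_{2n+1},$$ the term $n=0$ of the first series being omitted if $\alpha+\beta=-1$ (then $\lambda_0=0$). (ii) The maximal operators $H_*^+f(\theta)=\|H_t^+f(\theta)\|_{L^\infty((0,\infty),dt)}$ and $\widetilde H_*^+f(\theta)=\|\widetilde H_t^+f(\theta)\|_{L^\infty((0,\infty),dt)}$.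 (iii) For $M,N\ge0$, $M+N>0$, the square functions $$G_{M,N}^+f(\theta)=\big\|\partial_t^M\delta_N^{\mathrm{even}}H_t^+f(\theta)\big\|_{L^2(t^{2M+2N-1}dt)},\qquad \widetilde G_{M,N}^+f(\theta)=\big\|\partial_t^M\delta_N^{\mathrm{odd}}\widetilde H_t^+f(\theta)\big\|_{L^2(t^{2M+2N-1}dt)},$$ with $t\in(0,\infty)$. (iv) The multipliers $$M^+f=\sum_{n\ge0}m(\sqrt{\lambda_n})\langle f,\Phi_{2n}\rangle\Phi_{2n},\qquad \widetilde M^+f=\sum_{n\ge0}m(\sqrt{\lambda_{n+1}})\langle f,\Phi_{2n+1}\rangle\Phi_{2n+1},$$ where, for $z\ge|\frac{\alpha+\beta+1}2|$, either $m(z)=\int_0^\infty ze^{-tz}\phi(t)\,dt$ with $\phi$ a bounded measurable function on $(0,\infty)$, or $m(z)=\int_{(0,\infty)}e^{-tz}\,d\nu(t)$ with $\nu$ a signed or complex Borel measure on $(0,\infty)$ (possibly of infinite total variation) such that $\int_{(0,\infty)}e^{-t|\alpha+\beta+1|/2}\,d|\nu|(t)<\infty$. Then these operators are well defined: the series of $H_t^+f(\theta)$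 and $\widetilde H_t^+f(\theta)$ converge absolutely at every $(t,\theta)\in(0,\infty)\times(0,\pi)$ to smooth functions of $(t,\theta)$, and for every $f\in L^2(d\mu^+)$ the series in (i) and (iv) converge in $L^2(d\mu^+)$. Moreover, all the operators in (i)--(iv) are bounded on $L^2(d\mu^+)$ (those in (i) and (iv) are linear). In particular, the vector-valued operators $$f\mapsto\{H_t^+f(\theta)\}_{t>0},\qquad f\mapsto\{\widetilde H_t^+f(\theta)\}_{t>0}$$ are bounded and linear from $L^2(d\mu^+)$ to the Bochner space $L^2_{\mathbb X}(d\mu^+)$, where $\mathbb X\subset L^\infty(dt)$ is the subspace of continuous functions on $(0,\infty)$ with finite limits as $t\to0^+$ and $t\to\infty$; and, for $M,N\ge0$ with $M+N>0$, $$f\mapsto\{\partial_t^M\delta_N^{\mathrm{even}}H_t^+f(\theta)\}_{t>0},\qquad f\mapsto\{\partial_t^M\delta_N^{\mathrm{odd}}\widetilde H_t^+f(\theta)\}_{t>0}$$ are bounded and linear from $L^2(d\mu^+)$ to $L^2_{\mathbb B}(d\mu^+)$ with $\mathbb B=L^2((0,\infty),t^{2M+2N-1}dt)$. -/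

import Mathlib

open MeasureTheory Filter Topology Set
open scoped ENNReal NNReal BoundedContinuousFunction ComplexConjugate

noncomputable section

namespace SymJacobi

/-- The measure `sin(θ/2)^(2α+1) cos(θ/2)^(2β+1) dθ` on the interval `(0, π)`. -/
def muPlus (α β : ℝ) : Measure ℝ :=
  (volume.restrict (Ioo 0 Real.pi)).withDensity fun θ =>
    ENNReal.ofReal (Real.sin (θ / 2) ^ (2 * α + 1) * Real.cos (θ / 2) ^ (2 * β + 1))

/-- The space of (classes of) complex valued square integrable functions for `muPlus α β`. -/
abbrev L2 (α β : ℝ) : Type := Lp ℂ 2 (muPlus α β)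

/-- Classical Jacobi polynomials on `(-1, 1)`, by the Rodrigues formula. -/
def jacobiP (α β : ℝ) (n : ℕ) (x : ℝ) : ℝ :=
  (-1) ^ n / (2 ^ n * (n.factorial : ℝ)) * (1 - x) ^ (-α) * (1 + x) ^ (-β) *
    iteratedDeriv n (fun y : ℝ => (1 - y) ^ (α + n) * (1 + y) ^ (β + n)) x

/-- The normalizing factor: the inverse of the `L²` norm of `θ ↦ P_n(cos θ)`. -/
def normFactor (α β : ℝ) (n : ℕ) : ℝ :=
  (Real.sqrt (∫ θ, (jacobiP α β n (Real.cos θ)) ^ 2 ∂(muPlus α β)))⁻¹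

/-- Normalized Jacobi trigonometric polynomials. -/
def trigP (α β : ℝ) (n : ℕ) (θ : ℝ) : ℝ :=
  normFactor α β n * jacobiP α β n (Real.cos θ)

/-- The eigenvalues `λ_n = (n + (α + β + 1)/2)²`. -/
def eigenval (α β : ℝ) (n : ℕ) : ℝ := ((n : ℝ) + (α + β + 1) / 2) ^ 2

/-- The symmetrized system, as functions of `θ ∈ (0, π)`: for even index `2k` it is
`2^(-1/2) 𝒫_k`; for odd index `2k+1` it is
`-2^(-1/2) (λ_(k+1) - λ_0)^(-1/2) (d/dθ) 𝒫_(k+1)`. -/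
def Phi (α β : ℝ) (n : ℕ) (θ : ℝ) : ℝ :=
  if Even n then
    1 / Real.sqrt 2 * trigP α β (n / 2) θ
  else
    -(1 / Real.sqrt 2) * (eigenval α β ((n + 1) / 2) - eigenval α β 0) ^ (-(1 / 2) : ℝ) *
      deriv (trigP α β ((n + 1) / 2)) θ

/-- The coefficient `⟨f, Φ_n⟩ = ∫ f(θ) conj (Φ_n(θ)) dμ⁺(θ)`. -/
def coeff (α β : ℝ) (f : L2 α β) (n : ℕ) : ℂ :=
  ∫ θ, f θ * conj ((Phi α β n θ : ℝ) : ℂ) ∂(muPlus α β)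

/-- `δ = d/dθ`. -/
def delta (g : ℝ → ℂ) : ℝ → ℂ := deriv g

/-- `δ* = - d/dθ - (α + 1/2) cot(θ/2) + (β + 1/2) tan(θ/2)`. -/
def deltaStar (α β : ℝ) (g : ℝ → ℂ) : ℝ → ℂ := fun θ =>
  -deriv g θ - (((α + 1 / 2) * Real.cot (θ / 2) : ℝ) : ℂ) * g θ
    + (((β + 1 / 2) * Real.tan (θ / 2) : ℝ) : ℂ) * g θ

/-- `⋯ δ δ* δ`, `N` components, the first one to act being `δ`; the identity for `N = 0`. -/
def deltaEven (α β : ℝ) : ℕ → (ℝ → ℂ) → (ℝ → ℂ)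
  | 0, g => g
  | N + 1, g =>
      if Even N then delta (deltaEven α β N g) else deltaStar α β (deltaEven α β N g)

/-- `⋯ δ* δ δ*`, `N` components, the first one to act being `δ*`; the identity for `N = 0`. -/
def deltaOdd (α β : ℝ) : ℕ → (ℝ → ℂ) → (ℝ → ℂ)
  | 0, g => g
  | N + 1, g =>
      if Even N then deltaStar α β (deltaOdd α β N g) else delta (deltaOdd α β N g)

/-- The `n`-th term of the series defining the restricted Riesz transform `(R_N)⁺ f`.
If `λ_0 = 0` then the term with `n = 0` is absent: `(0 : ℝ) ^ s = 0` for `s ≠ 0`. -/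
def rieszEvenTerm (α β : ℝ) (N : ℕ) (f : L2 α β) (n : ℕ) (θ : ℝ) : ℂ :=
  ((eigenval α β n ^ (-(N : ℝ) / 2) : ℝ) : ℂ) * coeff α β f (2 * n) *
    deltaEven α β N (fun x => ((Phi α β (2 * n) x : ℝ) : ℂ)) θ

/-- The `n`-th term of the series defining the restricted Riesz transform `(R̃_N)⁺ f`. -/
def rieszOddTerm (α β : ℝ) (N : ℕ) (f : L2 α β) (n : ℕ) (θ : ℝ) : ℂ :=
  ((eigenval α β (n + 1) ^ (-(N : ℝ) / 2) : ℝ) : ℂ) * coeff α β f (2 * n + 1) *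
    deltaOdd α β N (fun x => ((Phi α β (2 * n + 1) x : ℝ) : ℂ)) θ

/-- The `n`-th term of the series defining the restricted multiplier operator `M⁺ f`. -/
def multEvenTerm (α β : ℝ) (m : ℝ → ℂ) (f : L2 α β) (n : ℕ) (θ : ℝ) : ℂ :=
  m (Real.sqrt (eigenval α β n)) * coeff α β f (2 * n) * ((Phi α β (2 * n) θ : ℝ) : ℂ)

/-- The `n`-th term of the series defining the restricted multiplier operator `M̃⁺ f`. -/
def multOddTerm (α β : ℝ) (m : ℝ → ℂ) (f : L2 α β) (n : ℕ) (θ : ℝ) : ℂ :=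
  m (Real.sqrt (eigenval α β (n + 1))) * coeff α β f (2 * n + 1) *
    ((Phi α β (2 * n + 1) θ : ℝ) : ℂ)

/-- `m(z) = ∫_0^∞ z e^(-tz) φ(t) dt` for `z ≥ |(α + β + 1)/2|`, with `φ` bounded measurable. -/
def IsLaplaceMultiplier (α β : ℝ) (m : ℝ → ℂ) : Prop :=
  ∃ φ : ℝ → ℂ, Measurable φ ∧ (∃ C : ℝ, ∀ t, 0 < t → ‖φ t‖ ≤ C) ∧
    ∀ z : ℝ, |(α + β + 1) / 2| ≤ z →
      m z = ∫ t in Ioi (0 : ℝ), ((z * Real.exp (-t * z) : ℝ) : ℂ) * φ t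

/-- `m(z) = ∫_(0,∞) e^(-tz) dν(t)` for `z ≥ |(α + β + 1)/2|`, with `ν` a signed or complex Borel
measure on `(0, ∞)` such that `∫ e^(-t|α+β+1|/2) d|ν|(t) < ∞`. As `|ν|` may be an infinite measure,
`ν` is given by its polar decomposition `dν = h d|ν|`, where `|h| = 1`; here `ρ` is `|ν|`.
Signed measures correspond to `h` with values `±1`. -/
def IsLaplaceStieltjesMultiplier (α β : ℝ) (m : ℝ → ℂ) : Prop :=
  ∃ (ρ : Measure ℝ) (h : ℝ → ℂ), Measurable h ∧ (∀ t, ‖h t‖ = 1) ∧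
    (∫⁻ t in Ioi (0 : ℝ), ENNReal.ofReal (Real.exp (-t * (|α + β + 1| / 2))) ∂ρ < ∞) ∧
    ∀ z : ℝ, |(α + β + 1) / 2| ≤ z →
      m z = ∫ t in Ioi (0 : ℝ), ((Real.exp (-t * z) : ℝ) : ℂ) * h t ∂ρ

/-- The `n`-th term of the series defining `(H_t)⁺ f(θ)`. -/
def poissonEvenTerm (α β : ℝ) (f : L2 α β) (t θ : ℝ) (n : ℕ) : ℂ :=
  ((Real.exp (-t * Real.sqrt (eigenval α β n)) : ℝ) : ℂ) * coeff α β f (2 * n) *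
    ((Phi α β (2 * n) θ : ℝ) : ℂ)

/-- The `n`-th term of the series defining `(H̃_t)⁺ f(θ)`. -/
def poissonOddTerm (α β : ℝ) (f : L2 α β) (t θ : ℝ) (n : ℕ) : ℂ :=
  ((Real.exp (-t * Real.sqrt (eigenval α β (n + 1))) : ℝ) : ℂ) * coeff α β f (2 * n + 1) *
    ((Phi α β (2 * n + 1) θ : ℝ) : ℂ)

/-- `(H_t)⁺ f(θ)`, as a pointwise sum. -/
def poissonEven (α β : ℝ) (f : L2 α β) (t θ : ℝ) : ℂ := ∑' n, poissonEvenTerm α β f t θ n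

/-- `(H̃_t)⁺ f(θ)`, as a pointwise sum. -/
def poissonOdd (α β : ℝ) (f : L2 α β) (t θ : ℝ) : ℂ := ∑' n, poissonOddTerm α β f t θ n

/-- The maximal operator `(H_*)⁺ f(θ)`: the `L^∞((0,∞), dt)` norm of `t ↦ (H_t)⁺ f(θ)`. -/
def maxEven (α β : ℝ) (f : L2 α β) (θ : ℝ) : ℝ≥0∞ :=
  eLpNorm (fun t => poissonEven α β f t θ) ∞ (volume.restrict (Ioi 0))

/-- The maximal operator `(H̃_*)⁺ f(θ)`. -/
def maxOdd (α β : ℝ) (f : L2 α β) (θ : ℝ) : ℝ≥0∞ :=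
  eLpNorm (fun t => poissonOdd α β f t θ) ∞ (volume.restrict (Ioi 0))

/-- The measure `t^(2M+2N-1) dt` on `(0, ∞)` (used only for `M + N > 0`). -/
def sqMeasure (M N : ℕ) : Measure ℝ :=
  (volume.restrict (Ioi 0)).withDensity fun t => ENNReal.ofReal (t ^ (2 * M + 2 * N - 1))

/-- `∂_t^M δ_N^even (H_t)⁺ f(θ)`, as a function of `θ` and `t`. -/
def sqEvenFun (α β : ℝ) (M N : ℕ) (f : L2 α β) (θ t : ℝ) : ℂ :=
  iteratedDeriv M (fun s => deltaEven α β N (fun x => poissonEven α β f s x) θ) t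

/-- `∂_t^M δ_N^odd (H̃_t)⁺ f(θ)`, as a function of `θ` and `t`. -/
def sqOddFun (α β : ℝ) (M N : ℕ) (f : L2 α β) (θ t : ℝ) : ℂ :=
  iteratedDeriv M (fun s => deltaOdd α β N (fun x => poissonOdd α β f s x) θ) t

/-- The mixed square function `(G_(M,N))⁺ f(θ)`. -/
def sqEven (α β : ℝ) (M N : ℕ) (f : L2 α β) (θ : ℝ) : ℝ≥0∞ :=
  eLpNorm (sqEvenFun α β M N f θ) 2 (sqMeasure M N)

/-- The mixed square function `(G̃_(M,N))⁺ f(θ)`. -/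
def sqOdd (α β : ℝ) (M N : ℕ) (f : L2 α β) (θ : ℝ) : ℝ≥0∞ :=
  eLpNorm (sqOddFun α β M N f θ) 2 (sqMeasure M N)

/-- The space `𝕏` of continuous functions on `(0, ∞)` which have finite limits at `0⁺` and at `∞`
(such functions are bounded), with the supremum norm, which for continuous functions is the
norm of `L^∞(dt)`. -/
def XSpace : Submodule ℂ (Ioi (0 : ℝ) →ᵇ ℂ) where
  carrier := {g | (∃ a : ℂ, Tendsto g (comap Subtype.val (𝓝[>] (0 : ℝ))) (𝓝 a)) ∧
    ∃ b : ℂ, Tendsto g (comap Subtype.val (atTop : Filter ℝ)) (𝓝 b)}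
  add_mem' := by
    rintro f g ⟨⟨a, ha⟩, ⟨b, hb⟩⟩ ⟨⟨c, hc⟩, ⟨d, hd⟩⟩
    exact ⟨⟨a + c, ha.add hc⟩, ⟨b + d, hb.add hd⟩⟩
  zero_mem' := ⟨⟨0, tendsto_const_nhds⟩, ⟨0, tendsto_const_nhds⟩⟩
  smul_mem' := by
    rintro c g ⟨⟨a, ha⟩, ⟨b, hb⟩⟩
    exact ⟨⟨c • a, ha.const_smul c⟩, ⟨c • b, hb.const_smul c⟩⟩

/-- For all `f ∈ L²(dμ⁺)`, the functions `u f n` lie in `L²(dμ⁺)`, their series over `n` converges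
in `L²(dμ⁺)`, and the sum is a bounded linear operator on `L²(dμ⁺)`. -/
def SeriesBoundedOnL2 (α β : ℝ) (u : L2 α β → ℕ → ℝ → ℂ) : Prop :=
  ∃ T : L2 α β →L[ℂ] L2 α β, ∀ f : L2 α β,
    ∃ h : ∀ n, MemLp (u f n) 2 (muPlus α β), HasSum (fun n => (h n).toLp (u f n)) (T f)

/-- A nonlinear operator with values in nonnegative functions is bounded on `L²(dμ⁺)`. -/
def BoundedOnL2 (α β : ℝ) (S : L2 α β → ℝ → ℝ≥0∞) : Prop :=
  ∃ C : ℝ≥0, ∀ f : L2 α β, MemLp (S f) 2 (muPlus α β) ∧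
    eLpNorm (S f) 2 (muPlus α β) ≤ C * eLpNorm f 2 (muPlus α β)

/-- `f ↦ {F f t θ}_(t>0)` is a bounded linear operator from `L²(dμ⁺)` to the Bochner space
`L²_𝕏(dμ⁺)`. -/
def BoundedIntoX (α β : ℝ) (F : L2 α β → ℝ → ℝ → ℂ) : Prop :=
  ∃ T : L2 α β →L[ℂ] Lp XSpace 2 (muPlus α β), ∀ f : L2 α β,
    ∀ᵐ θ ∂(muPlus α β), ∀ t : Ioi (0 : ℝ), (T f θ : Ioi (0 : ℝ) →ᵇ ℂ) t = F f t θ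

/-- `f ↦ {F f θ t}_(t>0)` is a bounded linear operator from `L²(dμ⁺)` to the Bochner space
`L²_𝔹(dμ⁺)`, where `𝔹 = L²(t^(2M+2N-1) dt)`. -/
def BoundedIntoL2t (α β : ℝ) (M N : ℕ) (F : L2 α β → ℝ → ℝ → ℂ) : Prop :=
  ∃ T : L2 α β →L[ℂ] Lp (Lp ℂ 2 (sqMeasure M N)) 2 (muPlus α β), ∀ f : L2 α β,
    ∀ᵐ θ ∂(muPlus α β), (T f θ : ℝ → ℂ) =ᵐ[sqMeasure M N] F f θ

/-- The series with terms `u f t θ n` converges absolutely for all `t > 0` and `θ ∈ (0, π)`,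
and its sum is a smooth function of `(t, θ)`. -/
def SmoothSeries (α β : ℝ) (u : L2 α β → ℝ → ℝ → ℕ → ℂ) : Prop :=
  ∀ f : L2 α β, (∀ t ∈ Ioi (0 : ℝ), ∀ θ ∈ Ioo (0 : ℝ) Real.pi, Summable (u f t θ)) ∧
    ContDiffOn ℝ ((⊤ : ℕ∞) : WithTop ℕ∞) (fun p : ℝ × ℝ => ∑' n, u f p.1 p.2 n)
      (Ioi (0 : ℝ) ×ˢ Ioo (0 : ℝ) Real.pi)

end SymJacobi

end

open SymJacobi

/-!
Write `κ_n = λ_n - λ_0` and `Ψ_n` for either of `Φ_{2n}`, `Φ_{2n-1}`. Everything rests on the first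
order system `δ Φ_{2n} = -√κ_n Φ_{2n-1}`, `δ* Φ_{2n-1} = -√κ_n Φ_{2n}` on `(0, π)`
(`hasDerivAt_sysFun_false`, `hasDerivAt_sysFun_true`), which follows from the Jacobi differential
equation, and on the orthogonality of each half of the system, which follows from Green's formula
(`integral_jacOp_mul`).

* *Riesz transforms and multipliers.* They send one half of the system to one of the halves, with
  bounded coefficients (`√κ_n ≤ √λ_n` for the Riesz transforms), so they are bounded by
  orthogonality (`seriesBoundedOnL2_of_diagonal`).

* *Pointwise convergence and smoothness.* The energy `Φ_{2n}² + Φ_{2n-1}²` obeys a differential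
  inequality with constants independent of `n`, so the system is uniformly bounded on compact subsets
  of `(0, π)` (`exists_sysFun_bound`). Hence `∑ e^{-t√λ_n} a_n Ψ_n(θ)` converges locally uniformly
  for `a` of polynomial growth, and by the first order system its derivatives are series of the same
  kind (`hasFDerivAt_ser`, `iteratedDeriv_deltaSeq_ser`).

* *Square functions.* The mixed derivatives form a series of tensors `Ψ_n ⊗ k_n` in
  `L²(dμ⁺; L²(t^{2M+2N-1} dt))`, orthogonal since the `Ψ_n` are, with
  `‖k_n‖² ≤ Γ(2M + 2N)` (`boundedIntoL2t_deltaSeq_poisson`).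

* *Maximal operators.* Split `e^{-x} = (1 + x²)⁻¹ + F(x)` with `x = t√λ_n`. The function `F` vanishes
  at `0` and decays at infinity, so the supremum over `t` of its contribution is bounded by a square
  function (`enorm_sq_le_lintegral`, `exists_maximal_diff`). The rest is the maximal function of the
  resolvents `R_s = (1 + s L)⁻¹`, `s = t²`. They preserve positivity, by the maximum principle for the
  Jacobi operator on polynomials and density (`exists_resolvent`); for the odd half, `Φ_{2n-1}` is
  `sin θ` times a polynomial of type `(α + 1, β + 1)`, so the same argument applies. For symmetric
  positivity preserving resolvents, `R_s R_r ≤ 4 R_{2s}` if `r ≤ s`; by duality this bounds the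
  supremum: the inequality `‖∑ R_{t_i} g_i‖² ≤ 8 ‖∑ g_i‖ ‖∑ R_{2 t_i} g_i‖` for `g_i ≥ 0`, iterated
  over doublings of the times, yields `‖∑ R_{t_i} g_i‖ ≤ 8 ‖∑ g_i‖`
  (`IsPositiveResolvent.norm_sum_le`, `IsPositiveResolvent.exists_maximal`). The maximal inequality
  for finite sums is the bound that makes the series converge in the Bochner space of
  `XSpace`-valued functions (`boundedIntoX_poisson`).
-/

/-! ### Jacobi polynomials as solutions of the Jacobi differential equation -/

namespace SymJacobi

open Polynomial in
/-- The Jacobi differential operator `(1 - x²) p'' + (β - α - (α + β + 2) x) p'` on polynomials. -/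
noncomputable def jacOp (α β : ℝ) (p : ℝ[X]) : ℝ[X] :=
  (1 - X ^ 2) * derivative (derivative p) + (C (β - α) - C (α + β + 2) * X) * derivative p

/-- The coefficient of `(1 - x)^(n-k) (1 + x)^k` that Leibniz' rule yields in Rodrigues' formula. -/
noncomputable def jacCoef (α β : ℝ) (n k : ℕ) : ℝ :=
  (-1) ^ n / (2 ^ n * (n.factorial : ℝ)) * (n.choose k * ((-1) ^ k *
    (descPochhammer ℝ k).eval (α + n)) * (descPochhammer ℝ (n - k)).eval (β + n))

open Polynomial in
/-- The Jacobi polynomial as an element of `ℝ[X]`. -/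
noncomputable def jacPoly (α β : ℝ) (n : ℕ) : ℝ[X] :=
  ∑ k ∈ Finset.range (n + 1), C (jacCoef α β n k) * ((1 - X) ^ (n - k) * (1 + X) ^ k)

/-- Leibniz' rule turns Rodrigues' formula into a polynomial. -/
theorem jacobiP_eq_eval (α β : ℝ) (n : ℕ) {x : ℝ} (hx : x ∈ Set.Ioo (-1 : ℝ) 1) :
    jacobiP α β n x = (jacPoly α β n).eval x := by
  have h1 : (0 : ℝ) < 1 - x := by linarith [hx.2]
  have h2 : (0 : ℝ) < 1 + x := by linarith [hx.1]
  have key : iteratedDeriv n (fun y : ℝ => (1 - y) ^ (α + n) * (1 + y) ^ (β + n)) x =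
      ∑ k ∈ Finset.range (n + 1), n.choose k * ((-1) ^ k * ((descPochhammer ℝ k).eval (α + n) *
        (1 - x) ^ (α + n - k))) * ((descPochhammer ℝ (n - k)).eval (β + n) *
        (1 + x) ^ (β + n - (n - k : ℕ))) := by
    rw [iteratedDeriv_fun_mul]
    · refine Finset.sum_congr rfl fun k _ => ?_
      congr 2
      · have := congrFun (iteratedDeriv_comp_const_sub (n := k) (f := fun y : ℝ => y ^ (α + n))
          (s := (1 : ℝ))) x
        rw [this, iteratedDeriv_eq_iterate, Real.iter_deriv_rpow_const, smul_eq_mul]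
      · have := congrFun (iteratedDeriv_comp_const_add (n := n - k)
          (f := fun y : ℝ => y ^ (β + n)) (s := (1 : ℝ))) x
        rw [this, iteratedDeriv_eq_iterate, Real.iter_deriv_rpow_const]
    · exact ((contDiffAt_const (c := (1 : ℝ))).sub contDiffAt_id).rpow_const_of_ne h1.ne'
    · exact ((contDiffAt_const (c := (1 : ℝ))).add contDiffAt_id).rpow_const_of_ne h2.ne'
  rw [jacobiP, key, jacPoly, Polynomial.eval_finsetSum, Finset.mul_sum]
  refine Finset.sum_congr rfl fun k hk => ?_
  have hk' : k ≤ n := Nat.lt_succ_iff.mp (Finset.mem_range.mp hk)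
  have e1 : (1 - x) ^ (α + n - k) = (1 - x) ^ α * (1 - x) ^ (n - k) := by
    rw [← Real.rpow_natCast, ← Real.rpow_add h1, Nat.cast_sub hk']; ring_nf
  have e2 : (1 + x) ^ (β + n - (n - k : ℕ)) = (1 + x) ^ β * (1 + x) ^ k := by
    rw [← Real.rpow_natCast, ← Real.rpow_add h2, Nat.cast_sub hk']; ring_nf
  have e3 : (1 - x) ^ (-α) * (1 - x) ^ α = 1 := by
    rw [← Real.rpow_add h1]; simp
  have e4 : (1 + x) ^ (-β) * (1 + x) ^ β = 1 := by
    rw [← Real.rpow_add h2]; simp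
  rw [e1, e2]
  simp only [Polynomial.eval_mul, Polynomial.eval_C, Polynomial.eval_pow, Polynomial.eval_sub,
    Polynomial.eval_add, Polynomial.eval_one, Polynomial.eval_X, jacCoef]
  calc _ = ((1 - x) ^ (-α) * (1 - x) ^ α) * ((1 + x) ^ (-β) * (1 + x) ^ β) *
        ((-1) ^ n / (2 ^ n * (n.factorial : ℝ)) * (n.choose k * ((-1) ^ k *
    (descPochhammer ℝ k).eval (α + n)) * (descPochhammer ℝ (n - k)).eval (β + n))
      * ((1 - x) ^ (n - k) * (1 + x) ^ k)) := by ring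
    _ = _ := by rw [e3, e4]; ring

/-- The two term recursion for the coefficients, which is division free and hence valid for all
parameters. -/
theorem jacCoef_succ (α β : ℝ) {n k : ℕ} (hk : k < n) :
    (k + 1) * (β + k + 1) * jacCoef α β n (k + 1) =
      -((n - k) * (α + n - k)) * jacCoef α β n k := by
  have h1 : ((n.choose (k + 1) : ℕ) : ℝ) * (k + 1) = n.choose k * (n - k) := by
    rw [← Nat.cast_sub hk.le]; exact_mod_cast Nat.choose_succ_right_eq n k
  obtain ⟨m, rfl⟩ : ∃ m, n = m + 1 + k := ⟨n - k - 1, by omega⟩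
  have h2 : m + 1 + k - (k + 1) = m := by omega
  have h3 : m + 1 + k - k = m + 1 := by omega
  simp only [jacCoef, h2, h3, descPochhammer_succ_eval]
  push_cast at h1 ⊢
  linear_combination (-1) ^ (m + 1 + k) / (2 ^ (m + 1 + k) * ((m + 1 + k).factorial : ℝ)) *
    (β + k + 1) * (-1) ^ (k + 1) * ((descPochhammer ℝ k).eval (α + (m + 1 + k)) *
      (α + (m + 1 + k) - k)) * (descPochhammer ℝ m).eval (β + (m + 1 + k)) * h1

open Polynomial in
theorem jacOp_sum {ι : Type*} (α β : ℝ) (s : Finset ι) (c : ι → ℝ) (p : ι → ℝ[X]) :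
    jacOp α β (∑ i ∈ s, C (c i) * p i) = ∑ i ∈ s, C (c i) * jacOp α β (p i) := by
  simp only [jacOp, derivative_sum, derivative_C_mul, Finset.mul_sum, ← Finset.sum_add_distrib]
  exact Finset.sum_congr rfl fun i _ => by ring

open Polynomial in
/-- In the homogeneous basis `(1 - x)^j (1 + x)^k` the Jacobi operator is tridiagonal. -/
theorem jacOp_basis (α β : ℝ) (j k : ℕ) :
    jacOp α β ((1 - X) ^ j * (1 + X) ^ k) =
      C (j * (j + α)) * ((1 - X) ^ (j - 1) * (1 + X) ^ (k + 1)) +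
      C (k * (k + β)) * ((1 - X) ^ (j + 1) * (1 + X) ^ (k - 1)) -
      C (2 * j * k + (β + 1) * j + (α + 1) * k) * ((1 - X) ^ j * (1 + X) ^ k) := by
  have hC : ∀ a : ℕ, (C (a : ℝ) : ℝ[X]) = (a : ℝ[X]) := fun a => by simp
  rcases j with _ | _ | j <;> rcases k with _ | _ | k <;>
  · simp only [jacOp, derivative_mul, derivative_pow, derivative_sub, derivative_add,
      derivative_one, derivative_X, Nat.add_sub_cancel, derivative_natCast, pow_zero,
      Nat.cast_zero, Nat.cast_add, Nat.cast_one, map_add, map_mul, map_sub, map_one, map_zero, hC,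
      zero_add, Nat.zero_sub, pow_one, Nat.sub_self, map_ofNat]
    ring

open Polynomial in
/-- The Jacobi differential equation. -/
theorem jacOp_jacPoly (α β : ℝ) (n : ℕ) :
    jacOp α β (jacPoly α β n) = C (-(n * (n + α + β + 1))) * jacPoly α β n := by
  set c := jacCoef α β n with hc
  rw [jacPoly, jacOp_sum, Finset.mul_sum]
  have hL : ∀ k ∈ Finset.range (n + 1), C (c k) * jacOp α β ((1 - X) ^ (n - k) * (1 + X) ^ k) =
      C (c k * ((n - k) * (n - k + α))) * ((1 - X) ^ (n - k - 1) * (1 + X) ^ (k + 1)) +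
      C (c k * (k * (k + β))) * ((1 - X) ^ (n - k + 1) * (1 + X) ^ (k - 1)) -
      C (c k * (2 * (n - k) * k + (β + 1) * (n - k) + (α + 1) * k)) *
        ((1 - X) ^ (n - k) * (1 + X) ^ k) := by
    intro k hk
    have hk' : k ≤ n := Nat.lt_succ_iff.mp (Finset.mem_range.mp hk)
    rw [jacOp_basis, Nat.cast_sub hk']
    simp only [map_mul]
    ring
  rw [Finset.sum_congr rfl hL, Finset.sum_sub_distrib, Finset.sum_add_distrib]
  -- shift the two off-diagonal sums so that the recursion for the coefficients applies
  have hA : ∑ k ∈ Finset.range (n + 1), C (c k * ((n - k) * (n - k + α))) *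
      ((1 - X) ^ (n - k - 1) * (1 + X) ^ (k + 1)) =
      ∑ k ∈ Finset.range (n + 1), C (-(c k * (k * (k + β)))) *
        (((1 : ℝ[X]) - X) ^ (n - k) * (1 + X) ^ k) := by
    rw [Finset.sum_range_succ, Finset.sum_range_succ']
    simp only [sub_self, zero_mul, mul_zero, map_zero, Nat.cast_zero, add_zero, neg_zero]
    refine Finset.sum_congr rfl fun k hk => ?_
    have hk' := Finset.mem_range.mp hk
    rw [Nat.sub_sub]
    congr 2
    have := jacCoef_succ α β hk'
    rw [← hc] at this
    push_cast
    linear_combination this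
  have hB : ∑ k ∈ Finset.range (n + 1), C (c k * (k * (k + β))) *
      ((1 - X) ^ (n - k + 1) * (1 + X) ^ (k - 1)) =
      ∑ k ∈ Finset.range (n + 1), C (-(c k * ((n - k) * (n - k + α)))) *
        (((1 : ℝ[X]) - X) ^ (n - k) * (1 + X) ^ k) := by
    rw [Finset.sum_range_succ', Finset.sum_range_succ _ n]
    simp only [sub_self, zero_mul, mul_zero, map_zero, Nat.cast_zero, add_zero, neg_zero]
    refine Finset.sum_congr rfl fun k hk => ?_
    have hk' := Finset.mem_range.mp hk
    have e : n - (k + 1) + 1 = n - k := by omega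
    rw [e, Nat.add_sub_cancel]
    congr 2
    have := jacCoef_succ α β hk'
    rw [← hc] at this
    push_cast
    linear_combination this
  rw [hA, hB, ← Finset.sum_add_distrib, ← Finset.sum_sub_distrib]
  refine Finset.sum_congr rfl fun k _ => ?_
  simp only [← add_mul, ← sub_mul, ← map_add, ← map_sub, ← mul_assoc, ← map_mul]
  congr 3
  ring

theorem jacPoly_eval_one_ne_zero {α : ℝ} (β : ℝ) (hα : -1 < α) (n : ℕ) :
    (jacPoly α β n).eval 1 ≠ 0 := by
  rw [jacPoly, Polynomial.eval_finsetSum, Finset.sum_eq_single n]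
  · have : (descPochhammer ℝ n).eval (α + n) ≠ 0 := (descPochhammer_pos (by linarith)).ne'
    simp [jacCoef, Nat.factorial_ne_zero, this]
  · intro k hk hkn
    have : n - k ≠ 0 := by have := Finset.mem_range.mp hk; omega
    simp [this]
  · simp

open Polynomial in
/-- The Jacobi operator does not raise the degree and acts on leading terms as on an eigenvector. -/
theorem jacOp_coeff_natDegree (α β : ℝ) (p : ℝ[X]) :
    (jacOp α β p).coeff p.natDegree =
      -(p.natDegree * (p.natDegree + α + β + 1)) * p.leadingCoeff := by
  have h1 : p.coeff (p.natDegree + 1) = 0 := coeff_eq_zero_of_natDegree_lt (by omega)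
  have h2 : p.coeff (p.natDegree + 2) = 0 := coeff_eq_zero_of_natDegree_lt (by omega)
  rw [leadingCoeff]
  have e : jacOp α β p = derivative (derivative p) - X ^ 2 * derivative (derivative p)
      + C (β - α) * derivative p - C (α + β + 2) * (X * derivative p) := by
    rw [jacOp]; ring
  rw [e, coeff_sub, coeff_add, coeff_sub, coeff_C_mul, coeff_C_mul]
  generalize p.natDegree = d at *
  rcases d with _ | _ | d
  · simp [coeff_derivative, h1, h2]
  · simp [coeff_derivative, h1, h2, coeff_X_pow_mul', coeff_X_mul]
    ring
  · rw [coeff_X_pow_mul, coeff_X_mul]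
    simp only [coeff_derivative] at h1 h2 ⊢
    simp only [h1, h2]
    push_cast
    ring

open Polynomial in
/-- A nonzero polynomial solution of the Jacobi equation has the degree that its eigenvalue
prescribes. -/
theorem natDegree_of_jacOp_eq {α β : ℝ} (hαβ : 0 ≤ α + β + 1) {p : ℝ[X]} (hp : p ≠ 0) {n : ℕ}
    (h : jacOp α β p = C (-(n * (n + α + β + 1))) * p) : p.natDegree = n := by
  have h1 := jacOp_coeff_natDegree α β p
  rw [h, coeff_C_mul, coeff_natDegree] at h1
  have h2 := mul_right_cancel₀ (leadingCoeff_ne_zero.mpr hp) h1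
  have h3 : ((p.natDegree : ℝ) - n) * (p.natDegree + n + (α + β + 1)) = 0 := by
    linear_combination h2
  rcases mul_eq_zero.mp h3 with h4 | h4
  · exact_mod_cast sub_eq_zero.mp h4
  -- the second factor vanishes only if `deg p = n = 0` and `α + β + 1 = 0`
  · have a : (0 : ℝ) ≤ p.natDegree := by positivity
    have b : (0 : ℝ) ≤ n := by positivity
    have a' : (p.natDegree : ℝ) = 0 := by linarith
    have b' : (n : ℝ) = 0 := by linarith
    exact_mod_cast a'.trans b'.symm

theorem jacPoly_ne_zero {α : ℝ} (β : ℝ) (hα : -1 < α) (n : ℕ) : jacPoly α β n ≠ 0 := fun h =>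
  jacPoly_eval_one_ne_zero β hα n (by simp [h])

theorem natDegree_jacPoly {α β : ℝ} (hα : -1 < α) (hαβ : 0 ≤ α + β + 1) (n : ℕ) :
    (jacPoly α β n).natDegree = n :=
  natDegree_of_jacOp_eq hαβ (jacPoly_ne_zero β hα n) (jacOp_jacPoly α β n)

open Polynomial in
/-- Differentiation intertwines the Jacobi operators with parameters `(α, β)` and
`(α + 1, β + 1)`. -/
theorem jacOp_derivative (α β : ℝ) (p : ℝ[X]) :
    jacOp (α + 1) (β + 1) (derivative p) =
      derivative (jacOp α β p) + C (α + β + 2) * derivative p := by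
  simp only [jacOp, derivative_mul, derivative_add, derivative_sub, derivative_one, derivative_C,
    derivative_X_pow, derivative_X, Nat.cast_ofNat, map_ofNat]
  rw [show α + 1 + (β + 1) + 2 = (α + β + 2) + 2 by ring, C_add (a := α + β + 2) (b := 2),
    show β + 1 - (α + 1) = β - α by ring, map_ofNat]
  ring

end SymJacobi

/-! ### The measure, Green's formula and orthogonality -/

namespace SymJacobi

open Polynomial

/-- The density of `muPlus α β`. -/
noncomputable def wt (α β θ : ℝ) : ℝ :=
  Real.sin (θ / 2) ^ (2 * α + 1) * Real.cos (θ / 2) ^ (2 * β + 1)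

/-- The logarithmic derivative of `wt α β`. -/
noncomputable def drift (α β θ : ℝ) : ℝ :=
  (α + 1 / 2) * Real.cot (θ / 2) - (β + 1 / 2) * Real.tan (θ / 2)

theorem sin_half_pos {θ : ℝ} (h : θ ∈ Ioo 0 Real.pi) : 0 < Real.sin (θ / 2) :=
  Real.sin_pos_of_pos_of_lt_pi (by linarith [h.1]) (by linarith [h.2, h.1])

theorem cos_half_pos {θ : ℝ} (h : θ ∈ Ioo 0 Real.pi) : 0 < Real.cos (θ / 2) :=
  Real.cos_pos_of_mem_Ioo ⟨by linarith [h.1, Real.pi_pos], by linarith [h.2]⟩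

theorem wt_pos {α β θ : ℝ} (h : θ ∈ Ioo 0 Real.pi) : 0 < wt α β θ :=
  mul_pos (Real.rpow_pos_of_pos (sin_half_pos h) _) (Real.rpow_pos_of_pos (cos_half_pos h) _)

theorem wt_nonneg {α β θ : ℝ} (h : θ ∈ Icc 0 Real.pi) : 0 ≤ wt α β θ := by
  have h1 : 0 ≤ Real.sin (θ / 2) :=
    Real.sin_nonneg_of_nonneg_of_le_pi (by linarith [h.1]) (by linarith [h.2, h.1])
  have h2 : 0 ≤ Real.cos (θ / 2) :=
    Real.cos_nonneg_of_mem_Icc ⟨by linarith [h.1, Real.pi_pos], by linarith [h.2]⟩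
  exact mul_nonneg (Real.rpow_nonneg h1 _) (Real.rpow_nonneg h2 _)

theorem continuous_wt {α β : ℝ} (hα : -1 / 2 ≤ α) (hβ : -1 / 2 ≤ β) : Continuous (wt α β) := by
  unfold wt
  exact ((by fun_prop : Continuous fun θ : ℝ => Real.sin (θ / 2)).rpow_const
    fun _ => Or.inr (by linarith)).mul
    ((by fun_prop : Continuous fun θ : ℝ => Real.cos (θ / 2)).rpow_const
    fun _ => Or.inr (by linarith))

theorem hasDerivAt_wt (α β : ℝ) {θ : ℝ} (h : θ ∈ Ioo 0 Real.pi) :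
    HasDerivAt (wt α β) (wt α β θ * drift α β θ) θ := by
  have hs := sin_half_pos h
  have hc := cos_half_pos h
  have h1 : HasDerivAt (fun θ : ℝ => Real.sin (θ / 2)) (Real.cos (θ / 2) * (1 / 2)) θ :=
    (Real.hasDerivAt_sin _).comp θ ((hasDerivAt_id θ).div_const 2)
  have h2 : HasDerivAt (fun θ : ℝ => Real.cos (θ / 2)) (-Real.sin (θ / 2) * (1 / 2)) θ :=
    (Real.hasDerivAt_cos _).comp θ ((hasDerivAt_id θ).div_const 2)
  have h3 := (h1.rpow_const (p := 2 * α + 1) (Or.inl hs.ne')).mul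
    (h2.rpow_const (p := 2 * β + 1) (Or.inl hc.ne'))
  refine h3.congr_deriv ?_
  rw [wt, drift, Real.cot_eq_cos_div_sin, Real.tan_eq_sin_div_cos,
    Real.rpow_sub_one hs.ne', Real.rpow_sub_one hc.ne']
  field_simp
  ring

theorem drift_mul_sin (α β : ℝ) {θ : ℝ} (h : θ ∈ Ioo 0 Real.pi) :
    drift α β θ * Real.sin θ = α - β + (α + β + 1) * Real.cos θ := by
  have hs := sin_half_pos h
  have hc := cos_half_pos h
  have e1 : Real.sin θ = 2 * Real.sin (θ / 2) * Real.cos (θ / 2) := by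
    rw [← Real.sin_two_mul]; ring_nf
  have e2 : Real.cos θ = Real.cos (θ / 2) ^ 2 - Real.sin (θ / 2) ^ 2 := by
    rw [← Real.cos_two_mul']; ring_nf
  rw [drift, Real.cot_eq_cos_div_sin, Real.tan_eq_sin_div_cos, e1, e2]
  field_simp
  linear_combination (α - β) * (Real.sin_sq_add_cos_sq (θ / 2))

theorem contDiffOn_drift (α β : ℝ) {n : WithTop ℕ∞} :
    ContDiffOn ℝ n (drift α β) (Ioo 0 Real.pi) := by
  have : drift α β = fun θ => (α + 1 / 2) * (Real.cos (θ / 2) / Real.sin (θ / 2)) -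
      (β + 1 / 2) * (Real.sin (θ / 2) / Real.cos (θ / 2)) := by
    funext θ; rw [drift, Real.cot_eq_cos_div_sin, Real.tan_eq_sin_div_cos]
  rw [this]
  have h1 : ContDiff ℝ n (fun θ : ℝ => Real.sin (θ / 2)) :=
    Real.contDiff_sin.comp (contDiff_id.div_const 2)
  have h2 : ContDiff ℝ n (fun θ : ℝ => Real.cos (θ / 2)) :=
    Real.contDiff_cos.comp (contDiff_id.div_const 2)
  exact (contDiffOn_const.mul (h2.contDiffOn.div h1.contDiffOn fun x hx => (sin_half_pos hx).ne')).sub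
    (contDiffOn_const.mul (h1.contDiffOn.div h2.contDiffOn fun x hx => (cos_half_pos hx).ne'))

theorem measurable_wt (α β : ℝ) : Measurable (wt α β) := by
  unfold wt; fun_prop

theorem muPlus_eq (α β : ℝ) : muPlus α β = (volume.restrict (Ioo 0 Real.pi)).withDensity
    fun θ => ENNReal.ofReal (wt α β θ) := rfl

theorem muPlus_absolutelyContinuous (α β : ℝ) : muPlus α β ≪ volume.restrict (Ioo 0 Real.pi) :=
  withDensity_absolutelyContinuous _ _

theorem ae_mem_Ioo (α β : ℝ) : ∀ᵐ θ ∂(muPlus α β), θ ∈ Ioo 0 Real.pi :=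
  (muPlus_absolutelyContinuous α β).ae_le (ae_restrict_mem measurableSet_Ioo)

theorem integral_muPlus (α β : ℝ) (g : ℝ → ℝ) :
    ∫ θ, g θ ∂(muPlus α β) = ∫ θ in (0 : ℝ)..Real.pi, wt α β θ * g θ := by
  rw [muPlus_eq, integral_withDensity_eq_integral_toReal_smul
    (measurable_wt α β).ennreal_ofReal (by simp), intervalIntegral.integral_of_le Real.pi_pos.le,
    ← integral_Ioc_eq_integral_Ioo]
  refine setIntegral_congr_ae measurableSet_Ioc (ae_of_all _ fun θ hθ => ?_)
  rw [ENNReal.toReal_ofReal (wt_nonneg ⟨hθ.1.le, hθ.2⟩), smul_eq_mul]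

theorem isFiniteMeasure_muPlus {α β : ℝ} (hα : -1 / 2 ≤ α) (hβ : -1 / 2 ≤ β) :
    IsFiniteMeasure (muPlus α β) := by
  rw [muPlus_eq]
  refine isFiniteMeasure_withDensity_ofReal (Integrable.hasFiniteIntegral ?_)
  exact ((continuous_wt hα hβ).integrableOn_Icc (a := 0) (b := Real.pi)).mono_set Ioo_subset_Icc_self

/-- Green's formula: the Jacobi operator is symmetric, with an explicit Dirichlet form. -/
theorem integral_jacOp_mul {α β : ℝ} (hα : -1 / 2 ≤ α) (hβ : -1 / 2 ≤ β) (p q : ℝ[X]) :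
    ∫ θ, (jacOp α β p).eval (Real.cos θ) * q.eval (Real.cos θ) ∂(muPlus α β) =
      -∫ θ, (Real.sin θ * (derivative p).eval (Real.cos θ)) *
        (Real.sin θ * (derivative q).eval (Real.cos θ)) ∂(muPlus α β) := by
  have hw := continuous_wt hα hβ
  rw [integral_muPlus, integral_muPlus, ← sub_eq_zero, sub_neg_eq_add,
    ← intervalIntegral.integral_add (Continuous.intervalIntegrable (by fun_prop) _ _)
      (Continuous.intervalIntegrable (by fun_prop) _ _), ← neg_eq_zero,
      ← intervalIntegral.integral_neg]
  -- the integrand is the derivative of `w · sin θ · p'(cos θ) · q(cos θ)`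
  rw [intervalIntegral.integral_eq_sub_of_hasDerivAt_of_le (f := fun θ => wt α β θ *
    (Real.sin θ * (derivative p).eval (Real.cos θ)) * q.eval (Real.cos θ)) Real.pi_pos.le]
  · simp
  · exact Continuous.continuousOn (by fun_prop)
  · intro θ hθ
    have hc : HasDerivAt Real.cos (-Real.sin θ) θ := Real.hasDerivAt_cos θ
    have h1 := (((hasDerivAt_wt α β hθ).mul ((Real.hasDerivAt_sin θ).mul
      (((derivative p).hasDerivAt (Real.cos θ)).comp θ hc))).mul
      ((q.hasDerivAt (Real.cos θ)).comp θ hc))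
    refine h1.congr_deriv ?_
    have hd := drift_mul_sin α β hθ
    have hs := Real.sin_sq_add_cos_sq θ
    simp only [jacOp, eval_add, eval_mul, eval_sub, eval_one, eval_pow, eval_X, eval_C,
      Function.comp_apply, Pi.mul_apply]
    linear_combination wt α β θ * eval (Real.cos θ) (derivative p) * eval (Real.cos θ) q * hd
      - wt α β θ * eval (Real.cos θ) (derivative (derivative p)) * eval (Real.cos θ) q * hs
  · exact Continuous.intervalIntegrable (by fun_prop) _ _

/-- The eigenvalues of minus the Jacobi operator. -/
noncomputable def kap (α β : ℝ) (n : ℕ) : ℝ := n * (n + α + β + 1)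

theorem eigenval_sub (α β : ℝ) (n : ℕ) : eigenval α β n - eigenval α β 0 = kap α β n := by
  simp only [eigenval, kap, Nat.cast_zero]; ring

theorem kap_nonneg {α β : ℝ} (h : 0 ≤ α + β + 1) (n : ℕ) : 0 ≤ kap α β n := by
  unfold kap
  have : (0 : ℝ) ≤ n := by positivity
  exact mul_nonneg this (by linarith)

theorem one_le_kap {α β : ℝ} (h : 0 ≤ α + β + 1) {n : ℕ} (hn : n ≠ 0) : 1 ≤ kap α β n := by
  unfold kap
  have : (1 : ℝ) ≤ n := by exact_mod_cast Nat.one_le_iff_ne_zero.mpr hn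
  nlinarith

theorem kap_injective {α β : ℝ} (h : 0 ≤ α + β + 1) : Function.Injective (kap α β) := by
  intro n m hnm
  have h3 : ((n : ℝ) - m) * (n + m + (α + β + 1)) = 0 := by
    unfold kap at hnm; linear_combination hnm
  rcases mul_eq_zero.mp h3 with h4 | h4
  · exact_mod_cast sub_eq_zero.mp h4
  · have a : (0 : ℝ) ≤ n := by positivity
    have b : (0 : ℝ) ≤ m := by positivity
    have a' : (n : ℝ) = 0 := by linarith
    have b' : (m : ℝ) = 0 := by linarith
    exact_mod_cast a'.trans b'.symm

/-- The Jacobi polynomials with the normalization of `Φ_{2n}`. -/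
noncomputable def nPoly (α β : ℝ) (n : ℕ) : ℝ[X] :=
  C (1 / Real.sqrt 2 * normFactor α β n) * jacPoly α β n

theorem jacOp_nPoly (α β : ℝ) (n : ℕ) :
    jacOp α β (nPoly α β n) = C (-kap α β n) * nPoly α β n := by
  have := jacOp_sum α β {()} (fun _ => 1 / Real.sqrt 2 * normFactor α β n)
    (fun _ => jacPoly α β n)
  simp only [Finset.sum_singleton] at this
  rw [nPoly, this, jacOp_jacPoly, kap]
  ring

theorem cos_mem_Ioo {θ : ℝ} (h : θ ∈ Ioo 0 Real.pi) : Real.cos θ ∈ Ioo (-1 : ℝ) 1 := by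
  constructor
  · rw [← Real.cos_pi]
    exact Real.cos_lt_cos_of_nonneg_of_le_pi h.1.le le_rfl h.2
  · rw [← Real.cos_zero]
    exact Real.cos_lt_cos_of_nonneg_of_le_pi le_rfl h.2.le h.1

theorem integral_sq_poly_pos {α β : ℝ} (hα : -1 / 2 ≤ α) (hβ : -1 / 2 ≤ β) {p : ℝ[X]}
    (hp : p ≠ 0) : 0 < ∫ θ, p.eval (Real.cos θ) ^ 2 ∂(muPlus α β) := by
  have hw := continuous_wt hα hβ
  rw [integral_muPlus]
  obtain ⟨x, hx, hpx⟩ : ∃ x ∈ Ioo (-1 : ℝ) 1, p.eval x ≠ 0 := by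
    by_contra! hcon
    exact hp (p.eq_zero_of_infinite_isRoot
      ((Ioo_infinite (by norm_num : (-1 : ℝ) < 1)).mono fun x hx => hcon x hx))
  have hx1 : Real.arccos x ∈ Ioo 0 Real.pi :=
    ⟨Real.arccos_pos.mpr hx.2, (Real.arccos_lt_pi.mpr hx.1)⟩
  refine intervalIntegral.integral_pos Real.pi_pos (Continuous.continuousOn (by fun_prop))
    (fun θ hθ => mul_nonneg (wt_nonneg ⟨hθ.1.le, hθ.2⟩) (sq_nonneg _))
    ⟨Real.arccos x, ⟨hx1.1.le, hx1.2.le⟩, ?_⟩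
  rw [Real.cos_arccos hx.1.le hx.2.le]
  exact mul_pos (wt_pos hx1) (by positivity)

theorem normFactor_eq (α β : ℝ) (n : ℕ) : normFactor α β n =
    (Real.sqrt (∫ θ, (jacPoly α β n).eval (Real.cos θ) ^ 2 ∂(muPlus α β)))⁻¹ := by
  rw [normFactor]
  congr 2
  refine integral_congr_ae ?_
  filter_upwards [ae_mem_Ioo α β] with θ hθ
  rw [jacobiP_eq_eval _ _ _ (cos_mem_Ioo hθ)]

theorem normFactor_pos {α β : ℝ} (hα : -1 / 2 ≤ α) (hβ : -1 / 2 ≤ β) (n : ℕ) :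
    0 < normFactor α β n := by
  rw [normFactor_eq]
  exact inv_pos.mpr (Real.sqrt_pos.mpr
    (integral_sq_poly_pos hα hβ (jacPoly_ne_zero β (by linarith) n)))

theorem natDegree_nPoly {α β : ℝ} (hα : -1 / 2 ≤ α) (hβ : -1 / 2 ≤ β) (n : ℕ) :
    (nPoly α β n).natDegree = n := by
  have := normFactor_pos hα hβ n
  rw [nPoly, natDegree_C_mul (by positivity), natDegree_jacPoly (by linarith) (by linarith)]

theorem nPoly_ne_zero {α β : ℝ} (hα : -1 / 2 ≤ α) (hβ : -1 / 2 ≤ β) (n : ℕ) :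
    nPoly α β n ≠ 0 := by
  have := normFactor_pos hα hβ n
  exact mul_ne_zero (C_ne_zero.mpr (by positivity)) (jacPoly_ne_zero β (by linarith) n)

theorem integral_nPoly_sq {α β : ℝ} (hα : -1 / 2 ≤ α) (hβ : -1 / 2 ≤ β) (n : ℕ) :
    ∫ θ, (nPoly α β n).eval (Real.cos θ) * (nPoly α β n).eval (Real.cos θ) ∂(muPlus α β) =
      1 / 2 := by
  have h1 := integral_sq_poly_pos hα hβ (jacPoly_ne_zero β (by linarith : -1 < α) n)
  have e : ∀ θ, (nPoly α β n).eval (Real.cos θ) * (nPoly α β n).eval (Real.cos θ) =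
      (1 / Real.sqrt 2 * normFactor α β n) ^ 2 * (jacPoly α β n).eval (Real.cos θ) ^ 2 := by
    intro θ; simp only [nPoly, eval_mul, eval_C]; ring
  simp_rw [e]
  rw [integral_const_mul, normFactor_eq, mul_pow, div_pow, Real.sq_sqrt (by norm_num), inv_pow,
    Real.sq_sqrt h1.le]
  field_simp

theorem integral_nPoly_mul {α β : ℝ} (hα : -1 / 2 ≤ α) (hβ : -1 / 2 ≤ β) {n m : ℕ}
    (h : n ≠ m) :
    ∫ θ, (nPoly α β n).eval (Real.cos θ) * (nPoly α β m).eval (Real.cos θ) ∂(muPlus α β) = 0 := by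
  have h1 := integral_jacOp_mul hα hβ (nPoly α β n) (nPoly α β m)
  have h2 := integral_jacOp_mul hα hβ (nPoly α β m) (nPoly α β n)
  simp only [jacOp_nPoly, eval_mul, eval_C, mul_assoc (-kap _ _ _), integral_const_mul] at h1 h2
  simp only [mul_comm (eval _ (nPoly α β m)) (eval _ (nPoly α β n))] at h2
  simp only [mul_comm (Real.sin _ * eval _ (derivative (nPoly α β m)))
    (Real.sin _ * eval _ (derivative (nPoly α β n)))] at h2
  have h3 := h1.trans h2.symm
  have h4 := (kap_injective (by linarith : 0 ≤ α + β + 1)).ne h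
  by_contra h5
  exact h4 (neg_injective (mul_right_cancel₀ h5 h3))

/-- The Dirichlet form on Jacobi polynomials: orthogonality and norms of the odd half of the system
reduce to those of the even half. -/
theorem integral_sin_nPoly_mul {α β : ℝ} (hα : -1 / 2 ≤ α) (hβ : -1 / 2 ≤ β) (n m : ℕ) :
    ∫ θ, (Real.sin θ * (derivative (nPoly α β n)).eval (Real.cos θ)) *
        (Real.sin θ * (derivative (nPoly α β m)).eval (Real.cos θ)) ∂(muPlus α β) =
      kap α β n * ∫ θ, (nPoly α β n).eval (Real.cos θ) * (nPoly α β m).eval (Real.cos θ)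
        ∂(muPlus α β) := by
  have h1 := integral_jacOp_mul hα hβ (nPoly α β n) (nPoly α β m)
  simp only [jacOp_nPoly, eval_mul, eval_C, mul_assoc (-kap _ _ _), integral_const_mul] at h1
  linarith

/-- The two halves of the symmetrized system, indexed by the degree of the underlying Jacobi
polynomial: `sysFun α β false n` is `Φ_{2n}` and `sysFun α β true n` is `Φ_{2n-1}`. For
`n = 0` the latter vanishes on `(0, π)` (a constant is differentiated). -/
noncomputable def sysFun (α β : ℝ) : Bool → ℕ → ℝ → ℝ
  | false, n, θ => 1 / Real.sqrt 2 * trigP α β n θ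
  | true, n, θ => -(1 / Real.sqrt 2) * (eigenval α β n - eigenval α β 0) ^ (-(1 / 2) : ℝ) *
      deriv (trigP α β n) θ

theorem Phi_even (α β : ℝ) (n : ℕ) : Phi α β (2 * n) = sysFun α β false n := by
  funext θ; simp [Phi, sysFun]

theorem Phi_odd (α β : ℝ) (n : ℕ) : Phi α β (2 * n + 1) = sysFun α β true (n + 1) := by
  have : (2 * n + 1 + 1) / 2 = n + 1 := by omega
  funext θ; simp [Phi, sysFun, this]

theorem sysFun_false (α β : ℝ) (n : ℕ) {θ : ℝ} (h : θ ∈ Ioo 0 Real.pi) :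
    sysFun α β false n θ = (nPoly α β n).eval (Real.cos θ) := by
  simp only [sysFun, trigP, jacobiP_eq_eval _ _ _ (cos_mem_Ioo h), nPoly, eval_mul, eval_C]
  ring

theorem sysFun_true (α β : ℝ) (n : ℕ) {θ : ℝ} (h : θ ∈ Ioo 0 Real.pi) :
    sysFun α β true n θ = kap α β n ^ (-(1 / 2) : ℝ) *
      (Real.sin θ * (derivative (nPoly α β n)).eval (Real.cos θ)) := by
  have h1 : trigP α β n =ᶠ[𝓝 θ] fun θ => normFactor α β n *
      (jacPoly α β n).eval (Real.cos θ) := by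
    filter_upwards [isOpen_Ioo.mem_nhds h] with x hx
    rw [trigP, jacobiP_eq_eval _ _ _ (cos_mem_Ioo hx)]
  have h2 := (((jacPoly α β n).hasDerivAt (Real.cos θ)).comp θ (Real.hasDerivAt_cos θ)).const_mul
    (normFactor α β n)
  simp only [Function.comp_def] at h2
  simp only [sysFun, eigenval_sub, h1.deriv_eq, h2.deriv, nPoly, derivative_C_mul, eval_mul,
    eval_C]
  ring

theorem integral_sysFun_mul {α β : ℝ} (hα : -1 / 2 ≤ α) (hβ : -1 / 2 ≤ β) (c : Bool) {n m : ℕ}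
    (h : n ≠ m) : ∫ θ, sysFun α β c n θ * sysFun α β c m θ ∂(muPlus α β) = 0 := by
  cases c
  · rw [← integral_nPoly_mul hα hβ h]
    refine integral_congr_ae ?_
    filter_upwards [ae_mem_Ioo α β] with θ hθ
    rw [sysFun_false _ _ _ hθ, sysFun_false _ _ _ hθ]
  · have := integral_sin_nPoly_mul hα hβ n m
    rw [integral_nPoly_mul hα hβ h, mul_zero] at this
    rw [← mul_zero (kap α β n ^ (-(1 / 2) : ℝ) * kap α β m ^ (-(1 / 2) : ℝ)), ← this,
      ← integral_const_mul]
    refine integral_congr_ae ?_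
    filter_upwards [ae_mem_Ioo α β] with θ hθ
    rw [sysFun_true _ _ _ hθ, sysFun_true _ _ _ hθ]
    ring

theorem integral_sysFun_sq {α β : ℝ} (hα : -1 / 2 ≤ α) (hβ : -1 / 2 ≤ β) (c : Bool) (n : ℕ)
    (hn : c = true → n ≠ 0) :
    ∫ θ, sysFun α β c n θ * sysFun α β c n θ ∂(muPlus α β) = 1 / 2 := by
  cases c
  · rw [← integral_nPoly_sq hα hβ n]
    refine integral_congr_ae ?_
    filter_upwards [ae_mem_Ioo α β] with θ hθ
    rw [sysFun_false _ _ _ hθ]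
  · have hk := one_le_kap (by linarith : 0 ≤ α + β + 1) (hn rfl)
    have := integral_sin_nPoly_mul hα hβ n n
    rw [integral_nPoly_sq hα hβ n] at this
    have e : (1 : ℝ) / 2 = (kap α β n ^ (-(1 / 2) : ℝ)) ^ 2 * (kap α β n * (1 / 2)) := by
      rw [← Real.rpow_natCast, ← Real.rpow_mul (by linarith)]
      norm_num
      rw [Real.rpow_neg_one]
      field_simp
    rw [e, ← this, ← integral_const_mul]
    refine integral_congr_ae ?_
    filter_upwards [ae_mem_Ioo α β] with θ hθ
    rw [sysFun_true _ _ _ hθ]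
    ring

theorem sysFun_true_zero {α β : ℝ} (hα : -1 / 2 ≤ α) (hβ : -1 / 2 ≤ β) {θ : ℝ}
    (h : θ ∈ Ioo 0 Real.pi) : sysFun α β true 0 θ = 0 := by
  rw [sysFun_true _ _ _ h, eq_C_of_natDegree_eq_zero (natDegree_nPoly hα hβ 0)]
  simp

/-- `δ Φ_{2n} = -√κ_n Φ_{2n-1}`. -/
theorem hasDerivAt_sysFun_false {α β : ℝ} (hα : -1 / 2 ≤ α) (hβ : -1 / 2 ≤ β) (n : ℕ) {θ : ℝ}
    (h : θ ∈ Ioo 0 Real.pi) : HasDerivAt (sysFun α β false n)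
      (-Real.sqrt (kap α β n) * sysFun α β true n θ) θ := by
  have h1 : sysFun α β false n =ᶠ[𝓝 θ] fun θ => (nPoly α β n).eval (Real.cos θ) := by
    filter_upwards [isOpen_Ioo.mem_nhds h] with x hx using sysFun_false α β n hx
  have h2 := ((nPoly α β n).hasDerivAt (Real.cos θ)).comp θ (Real.hasDerivAt_cos θ)
  refine (h2.congr_of_eventuallyEq h1).congr_deriv ?_
  rcases eq_or_ne n 0 with rfl | hn
  · rw [sysFun_true_zero hα hβ h, eq_C_of_natDegree_eq_zero (natDegree_nPoly hα hβ 0)]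
    simp
  · have hk := one_le_kap (by linarith : 0 ≤ α + β + 1) hn
    have e : Real.sqrt (kap α β n) * kap α β n ^ (-(1 / 2) : ℝ) = 1 := by
      rw [Real.sqrt_eq_rpow, ← Real.rpow_add (by linarith)]; norm_num
    rw [sysFun_true _ _ _ h]
    linear_combination (Real.sin θ * (derivative (nPoly α β n)).eval (Real.cos θ)) * e

/-- `δ* Φ_{2n-1} = -√κ_n Φ_{2n}`. -/
theorem hasDerivAt_sysFun_true {α β : ℝ} (hα : -1 / 2 ≤ α) (hβ : -1 / 2 ≤ β) (n : ℕ) {θ : ℝ}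
    (h : θ ∈ Ioo 0 Real.pi) : HasDerivAt (sysFun α β true n)
      (Real.sqrt (kap α β n) * sysFun α β false n θ - drift α β θ * sysFun α β true n θ) θ := by
  have hk := kap_nonneg (by linarith : 0 ≤ α + β + 1) n
  have h1 : sysFun α β true n =ᶠ[𝓝 θ] fun θ => kap α β n ^ (-(1 / 2) : ℝ) *
      (Real.sin θ * (derivative (nPoly α β n)).eval (Real.cos θ)) := by
    filter_upwards [isOpen_Ioo.mem_nhds h] with x hx using sysFun_true α β n hx
  have h2 := ((Real.hasDerivAt_sin θ).mul (((derivative (nPoly α β n)).hasDerivAt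
    (Real.cos θ)).comp θ (Real.hasDerivAt_cos θ))).const_mul (kap α β n ^ (-(1 / 2) : ℝ))
  refine (h2.congr_of_eventuallyEq h1).congr_deriv ?_
  have e : Real.sqrt (kap α β n) = kap α β n ^ (-(1 / 2) : ℝ) * kap α β n := by
    rcases hk.eq_or_lt with hk | hk
    · rw [← hk]; simp
    · rw [Real.sqrt_eq_rpow, ← Real.rpow_add_one hk.ne']; norm_num
  have hj := congrArg (eval (Real.cos θ)) (jacOp_nPoly α β n)
  simp only [jacOp, eval_add, eval_mul, eval_sub, eval_one, eval_pow, eval_X, eval_C] at hj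
  have hd := drift_mul_sin α β h
  have hs := Real.sin_sq_add_cos_sq θ
  rw [sysFun_true _ _ _ h, sysFun_false _ _ _ h, e]
  simp only [Function.comp_apply]
  set r := kap α β n ^ (-(1 / 2) : ℝ)
  linear_combination r * eval (Real.cos θ) (derivative (nPoly α β n)) * hd - r * hj -
    r * eval (Real.cos θ) (derivative (derivative (nPoly α β n))) * hs

end SymJacobi

/-! ### Operators defined by orthogonal series -/

namespace SymJacobi

section OrthogonalSeries

variable {𝕜 H E : Type*} [RCLike 𝕜] [NormedAddCommGroup H] [InnerProductSpace 𝕜 H]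
  [NormedAddCommGroup E] [NormedSpace 𝕜 E]

theorem norm_sq_sum_smul_le_of_orthogonal {v : ℕ → H}
    (hv : Pairwise fun i j => inner 𝕜 (v i) (v j) = 0) {K : ℝ} (hK : ∀ i, ‖v i‖ ^ 2 ≤ K) (s : Finset ℕ) (a : ℕ → 𝕜) :
    ‖∑ i ∈ s, a i • v i‖ ^ 2 ≤ K * ∑ i ∈ s, ‖a i‖ ^ 2 := by
  classical
  induction s using Finset.induction_on with
  | empty => simp
  | insert j s hj ih =>
    have h0 : inner 𝕜 (a j • v j) (∑ i ∈ s, a i • v i) = 0 := by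
      rw [inner_sum]
      refine Finset.sum_eq_zero fun i hi => ?_
      rw [inner_smul_left, inner_smul_right, @hv j i (fun h => hj (by rwa [h]))]
      simp
    rw [Finset.sum_insert hj, Finset.sum_insert hj, @norm_add_sq 𝕜, h0, norm_smul, mul_pow]
    have := mul_le_mul_of_nonneg_left (hK j) (sq_nonneg ‖a j‖)
    simp only [map_zero, mul_zero, add_zero]
    linarith

/-- Bessel's inequality for an orthogonal family in the closed unit ball. -/
theorem sum_norm_sq_inner_le {v : ℕ → H} (hv : Pairwise fun i j => inner 𝕜 (v i) (v j) = 0)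
    (hK : ∀ i, ‖v i‖ ^ 2 ≤ 1) (f : H) (s : Finset ℕ) :
    ∑ i ∈ s, ‖inner 𝕜 (v i) f‖ ^ 2 ≤ ‖f‖ ^ 2 := by
  set g := ∑ i ∈ s, inner 𝕜 (v i) f • v i with hg
  set S := ∑ i ∈ s, ‖inner 𝕜 (v i) f‖ ^ 2 with hS
  have h1 : inner 𝕜 g f = (S : 𝕜) := by
    rw [hg, sum_inner, hS]
    push_cast
    refine Finset.sum_congr rfl fun i _ => ?_
    rw [inner_smul_left, RCLike.conj_mul]
  have h2 : ‖g‖ ^ 2 ≤ 1 * S := norm_sq_sum_smul_le_of_orthogonal hv hK s _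
  have hS0 : 0 ≤ S := Finset.sum_nonneg fun i _ => sq_nonneg _
  have h3 : S ≤ ‖g‖ * ‖f‖ := by
    have := norm_inner_le_norm (𝕜 := 𝕜) g f
    rwa [h1, RCLike.norm_ofReal, abs_of_nonneg hS0] at this
  rcases hS0.eq_or_lt with h | h
  · rw [← h]; positivity
  · have h4 : S ^ 2 ≤ S * ‖f‖ ^ 2 := by
      calc S ^ 2 ≤ (‖g‖ * ‖f‖) ^ 2 := by gcongr
        _ = ‖g‖ ^ 2 * ‖f‖ ^ 2 := by ring
        _ ≤ S * ‖f‖ ^ 2 := by gcongr; linarith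
    nlinarith

/-- If the analysis map of `e` is bounded into `ℓ²` and the synthesis map of `v` is bounded on `ℓ²`,
then `f ↦ ∑ ⟨e n, f⟩ v n` is a bounded linear operator. -/
theorem exists_clm_hasSum [CompleteSpace E] {e : ℕ → H} {v : ℕ → E} {K : ℝ}
    (he : ∀ f s, ∑ i ∈ s, ‖inner 𝕜 (e i) f‖ ^ 2 ≤ ‖f‖ ^ 2)
    (hv : ∀ (s : Finset ℕ) (a : ℕ → 𝕜), ‖∑ i ∈ s, a i • v i‖ ^ 2 ≤ K * ∑ i ∈ s, ‖a i‖ ^ 2) :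
    ∃ T : H →L[𝕜] E, (∀ f, HasSum (fun n => inner 𝕜 (e n) f • v n) (T f)) ∧
      ∀ f, ‖T f‖ ^ 2 ≤ K * ‖f‖ ^ 2 := by
  have hK : 0 ≤ K := by
    have := hv {0} 1
    simp only [Finset.sum_singleton, Pi.one_apply, one_smul, norm_one, one_pow, mul_one] at this
    exact (sq_nonneg _).trans this
  have hsum : ∀ f, Summable fun n => inner 𝕜 (e n) f • v n := by
    intro f
    have h1 : Summable fun n => ‖inner 𝕜 (e n) f‖ ^ 2 :=
      summable_of_sum_le (fun _ => sq_nonneg _) (he f)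
    rw [summable_iff_vanishing_norm] at h1 ⊢
    intro ε hε
    obtain ⟨s, hs⟩ := h1 (ε ^ 2 / (K + 1)) (by positivity)
    refine ⟨s, fun t ht => ?_⟩
    have h2 := hs t ht
    rw [Real.norm_of_nonneg (Finset.sum_nonneg fun i _ => sq_nonneg _), lt_div_iff₀ (by linarith)] at h2
    have h3 := hv t (fun n => inner 𝕜 (e n) f)
    have h4 : 0 ≤ ∑ i ∈ t, ‖inner 𝕜 (e i) f‖ ^ 2 := Finset.sum_nonneg fun i _ => sq_nonneg _
    exact lt_of_pow_lt_pow_left₀ 2 hε.le (by nlinarith)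
  have hb : ∀ f, ‖∑' n, inner 𝕜 (e n) f • v n‖ ^ 2 ≤ K * ‖f‖ ^ 2 := by
    intro f
    refine le_of_tendsto ((hsum f).hasSum.norm.pow 2) (Eventually.of_forall fun s => ?_)
    exact (hv s _).trans (mul_le_mul_of_nonneg_left (he f s) hK)
  let L : H →ₗ[𝕜] E :=
    { toFun := fun f => ∑' n, inner 𝕜 (e n) f • v n
      map_add' := fun f g => by
        simp only [inner_add_right, add_smul]
        exact (hsum f).tsum_add (hsum g)
      map_smul' := fun c f => by
        simp only [inner_smul_right, mul_smul, RingHom.id_apply]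
        exact (hsum f).tsum_const_smul c }
  refine ⟨L.mkContinuous (Real.sqrt K) fun f => ?_, fun f => (hsum f).hasSum, hb⟩
  refine le_of_sq_le_sq ?_ (by positivity)
  rw [mul_pow, Real.sq_sqrt hK]
  exact hb f

end OrthogonalSeries

end SymJacobi

/-! ### The maximal theorem for symmetric positive resolvents -/

namespace SymJacobi

section MaximalResolvent

variable {X : Type*} [MeasurableSpace X] {μ : Measure X}

theorem lintegral_enorm_sq_eq {F : Type*} [NormedAddCommGroup F] (g : X → F) :
    ∫⁻ x, ‖g x‖ₑ ^ 2 ∂μ = eLpNorm g 2 μ ^ 2 := by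
  have := eLpNorm_nnreal_pow_eq_lintegral (f := g) (μ := μ) (p := 2) (by norm_num)
  simp only [NNReal.coe_ofNat, ENNReal.rpow_ofNat, ENNReal.coe_ofNat] at this
  exact this.symm

theorem inner_nonneg_of_nonneg {f g : Lp ℝ 2 μ} (hf : 0 ≤ f) (hg : 0 ≤ g) :
    0 ≤ inner ℝ f g := by
  rw [L2.inner_def]
  refine integral_nonneg_of_ae ?_
  filter_upwards [(Lp.coeFn_nonneg f).mpr hf, (Lp.coeFn_nonneg g).mpr hg] with x h1 h2
  exact mul_nonneg h2 h1

/-- The resolvents `R t = (1 + t L)⁻¹`, `t > 0`, of a symmetric operator `L` on real `L²`, as bounded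
operators: symmetric, positivity preserving contractions that satisfy the resolvent identity. -/
structure IsPositiveResolvent (R : ℝ → Lp ℝ 2 μ →L[ℝ] Lp ℝ 2 μ) : Prop where
  nonneg : ∀ t, 0 < t → ∀ f, 0 ≤ f → 0 ≤ R t f
  symm : ∀ t, 0 < t → ∀ f g, inner ℝ (R t f) g = inner ℝ f (R t g)
  contr : ∀ t, 0 < t → ∀ f, ‖R t f‖ ≤ ‖f‖
  resolvent : ∀ s r, 0 < s → 0 < r → ∀ f, s • R s f - r • R r f = (s - r) • R s (R r f)

namespace IsPositiveResolvent

variable {R : ℝ → Lp ℝ 2 μ →L[ℝ] Lp ℝ 2 μ}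

/-- In the sense of positive operators `R s R r ≤ 4 R (2 s)` for `r ≤ s`. -/
theorem inner_comp_le (hR : IsPositiveResolvent R) {s r : ℝ} (hr : 0 < r) (hrs : r ≤ s)
    {f g : Lp ℝ 2 μ} (hf : 0 ≤ f) (hg : 0 ≤ g) :
    inner ℝ (R s (R r f)) g ≤ 4 * inner ℝ (R (2 * s) f) g := by
  have hs : 0 < s := hr.trans_le hrs
  have h2s : 0 < 2 * s := by linarith
  have hrf := hR.nonneg r hr f hf
  have e1 := congrArg (fun h => inner ℝ h g) (hR.resolvent (2 * s) s h2s hs (R r f))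
  have e2 := congrArg (fun h => inner ℝ h g) (hR.resolvent (2 * s) r h2s hr f)
  simp only [inner_sub_left, real_inner_smul_left] at e1 e2
  have p1 := inner_nonneg_of_nonneg (hR.nonneg (2 * s) h2s _ (hR.nonneg s hs _ hrf)) hg
  have p2 := inner_nonneg_of_nonneg hrf hg
  have p3 := inner_nonneg_of_nonneg (hR.nonneg (2 * s) h2s _ hf) hg
  -- twice the resolvent identity, for the times `(2 s, s)` and `(2 s, r)`
  have q1 : inner ℝ (R s (R r f)) g ≤ 2 * inner ℝ (R (2 * s) (R r f)) g := by
    have : s * inner ℝ (R s (R r f)) g ≤ s * (2 * inner ℝ (R (2 * s) (R r f)) g) := by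
      nlinarith
    exact le_of_mul_le_mul_left this hs
  have q2 : inner ℝ (R (2 * s) (R r f)) g ≤ 2 * inner ℝ (R (2 * s) f) g := by
    have : (2 * s - r) * inner ℝ (R (2 * s) (R r f)) g ≤
        (2 * s - r) * (2 * inner ℝ (R (2 * s) f) g) := by
      nlinarith [mul_nonneg hr.le p2, mul_nonneg (sub_nonneg.mpr hrs) p3]
    exact le_of_mul_le_mul_left this (by linarith)
  linarith

theorem inner_apply_apply_le (hR : IsPositiveResolvent R) {s r : ℝ} (hs : 0 < s) (hr : 0 < r)
    {f g : Lp ℝ 2 μ} (hf : 0 ≤ f) (hg : 0 ≤ g) :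
    inner ℝ (R s f) (R r g) ≤ 4 * inner ℝ (R (2 * s) f) g + 4 * inner ℝ f (R (2 * r) g) := by
  have p1 := inner_nonneg_of_nonneg (hR.nonneg (2 * s) (by linarith) _ hf) hg
  have p2 := inner_nonneg_of_nonneg hf (hR.nonneg (2 * r) (by linarith) _ hg)
  rcases le_total r s with h | h
  · have := hR.inner_comp_le hr h hg hf
    rw [hR.symm s hs, hR.symm (2 * s) (by linarith)] at this
    linarith [real_inner_comm (R s f) (R r g), real_inner_comm (R (2 * s) f) g]
  · have := hR.inner_comp_le hs h hf hg
    rw [hR.symm r hr, hR.symm (2 * r) (by linarith)] at this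
    linarith

/-- The quadratic estimate: expand the square and apply `R s R r ≤ 4 R (2 s)` to each product, `s`
being the larger of the two times. -/
theorem norm_sq_sum_le (hR : IsPositiveResolvent R) (N : ℕ) {t : ℕ → ℝ} (ht : ∀ i, 0 < t i)
    {g : ℕ → Lp ℝ 2 μ} (hg : ∀ i, 0 ≤ g i) :
    ‖∑ i ∈ Finset.range N, R (t i) (g i)‖ ^ 2 ≤
      8 * ‖∑ i ∈ Finset.range N, g i‖ * ‖∑ i ∈ Finset.range N, R (2 * t i) (g i)‖ := by
  have h1 : ‖∑ i ∈ Finset.range N, R (t i) (g i)‖ ^ 2 ≤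
      8 * inner ℝ (∑ i ∈ Finset.range N, R (2 * t i) (g i)) (∑ i ∈ Finset.range N, g i) := by
    rw [← real_inner_self_eq_norm_sq, sum_inner]
    calc _ ≤ ∑ i ∈ Finset.range N, ∑ j ∈ Finset.range N,
          (4 * inner ℝ (R (2 * t i) (g i)) (g j) + 4 * inner ℝ (g i) (R (2 * t j) (g j))) := by
          refine Finset.sum_le_sum fun i _ => ?_
          rw [inner_sum]
          exact Finset.sum_le_sum fun j _ =>
            hR.inner_apply_apply_le (ht i) (ht j) (hg i) (hg j)
      _ = 4 * inner ℝ (∑ i ∈ Finset.range N, R (2 * t i) (g i)) (∑ i ∈ Finset.range N, g i) +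
          4 * inner ℝ (∑ i ∈ Finset.range N, g i)
            (∑ i ∈ Finset.range N, R (2 * t i) (g i)) := by
          simp only [sum_inner, inner_sum, Finset.mul_sum, Finset.sum_add_distrib]
          congr 1 <;> rw [Finset.sum_comm]
      _ = _ := by rw [real_inner_comm (∑ i ∈ Finset.range N, g i)]; ring
  have h2 := real_inner_le_norm (∑ i ∈ Finset.range N, R (2 * t i) (g i))
    (∑ i ∈ Finset.range N, g i)
  linarith

/-- A bounded sequence with `x j ^ 2 ≤ c * x (j + 1)` is bounded by `c`. -/
theorem le_of_sq_le_mul_succ {x : ℕ → ℝ} {B c : ℝ} (hc : 0 ≤ c) (h0 : ∀ j, 0 ≤ x j)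
    (hB : ∀ j, x j ≤ B) (h : ∀ j, x j ^ 2 ≤ c * x (j + 1)) : x 0 ≤ c := by
  have hbdd : BddAbove (range x) := ⟨B, by rintro _ ⟨j, rfl⟩; exact hB j⟩
  set M := ⨆ j, x j with hM
  have h1 : ∀ j, x j ≤ M := fun j => le_ciSup hbdd j
  have hM0 : 0 ≤ M := (h0 0).trans (h1 0)
  have h2 : M ≤ Real.sqrt (c * M) := ciSup_le fun j => Real.le_sqrt_of_sq_le
    ((h j).trans (mul_le_mul_of_nonneg_left (h1 _) hc))
  have h3 : M ^ 2 ≤ c * M := by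
    have := pow_le_pow_left₀ hM0 h2 2
    rwa [Real.sq_sqrt (by positivity)] at this
  have h4 : M ≤ c := by
    rcases hM0.eq_or_lt with h | h
    · rw [← h]; exact hc
    · nlinarith
  exact (h1 0).trans h4

/-- The dual form of the maximal inequality. Doubling all times and using the trivial bound by
`∑ ‖g i‖`, uniform in the times, turns the quadratic estimate into a linear one. -/
theorem norm_sum_le (hR : IsPositiveResolvent R) (N : ℕ) {t : ℕ → ℝ} (ht : ∀ i, 0 < t i)
    {g : ℕ → Lp ℝ 2 μ} (hg : ∀ i, 0 ≤ g i) :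
    ‖∑ i ∈ Finset.range N, R (t i) (g i)‖ ≤ 8 * ‖∑ i ∈ Finset.range N, g i‖ := by
  have := le_of_sq_le_mul_succ (x := fun j => ‖∑ i ∈ Finset.range N, R (2 ^ j * t i) (g i)‖)
    (B := ∑ i ∈ Finset.range N, ‖g i‖) (c := 8 * ‖∑ i ∈ Finset.range N, g i‖) (by positivity)
    (fun j => norm_nonneg _)
    (fun j => (_root_.norm_sum_le _ _).trans (Finset.sum_le_sum fun i _ =>
      hR.contr _ (by have := ht i; positivity) _))
    (fun j => by
      have := hR.norm_sq_sum_le N (t := fun i => 2 ^ j * t i)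
        (fun i => by have := ht i; positivity) hg
      simpa only [pow_succ', mul_assoc] using this)
  simpa using this

/-- Splitting a nonnegative function along the set where `b ≤ a` linearizes the supremum `a ⊔ b`. -/
theorem exists_split {S : Lp ℝ 2 μ} (hS : 0 ≤ S) (a b : Lp ℝ 2 μ) :
    ∃ S₁ S₂ : Lp ℝ 2 μ, 0 ≤ S₁ ∧ 0 ≤ S₂ ∧ S₁ + S₂ = S ∧
      inner ℝ S₁ a + inner ℝ S₂ b = inner ℝ S (a ⊔ b) := by
  set A : Set X := {x | b x ≤ a x} with hA
  have hAm : MeasurableSet A := measurableSet_le (Lp.stronglyMeasurable b).measurable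
    (Lp.stronglyMeasurable a).measurable
  have m1 := (Lp.memLp S).indicator hAm
  have m2 := (Lp.memLp S).indicator hAm.compl
  have hS' := (Lp.coeFn_nonneg S).mpr hS
  have hsum : m1.toLp + m2.toLp = S := by
    rw [← MemLp.toLp_add]
    refine Lp.ext ?_
    filter_upwards [MemLp.coeFn_toLp (m1.add m2)] with x hx
    rw [hx]
    exact congrFun (indicator_self_add_compl A (S : X → ℝ)) x
  refine ⟨m1.toLp, m2.toLp, ?_, ?_, hsum, ?_⟩
  · rw [← Lp.coeFn_nonneg]
    filter_upwards [MemLp.coeFn_toLp m1, hS'] with x hx h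
    rw [hx, Set.indicator_apply]; split_ifs
    exacts [h, le_rfl]
  · rw [← Lp.coeFn_nonneg]
    filter_upwards [MemLp.coeFn_toLp m2, hS'] with x hx h
    rw [hx, Set.indicator_apply]; split_ifs
    exacts [h, le_rfl]
  · rw [L2.inner_def, L2.inner_def, L2.inner_def,
      ← integral_add (L2.integrable_inner _ _) (L2.integrable_inner _ _)]
    refine integral_congr_ae ?_
    filter_upwards [MemLp.coeFn_toLp m1, MemLp.coeFn_toLp m2, Lp.coeFn_sup a b] with x h1 h2 h3
    rw [h1, h2, h3, Pi.sup_apply]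
    by_cases hx : x ∈ A
    · have : b x ≤ a x := hx
      simp [hx, this]
    · have : a x ≤ b x := (not_le.mp hx).le
      simp [hx, this]

/-- Linearization of a finite supremum: `S` splits into nonnegative parts `g i`, supported where
`F i` attains the supremum. -/
theorem exists_decomposition (F : ℕ → Lp ℝ 2 μ) (N : ℕ) {S : Lp ℝ 2 μ} (hS : 0 ≤ S) :
    ∃ g : ℕ → Lp ℝ 2 μ, (∀ i, 0 ≤ g i) ∧ ∑ i ∈ Finset.range (N + 1), g i = S ∧
      ∑ i ∈ Finset.range (N + 1), inner ℝ (g i) (F i) = inner ℝ S (partialSups F N) := by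
  induction N generalizing S with
  | zero => exact ⟨fun _ => S, fun _ => hS, by simp, by simp⟩
  | succ N ih =>
    obtain ⟨S₁, S₂, h1, h2, h3, h4⟩ := exists_split hS (partialSups F N) (F (N + 1))
    obtain ⟨g, hg1, hg2, hg3⟩ := ih h1
    have hne : ∀ i ∈ Finset.range (N + 1), i ≠ N + 1 := fun i hi =>
      (Finset.mem_range.mp hi).ne
    refine ⟨fun i => if i = N + 1 then S₂ else g i, fun i => ?_, ?_, ?_⟩
    · dsimp only; split_ifs
      exacts [h2, hg1 i]
    · rw [Finset.sum_range_succ, if_pos rfl,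
        Finset.sum_congr rfl fun i hi => if_neg (hne i hi), hg2, h3]
    · rw [Finset.sum_range_succ, partialSups_add_one, ← h4, ← hg3]
      dsimp only
      rw [if_pos rfl]
      congr 1
      exact Finset.sum_congr rfl fun i hi => by rw [if_neg (hne i hi)]

theorem abs_apply_le (hR : IsPositiveResolvent R) {t : ℝ} (ht : 0 < t) (f : Lp ℝ 2 μ) :
    |R t f| ≤ R t |f| := by
  refine abs_le'.mpr ⟨?_, ?_⟩
  · rw [← sub_nonneg, ← map_sub]
    exact hR.nonneg t ht _ (sub_nonneg.mpr (le_abs_self f))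
  · rw [← sub_nonneg, ← map_neg, ← map_sub]
    exact hR.nonneg t ht _ (sub_nonneg.mpr (neg_le_abs f))

/-- The maximal theorem for finitely many times, by duality: linearize the supremum `S` and test it
against itself. -/
theorem norm_partialSups_le (hR : IsPositiveResolvent R) {t : ℕ → ℝ} (ht : ∀ i, 0 < t i)
    (N : ℕ) (f : Lp ℝ 2 μ) : ‖partialSups (fun i => R (t i) |f|) N‖ ≤ 8 * ‖f‖ := by
  set F : ℕ → Lp ℝ 2 μ := fun i => R (t i) |f| with hF
  set S := partialSups F N with hS
  have hS0 : 0 ≤ S := (hR.nonneg _ (ht 0) _ (abs_nonneg f)).trans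
    (le_partialSups_of_le F (Nat.zero_le N))
  obtain ⟨g, hg1, hg2, hg3⟩ := exists_decomposition F N hS0
  have h1 : ‖S‖ ^ 2 ≤ 8 * ‖S‖ * ‖f‖ := by
    calc ‖S‖ ^ 2 = inner ℝ S S := (real_inner_self_eq_norm_sq S).symm
      _ = inner ℝ (∑ i ∈ Finset.range (N + 1), R (t i) (g i)) |f| := by
        rw [← hg3, sum_inner]
        exact Finset.sum_congr rfl fun i _ => (hR.symm _ (ht i) _ _).symm
      _ ≤ ‖∑ i ∈ Finset.range (N + 1), R (t i) (g i)‖ * ‖|f|‖ := real_inner_le_norm _ _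
      _ ≤ 8 * ‖S‖ * ‖f‖ := by
        rw [norm_abs_eq_norm]
        gcongr
        rw [← hg2]
        exact hR.norm_sum_le _ ht hg1
  rcases (norm_nonneg S).eq_or_lt with h | h
  · rw [← h]; positivity
  · nlinarith

/-- The maximal theorem for a countable set of times. -/
theorem exists_maximal (hR : IsPositiveResolvent R) {t : ℕ → ℝ} (ht : ∀ i, 0 < t i)
    (f : Lp ℝ 2 μ) : ∃ M : X → ℝ≥0∞, AEMeasurable M μ ∧
      (∀ᵐ x ∂μ, ∀ i, ‖R (t i) f x‖ₑ ≤ M x) ∧ ∫⁻ x, M x ^ 2 ∂μ ≤ 64 * ‖f‖ₑ ^ 2 := by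
  set F : ℕ → Lp ℝ 2 μ := fun i => R (t i) |f| with hF
  set S : ℕ → Lp ℝ 2 μ := fun N => partialSups F N with hS
  have hmono : ∀ᵐ x ∂μ, ∀ N, S N x ≤ S (N + 1) x := ae_all_iff.mpr fun N =>
    (Lp.coeFn_le _ _).mpr ((partialSups F).monotone (Nat.le_succ N))
  have hpos : ∀ᵐ x ∂μ, ∀ N, 0 ≤ S N x := ae_all_iff.mpr fun N =>
    (Lp.coeFn_nonneg _).mpr ((hR.nonneg _ (ht 0) _ (abs_nonneg f)).trans
      (le_partialSups_of_le F (Nat.zero_le N)))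
  have hle : ∀ᵐ x ∂μ, ∀ i, |R (t i) f x| ≤ S i x := ae_all_iff.mpr fun i => by
    have h1 : |R (t i) f| ≤ S i := (hR.abs_apply_le (ht i) f).trans (le_partialSups F i)
    filter_upwards [(Lp.coeFn_le _ _).mpr h1, Lp.coeFn_abs (R (t i) f)] with x hx hx'
    rwa [← hx']
  refine ⟨fun x => ⨆ N, ‖S N x‖ₑ, AEMeasurable.iSup fun N =>
    (Lp.stronglyMeasurable (S N)).measurable.enorm.aemeasurable, ?_, ?_⟩
  · filter_upwards [hle] with x hx i
    refine le_trans ?_ (le_iSup (fun N => ‖S N x‖ₑ) i)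
    rw [← ofReal_norm, ← ofReal_norm]
    refine ENNReal.ofReal_le_ofReal ?_
    exact (hx i).trans (le_abs_self _)
  · have e : ∀ x, (⨆ N, ‖S N x‖ₑ) ^ 2 = ⨆ N, ‖S N x‖ₑ ^ 2 := fun x =>
      ENNReal.iSup_pow_of_ne_zero (by norm_num) _
    simp_rw [e]
    rw [lintegral_iSup' (fun N =>
      ((Lp.stronglyMeasurable (S N)).measurable.enorm.pow_const 2).aemeasurable)]
    · refine iSup_le fun N => ?_
      rw [lintegral_enorm_sq_eq]
      have h2 : ‖S N‖ₑ ≤ 8 * ‖f‖ₑ := by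
        have h8 : (8 : ℝ≥0∞) = ENNReal.ofReal 8 := by simp
        rw [← ofReal_norm, ← ofReal_norm, h8, ← ENNReal.ofReal_mul (by norm_num)]
        exact ENNReal.ofReal_le_ofReal (hR.norm_partialSups_le ht N f)
      calc eLpNorm (S N) 2 μ ^ 2 = ‖S N‖ₑ ^ 2 := by rw [Lp.enorm_def]
        _ ≤ (8 * ‖f‖ₑ) ^ 2 := by gcongr
        _ = 64 * ‖f‖ₑ ^ 2 := by rw [mul_pow]; norm_num
    · filter_upwards [hmono, hpos] with x h1 h2
      refine monotone_nat_of_le_succ fun N => ?_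
      gcongr ?_ ^ 2
      rw [← ofReal_norm, ← ofReal_norm]
      refine ENNReal.ofReal_le_ofReal ?_
      rw [Real.norm_of_nonneg (h2 _), Real.norm_of_nonneg (h2 _)]
      exact h1 N

end IsPositiveResolvent

end MaximalResolvent

end SymJacobi

/-! ### Positivity of the Jacobi resolvents -/

namespace SymJacobi

open Polynomial

/-- At a minimum over `[-1, 1]` the Jacobi operator is nonnegative: the second order part degenerates
at the end points, where the first order part points inwards. -/
theorem jacOp_eval_nonneg_of_isMinOn {a b : ℝ} (ha : -1 < a) (hb : -1 < b) {Q : ℝ[X]} {x : ℝ}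
    (hx : x ∈ Icc (-1 : ℝ) 1) (hmin : IsMinOn (fun y => Q.eval y) (Icc (-1 : ℝ) 1) x) :
    0 ≤ (jacOp a b Q).eval x := by
  have hmin' : ∀ y ∈ Icc (-1 : ℝ) 1, Q.eval x ≤ Q.eval y := fun y hy => hmin hy
  have hder : Tendsto (slope (fun y => Q.eval y) x) (𝓝[≠] x) (𝓝 ((derivative Q).eval x)) :=
    (Q.hasDerivAt x).tendsto_slope
  simp only [jacOp, eval_add, eval_mul, eval_sub, eval_one, eval_pow, eval_X, eval_C]
  rcases hx.1.eq_or_lt with h | h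
  · subst h
    have h1 : 0 ≤ (derivative Q).eval (-1) := by
      refine ge_of_tendsto (hder.mono_left (nhdsGT_le_nhdsNE _)) ?_
      filter_upwards [Ioo_mem_nhdsGT (by norm_num : (-1 : ℝ) < 1)] with y hy
      rw [slope_def_field]
      exact div_nonneg (sub_nonneg.mpr (hmin' y ⟨hy.1.le, hy.2.le⟩)) (by linarith [hy.1])
    nlinarith
  rcases hx.2.eq_or_lt with h' | h'
  · subst h'
    have h1 : (derivative Q).eval 1 ≤ 0 := by
      refine le_of_tendsto (hder.mono_left (nhdsLT_le_nhdsNE _)) ?_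
      filter_upwards [Ioo_mem_nhdsLT (by norm_num : (-1 : ℝ) < 1)] with y hy
      rw [slope_def_field]
      exact div_nonpos_of_nonneg_of_nonpos (sub_nonneg.mpr (hmin' y ⟨hy.1.le, hy.2.le⟩))
        (by linarith [hy.2])
    nlinarith
  · have hloc : IsLocalMin (fun y => Q.eval y) x := hmin.isLocalMin (Icc_mem_nhds h h')
    have hd1 : deriv (fun y => Q.eval y) = fun y => (derivative Q).eval y :=
      funext fun y => (Q.hasDerivAt y).deriv
    have hd2 : deriv (fun y => (derivative Q).eval y) = fun y =>
        (derivative (derivative Q)).eval y :=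
      funext fun y => ((derivative Q).hasDerivAt y).deriv
    have h1 : (derivative Q).eval x = 0 := by
      have := hloc.deriv_eq_zero
      rwa [hd1] at this
    have h2 : 0 ≤ (derivative (derivative Q)).eval x := by
      by_contra! hneg
      -- otherwise `x` is also a local maximum, so `Q` is locally constant
      have hmax : IsLocalMax (fun y => Q.eval y) x :=
        isLocalMax_of_deriv_deriv_neg (by rw [hd1, hd2]; exact hneg) (by rw [hd1]; exact h1)
          (by fun_prop)
      have hconst : (fun y => Q.eval y) =ᶠ[𝓝 x] fun _ => Q.eval x := by
        filter_upwards [hloc, hmax] with y hy1 hy2 using le_antisymm hy2 hy1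
      have h3 := hconst.deriv.deriv_eq
      rw [hd1, hd2] at h3
      simp only [deriv_const', deriv_const] at h3
      exact hneg.ne h3
    rw [h1, mul_zero, add_zero]
    exact mul_nonneg (by nlinarith) h2

/-- The maximum principle for the resolvent equation. -/
theorem eval_nonneg_of_resolvent_eq {a b : ℝ} (ha : -1 < a) (hb : -1 < b) {c t : ℝ} (hc : 0 < c)
    (ht : 0 ≤ t) {Q q : ℝ[X]} (h : C c * Q - C t * jacOp a b Q = q)
    (hq : ∀ x ∈ Icc (-1 : ℝ) 1, 0 ≤ q.eval x) : ∀ x ∈ Icc (-1 : ℝ) 1, 0 ≤ Q.eval x := by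
  obtain ⟨x₀, hx₀, hmin⟩ := (isCompact_Icc (a := (-1 : ℝ)) (b := 1)).exists_isMinOn
    ⟨0, by norm_num⟩ (f := fun y => Q.eval y) (by fun_prop)
  have h1 := jacOp_eval_nonneg_of_isMinOn ha hb hx₀ hmin
  have h2 := hq x₀ hx₀
  rw [← h] at h2
  simp only [eval_sub, eval_mul, eval_C] at h2
  have h3 : 0 ≤ c * Q.eval x₀ := by nlinarith [mul_nonneg ht h1]
  intro x hx
  exact (nonneg_of_mul_nonneg_right h3 hc).trans (hmin hx)

theorem cos_mem_Icc (θ : ℝ) : Real.cos θ ∈ Icc (-1 : ℝ) 1 :=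
  ⟨Real.neg_one_le_cos θ, Real.cos_le_one θ⟩

/-- Nonnegative functions in `L²` of a finite measure on `(0, π)` are limits of polynomials in
`cos θ` that are nonnegative. -/
theorem exists_nonneg_poly_near {ν : Measure ℝ} [IsFiniteMeasure ν]
    (hν : ∀ᵐ θ ∂ν, θ ∈ Ioo 0 Real.pi) {f : ℝ → ℝ} (hf : MemLp f 2 ν) (h0 : 0 ≤ᵐ[ν] f)
    {ε : ℝ} (hε : 0 < ε) : ∃ p : ℝ[X], (∀ x ∈ Icc (-1 : ℝ) 1, 0 ≤ p.eval x) ∧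
      eLpNorm (fun θ => f θ - p.eval (Real.cos θ)) 2 ν ≤ ENNReal.ofReal ε := by
  obtain ⟨g, hg, hgm⟩ := hf.exists_boundedContinuous_eLpNorm_sub_le (by norm_num)
    (ε := ENNReal.ofReal (ε / 2)) (by simpa using hε)
  set G : ℝ → ℝ := fun θ => max (g θ) 0 with hG
  have hGc : Continuous G := g.continuous.max continuous_const
  have h1 : eLpNorm (fun θ => f θ - G θ) 2 ν ≤ ENNReal.ofReal (ε / 2) := by
    refine le_trans (eLpNorm_mono_ae ?_) hg
    filter_upwards [h0] with θ hθ
    simp only [Pi.zero_apply] at hθ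
    simp only [Pi.sub_apply, hG, Real.norm_eq_abs]
    rcases max_cases (g θ) 0 with ⟨h, h'⟩ | ⟨h, h'⟩
    · rw [h]
    · rw [h, sub_zero, abs_of_nonneg hθ, abs_of_nonneg (by linarith)]; linarith
  set K : ℝ := (ν univ ^ ((2 : ℝ≥0∞).toReal)⁻¹).toReal with hK
  have hKtop : ν univ ^ ((2 : ℝ≥0∞).toReal)⁻¹ ≠ ∞ :=
    ENNReal.rpow_ne_top_of_nonneg (by positivity) (measure_ne_top _ _)
  have hK0 : 0 ≤ K := ENNReal.toReal_nonneg
  set η : ℝ := ε / (4 * (K + 1)) with hη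
  have hηpos : 0 < η := by positivity
  -- approximate within `η` and add `η` to stay nonnegative
  obtain ⟨p, hp⟩ := exists_polynomial_near_of_continuousOn (-1) 1 (fun x => G (Real.arccos x))
    (hGc.comp Real.continuous_arccos).continuousOn η hηpos
  have hb : ∀ θ ∈ Ioo 0 Real.pi, |G θ - (p + C η).eval (Real.cos θ)| ≤ 2 * η := by
    intro θ hθ
    have := hp _ (cos_mem_Icc θ)
    rw [Real.arccos_cos hθ.1.le hθ.2.le] at this
    simp only [eval_add, eval_C]
    rw [abs_lt] at this
    rw [abs_le]
    constructor <;> linarith [this.1, this.2]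
  refine ⟨p + C η, fun x hx => ?_, ?_⟩
  · have := (abs_lt.mp (hp x hx)).1
    have h2 : 0 ≤ G (Real.arccos x) := le_max_right _ _
    simp only [eval_add, eval_C]
    linarith
  · have h2 : eLpNorm (fun θ => G θ - (p + C η).eval (Real.cos θ)) 2 ν ≤
        ENNReal.ofReal (ε / 2) := by
      refine (eLpNorm_le_of_ae_bound (C := 2 * η) ?_).trans ?_
      · filter_upwards [hν] with θ hθ using hb θ hθ
      · rw [← ENNReal.ofReal_toReal hKtop, ← hK, ← ENNReal.ofReal_mul hK0]
        refine ENNReal.ofReal_le_ofReal ?_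
        rw [hη]
        have : K / (K + 1) ≤ 1 := by rw [div_le_one (by linarith)]; linarith
        calc K * (2 * (ε / (4 * (K + 1)))) = ε / 2 * (K / (K + 1)) := by field_simp; norm_num
          _ ≤ ε / 2 * 1 := by gcongr
          _ = ε / 2 := mul_one _
    have e : (fun θ => f θ - (p + C η).eval (Real.cos θ)) =
        (fun θ => f θ - G θ) + fun θ => G θ - (p + C η).eval (Real.cos θ) := by
      funext θ; simp only [Pi.add_apply]; ring
    rw [e]
    refine (eLpNorm_add_le (hf.aestronglyMeasurable.sub hGc.aestronglyMeasurable)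
      (Continuous.aestronglyMeasurable (by fun_prop)) (by norm_num)).trans ?_
    refine (add_le_add h1 h2).trans ?_
    rw [← ENNReal.ofReal_add (by positivity) (by positivity), add_halves]

/-- Multiplication by a positive function `s` is isometric from `L²(s² μ)` to `L²(μ)`, so
nonnegative functions in `L²(μ)` are limits of products of `s` and nonnegative polynomials in
`cos θ`. -/
theorem exists_nonneg_mul_poly_near {μ : Measure ℝ} [IsFiniteMeasure μ]
    (hμ : ∀ᵐ θ ∂μ, θ ∈ Ioo 0 Real.pi) {s : ℝ → ℝ} (hs : Measurable s)
    (hs0 : ∀ θ ∈ Ioo 0 Real.pi, 0 < s θ) (hs1 : ∀ θ, |s θ| ≤ 1) {f : ℝ → ℝ}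
    (hf : MemLp f 2 μ) (h0 : 0 ≤ᵐ[μ] f) {ε : ℝ} (hε : 0 < ε) :
    ∃ p : ℝ[X], (∀ x ∈ Icc (-1 : ℝ) 1, 0 ≤ p.eval x) ∧
      eLpNorm (fun θ => f θ - s θ * p.eval (Real.cos θ)) 2 μ ≤ ENNReal.ofReal ε := by
  have hsm : Measurable fun θ => ‖s θ‖ₑ ^ 2 := hs.enorm.pow_const 2
  set ν := μ.withDensity fun θ => ‖s θ‖ₑ ^ 2 with hν
  have hac : ν ≪ μ := withDensity_absolutelyContinuous _ _
  have hfin : IsFiniteMeasure ν := by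
    refine isFiniteMeasure_withDensity (ne_of_lt ?_)
    refine lt_of_le_of_lt (lintegral_mono (g := fun _ => 1) fun θ => ?_) (by simp)
    refine pow_le_one' ?_ 2
    rw [← ofReal_norm]
    exact ENNReal.ofReal_le_one.mpr (hs1 θ)
  have key : ∀ h : ℝ → ℝ, AEStronglyMeasurable h μ →
      eLpNorm (fun θ => s θ * h θ) 2 μ = eLpNorm h 2 ν := by
    intro h hh
    have h1 : eLpNorm (fun θ => s θ * h θ) 2 μ ^ 2 = eLpNorm h 2 ν ^ 2 := by
      rw [← lintegral_enorm_sq_eq, ← lintegral_enorm_sq_eq, hν,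
        lintegral_withDensity_eq_lintegral_mul₀ hsm.aemeasurable (hh.enorm.pow_const 2)]
      refine lintegral_congr fun θ => ?_
      simp only [Pi.mul_apply, enorm_mul, mul_pow]
    exact (ENNReal.pow_right_strictMono (by norm_num : (2 : ℕ) ≠ 0)).injective h1
  have hsf : AEStronglyMeasurable (fun θ => (s θ)⁻¹ * f θ) μ :=
    hs.inv.aestronglyMeasurable.mul hf.aestronglyMeasurable
  have hfg : (fun θ => s θ * ((s θ)⁻¹ * f θ)) =ᵐ[μ] f := by
    filter_upwards [hμ] with θ hθ
    rw [mul_inv_cancel_left₀ (hs0 θ hθ).ne']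
  have hg : MemLp (fun θ => (s θ)⁻¹ * f θ) 2 ν := by
    refine ⟨hsf.mono_ac hac, ?_⟩
    rw [← key _ hsf, eLpNorm_congr_ae hfg]
    exact hf.2
  obtain ⟨p, hp, hpe⟩ := exists_nonneg_poly_near (hac.ae_le hμ) hg (by
    filter_upwards [hac.ae_le hμ, hac.ae_le h0] with θ h1 h2
    exact mul_nonneg (inv_nonneg.mpr (hs0 θ h1).le) h2) hε
  refine ⟨p, hp, ?_⟩
  rw [← key (fun θ => (s θ)⁻¹ * f θ - p.eval (Real.cos θ))
    (hsf.sub (Continuous.aestronglyMeasurable (by fun_prop)))] at hpe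
  refine le_trans (le_of_eq (eLpNorm_congr_ae ?_)) hpe
  filter_upwards [hμ] with θ hθ
  rw [mul_sub, mul_inv_cancel_left₀ (hs0 θ hθ).ne']

/-- An orthonormal system in `L²(μ)`, `μ` a finite measure on `(0, π)`, of the form
`s(θ) q_n(cos θ)` with polynomials `q_n` of degree `n` that solve the Jacobi equation with parameters
`(a, b)` and eigenvalue `lam n - k`. -/
structure IsJacobiSystem (a b k : ℝ) (μ : Measure ℝ) (s : ℝ → ℝ) (q : ℕ → ℝ[X]) (lam : ℕ → ℝ) :
    Prop where
  left_lt : -1 < a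
  right_lt : -1 < b
  shift_nonneg : 0 ≤ k
  lam_nonneg : ∀ n, 0 ≤ lam n
  finite : IsFiniteMeasure μ
  ae_mem : ∀ᵐ θ ∂μ, θ ∈ Ioo 0 Real.pi
  measurable : Measurable s
  pos : ∀ θ ∈ Ioo 0 Real.pi, 0 < s θ
  abs_le : ∀ θ, |s θ| ≤ 1
  degree : ∀ n, (q n).degree = n
  ode : ∀ n, jacOp a b (q n) = C (k - lam n) * q n
  orth : ∀ n m, ∫ θ, s θ * (q n).eval (Real.cos θ) * (s θ * (q m).eval (Real.cos θ)) ∂μ =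
    if n = m then 1 else 0

theorem memLp_mul_poly {μ : Measure ℝ} [IsFiniteMeasure μ] {s : ℝ → ℝ} (hs : Measurable s)
    (hs1 : ∀ θ, |s θ| ≤ 1) (p : ℝ[X]) :
    MemLp (fun θ => s θ * p.eval (Real.cos θ)) 2 μ := by
  obtain ⟨K, hK⟩ := (isCompact_Icc (a := (-1 : ℝ)) (b := 1)).exists_bound_of_continuousOn
    (f := fun x => p.eval x) (by fun_prop)
  refine MemLp.of_bound (hs.aestronglyMeasurable.mul
    (Continuous.aestronglyMeasurable (by fun_prop))) K (ae_of_all _ fun θ => ?_)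
  rw [norm_mul]
  have h1 := hK _ (cos_mem_Icc θ)
  have h2 := hs1 θ
  rw [← Real.norm_eq_abs] at h2
  calc _ ≤ 1 * K := mul_le_mul h2 h1 (norm_nonneg _) zero_le_one
    _ = K := one_mul K

namespace IsJacobiSystem

variable {a b k : ℝ} {μ : Measure ℝ} {s : ℝ → ℝ} {q : ℕ → ℝ[X]} {lam : ℕ → ℝ}

theorem memLp (h : IsJacobiSystem a b k μ s q lam) (p : ℝ[X]) :
    MemLp (fun θ => s θ * p.eval (Real.cos θ)) 2 μ :=
  haveI := h.finite
  memLp_mul_poly h.measurable h.abs_le p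

/-- The class in `L²(μ)` of `s(θ) p(cos θ)`. -/
noncomputable def toL2 (h : IsJacobiSystem a b k μ s q lam) : ℝ[X] →ₗ[ℝ] Lp ℝ 2 μ where
  toFun p := (h.memLp p).toLp
  map_add' p p' := by
    rw [← MemLp.toLp_add]
    refine MemLp.toLp_congr _ _ (ae_of_all _ fun θ => ?_)
    simp only [eval_add, Pi.add_apply]; ring
  map_smul' c p := by
    rw [RingHom.id_apply, ← MemLp.toLp_const_smul]
    refine MemLp.toLp_congr _ _ (ae_of_all _ fun θ => ?_)
    simp only [eval_smul, Pi.smul_apply, smul_eq_mul]; ring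

theorem coeFn_toL2 (h : IsJacobiSystem a b k μ s q lam) (p : ℝ[X]) :
    h.toL2 p =ᵐ[μ] fun θ => s θ * p.eval (Real.cos θ) :=
  MemLp.coeFn_toLp (h.memLp p)

theorem orthonormal (h : IsJacobiSystem a b k μ s q lam) :
    Orthonormal ℝ fun n => h.toL2 (q n) := by
  classical
  rw [orthonormal_iff_ite]
  intro n m
  rw [L2.inner_def, ← h.orth n m]
  refine integral_congr_ae ?_
  filter_upwards [h.coeFn_toL2 (q n), h.coeFn_toL2 (q m)] with θ h1 h2
  rw [h1, h2, real_inner_eq_re_inner, RCLike.inner_apply]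
  simp [mul_comm]

/-- The resolvents `(1 + t L)⁻¹`, where `L` has the eigenvalues `lam n`. (On the orthogonal complement
of the system, in fact trivial, they vanish by definition.) Positivity holds for polynomials by the
maximum principle, and in general by density. -/
theorem exists_resolvent (h : IsJacobiSystem a b k μ s q lam) :
    ∃ R : ℝ → Lp ℝ 2 μ →L[ℝ] Lp ℝ 2 μ, IsPositiveResolvent R ∧
      ∀ t, 0 < t → ∀ n, R t (h.toL2 (q n)) = (1 + t * lam n)⁻¹ • h.toL2 (q n) := by
  classical
  set e : ℕ → Lp ℝ 2 μ := fun n => h.toL2 (q n) with he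
  have hon : Orthonormal ℝ e := h.orthonormal
  have hpos : ∀ t, 0 < t → ∀ n, 1 ≤ 1 + t * lam n := fun t ht n => by
    nlinarith [mul_nonneg ht.le (h.lam_nonneg n)]
  have hbessel : ∀ f (S : Finset ℕ), ∑ i ∈ S, ‖inner ℝ (e i) f‖ ^ 2 ≤ ‖f‖ ^ 2 :=
    fun f S => hon.sum_inner_products_le f
  have hex : ∀ t : ℝ, ∃ T : Lp ℝ 2 μ →L[ℝ] Lp ℝ 2 μ, 0 < t →
      (∀ f, HasSum (fun n => inner ℝ (e n) f • (1 + t * lam n)⁻¹ • e n) (T f)) ∧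
      ∀ f, ‖T f‖ ^ 2 ≤ 1 * ‖f‖ ^ 2 := by
    intro t
    by_cases ht : 0 < t
    · obtain ⟨T, hT⟩ := exists_clm_hasSum (𝕜 := ℝ) (v := fun n => (1 + t * lam n)⁻¹ • e n)
        (K := 1) hbessel (norm_sq_sum_smul_le_of_orthogonal (fun i j hij => by
          change inner ℝ ((1 + t * lam i)⁻¹ • e i) ((1 + t * lam j)⁻¹ • e j) = 0
          rw [inner_smul_left, inner_smul_right, hon.2 hij]; simp) (fun i => by
          rw [norm_smul, hon.1 i, mul_one, Real.norm_eq_abs, abs_of_nonneg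
            (inv_nonneg.mpr (zero_le_one.trans (hpos t ht i)))]
          exact pow_le_one₀ (inv_nonneg.mpr (zero_le_one.trans (hpos t ht i)))
            (inv_le_one_of_one_le₀ (hpos t ht i))))
      exact ⟨T, fun _ => hT⟩
    · exact ⟨0, fun h' => absurd h' ht⟩
  choose R hR using hex
  have hsum := fun t ht => (hR t ht).1
  have heig : ∀ t, 0 < t → ∀ n, R t (e n) = (1 + t * lam n)⁻¹ • e n := by
    intro t ht n
    refine (hsum t ht (e n)).unique ?_
    convert hasSum_single (f := fun m => inner ℝ (e m) (e n) • (1 + t * lam m)⁻¹ • e m) n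
      (fun m hm => by simp [hon.2 hm]) using 1
    simp [hon.1 n]
  have hcoef : ∀ t, 0 < t → ∀ f n, inner ℝ (e n) (R t f) =
      (1 + t * lam n)⁻¹ * inner ℝ (e n) f := by
    intro t ht f n
    have h1 := (hsum t ht f).mapL (innerSL ℝ (e n))
    simp only [innerSL_apply_apply, inner_smul_right] at h1
    have h2 := hasSum_single (f := fun m => inner ℝ (e m) f * ((1 + t * lam m)⁻¹ *
      inner ℝ (e n) (e m))) n (fun m hm => by simp [hon.2 hm.symm])
    rw [h1.unique h2, real_inner_self_eq_norm_sq, hon.1 n]; ring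
  refine ⟨R, ⟨?_, ?_, ?_, ?_⟩, heig⟩
  · intro t ht f hf
    -- on polynomials the resolvent is computed by solving the resolvent equation
    have hpoly : ∀ p : ℝ[X], ∃ P : ℝ[X], R t (h.toL2 p) = h.toL2 P ∧
        C (1 + t * k) * P - C t * jacOp a b P = p := by
      intro p
      let sq : Polynomial.Sequence ℝ := ⟨q, h.degree⟩
      have hp : p ∈ Submodule.span ℝ (range sq) := by
        rw [sq.span fun i => (leadingCoeff_ne_zero.mpr (sq.ne_zero i)).isUnit]
        trivial
      induction hp using Submodule.span_induction with
      | mem p hp =>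
        obtain ⟨n, rfl⟩ := hp
        have hn := (zero_lt_one.trans_le (hpos t ht n)).ne'
        refine ⟨C (1 + t * lam n)⁻¹ * q n, ?_, ?_⟩
        · rw [← smul_eq_C_mul, map_smul]
          exact heig t ht n
        · have := jacOp_sum a b {()} (fun _ => (1 + t * lam n)⁻¹) (fun _ => q n)
          simp only [Finset.sum_singleton] at this
          rw [this, h.ode n]
          change _ = q n
          have e1 : C (1 + t * k) * (C (1 + t * lam n)⁻¹ * q n) -
              C t * (C (1 + t * lam n)⁻¹ * (C (k - lam n) * q n)) =
              C ((1 + t * lam n) * (1 + t * lam n)⁻¹) * q n := by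
            simp only [map_mul, map_add, map_sub, map_one]; ring
          rw [e1, mul_inv_cancel₀ hn, map_one, one_mul]
      | zero => exact ⟨0, by simp, by simp [jacOp]⟩
      | add x y _ _ hx hy =>
        obtain ⟨P, h1, h2⟩ := hx
        obtain ⟨P', h1', h2'⟩ := hy
        refine ⟨P + P', by rw [map_add, map_add, map_add, h1, h1'], ?_⟩
        rw [← h2, ← h2']
        simp only [jacOp, map_add]; ring
      | smul c x _ hx =>
        obtain ⟨P, h1, h2⟩ := hx
        refine ⟨c • P, by rw [map_smul, map_smul, map_smul, h1], ?_⟩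
        rw [← h2]
        simp only [jacOp, smul_eq_C_mul, derivative_C_mul]; ring
    have := h.finite
    refine (isClosed_Ici (a := (0 : Lp ℝ 2 μ))).closure_subset (?_ : R t f ∈ closure (Ici 0))
    rw [Metric.mem_closure_iff]
    intro ε hε
    obtain ⟨p, hp, hpe⟩ := exists_nonneg_mul_poly_near h.ae_mem h.measurable h.pos h.abs_le
      (Lp.memLp f) ((Lp.coeFn_nonneg f).mpr hf) (half_pos hε)
    obtain ⟨P, hP, hP'⟩ := hpoly p
    have hPnn := eval_nonneg_of_resolvent_eq h.left_lt h.right_lt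
      (by nlinarith [mul_nonneg ht.le h.shift_nonneg] : 0 < 1 + t * k) ht.le hP' hp
    refine ⟨h.toL2 P, ?_, ?_⟩
    · rw [mem_Ici, ← Lp.coeFn_nonneg]
      filter_upwards [h.coeFn_toL2 P, h.ae_mem] with θ h1 h2
      rw [h1]
      exact mul_nonneg (h.pos θ h2).le (hPnn _ (cos_mem_Icc θ))
    · rw [← hP, dist_eq_norm, ← map_sub]
      have h1 := (hR t ht).2 (f - h.toL2 p)
      rw [one_mul] at h1
      have h2 : ‖R t (f - h.toL2 p)‖ ≤ ‖f - h.toL2 p‖ :=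
        le_of_sq_le_sq h1 (norm_nonneg _)
      have h3 : ‖f - h.toL2 p‖ ≤ ε / 2 := by
        rw [Lp.norm_def]
        refine ENNReal.toReal_le_of_le_ofReal (by positivity) (le_trans (le_of_eq ?_) hpe)
        refine eLpNorm_congr_ae ?_
        filter_upwards [Lp.coeFn_sub f (h.toL2 p), h.coeFn_toL2 p] with θ h4 h5
        rw [h4, Pi.sub_apply, h5]
      linarith
  · intro t ht f g
    have h1 := (hsum t ht g).mapL (innerSL ℝ f)
    have h2 := (hsum t ht f).mapL (innerSL ℝ g)
    simp only [innerSL_apply_apply, inner_smul_right] at h1 h2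
    rw [real_inner_comm]
    refine h2.unique ?_
    convert h1 using 2 with n
    rw [real_inner_comm (e n) g, real_inner_comm (e n) f]
    ring
  · intro t ht f
    have := (hR t ht).2 f
    rw [one_mul] at this
    exact le_of_sq_le_sq this (norm_nonneg _)
  · intro s' r hs hr f
    have h1 := ((hsum s' hs f).const_smul s').sub ((hsum r hr f).const_smul r)
    have h2 := (hsum s' hs (R r f)).const_smul (s' - r)
    refine h1.unique ?_
    convert h2 using 2 with n
    rw [hcoef r hr]
    have e1 := (zero_lt_one.trans_le (hpos s' hs n)).ne'
    have e2 := (zero_lt_one.trans_le (hpos r hr n)).ne'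
    simp only [smul_smul, ← sub_smul]
    congr 1
    generalize hx : 1 + s' * lam n = x at e1
    generalize hy : 1 + r * lam n = y at e2
    field_simp
    rw [← hx, ← hy]
    ring

end IsJacobiSystem

end SymJacobi

/-! ### The maximal inequality for the Poisson semigroup -/

namespace SymJacobi

/-- The difference of the Poisson and resolvent multipliers, `e^{-x} - (1 + x²)⁻¹`. -/
noncomputable def diffMul (x : ℝ) : ℝ := Real.exp (-x) - (1 + x ^ 2)⁻¹

/-- The derivative of `diffMul`. -/
noncomputable def diffMul' (x : ℝ) : ℝ := -Real.exp (-x) + 2 * x / (1 + x ^ 2) ^ 2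

theorem hasDerivAt_diffMul (x : ℝ) : HasDerivAt diffMul (diffMul' x) x := by
  have h0 : (1 : ℝ) + x ^ 2 ≠ 0 := by positivity
  have h1 : HasDerivAt (fun x : ℝ => Real.exp (-x)) (Real.exp (-x) * -1) x :=
    (Real.hasDerivAt_exp (-x)).comp x (hasDerivAt_neg x)
  have h2 : HasDerivAt (fun x : ℝ => 1 + x ^ 2) (2 * x) x := by
    simpa using (hasDerivAt_pow 2 x).const_add 1
  refine (h1.sub (h2.inv h0)).congr_deriv ?_
  rw [diffMul']; ring

theorem continuous_diffMul : Continuous diffMul :=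
  continuous_iff_continuousAt.mpr fun x => (hasDerivAt_diffMul x).continuousAt

theorem continuous_diffMul' : Continuous diffMul' := by
  unfold diffMul'
  exact (by fun_prop : Continuous fun x : ℝ => -Real.exp (-x)).add
    ((by fun_prop : Continuous fun x : ℝ => 2 * x).div (by fun_prop) fun x => by positivity)

theorem abs_diffMul_le {x : ℝ} (hx : 0 ≤ x) : |diffMul x| ≤ x / (1 + x ^ 2) := by
  have h0 : (0 : ℝ) < 1 + x ^ 2 := by positivity
  have he := Real.exp_pos x
  have h1 : 1 + x ≤ Real.exp x := by linarith [Real.add_one_le_exp x]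
  have h2 : 1 - x ≤ Real.exp (-x) := by linarith [Real.add_one_le_exp (-x)]
  have h3 : (1 + x ^ 2) * Real.exp (-x) ≤ 1 + x := by
    rw [Real.exp_neg, ← div_eq_mul_inv, div_le_iff₀ he]
    nlinarith
  have h4 : 1 - x ≤ (1 + x ^ 2) * Real.exp (-x) := by
    rcases le_total 1 x with h | h
    · exact (sub_nonpos.mpr h).trans (by positivity)
    · nlinarith [mul_le_mul_of_nonneg_left h2 h0.le, mul_nonneg (sq_nonneg x) (sub_nonneg.mpr h)]
  have e : diffMul x = ((1 + x ^ 2) * Real.exp (-x) - 1) / (1 + x ^ 2) := by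
    rw [diffMul]; field_simp
  rw [e, abs_div, abs_of_pos h0]
  gcongr
  rw [abs_le]
  constructor <;> linarith

theorem abs_diffMul'_le {x : ℝ} (hx : 0 ≤ x) : |diffMul' x| ≤ 3 / (1 + x ^ 2) := by
  have h0 : (0 : ℝ) < 1 + x ^ 2 := by positivity
  have h1 : Real.exp (-x) ≤ 2 / (1 + x ^ 2) := by
    rw [Real.exp_neg, inv_le_comm₀ (Real.exp_pos x) (by positivity), inv_div]
    linarith [Real.quadratic_le_exp_of_nonneg hx]
  have h2 : 2 * x / (1 + x ^ 2) ^ 2 ≤ 1 / (1 + x ^ 2) := by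
    rw [div_le_div_iff₀ (by positivity) h0]
    nlinarith [sq_nonneg (x - 1), mul_nonneg h0.le (sq_nonneg (x - 1))]
  have h3 : 0 ≤ 2 * x / (1 + x ^ 2) ^ 2 := by positivity
  rw [diffMul', abs_le]
  have e : (3 : ℝ) / (1 + x ^ 2) = 2 / (1 + x ^ 2) + 1 / (1 + x ^ 2) := by ring
  constructor <;> linarith [Real.exp_pos (-x)]

/-- The square function integral that controls the contribution of frequency `z`. -/
theorem lintegral_diffMul_le {z : ℝ} (hz : 0 ≤ z) :
    ∫⁻ t in Ioi (0 : ℝ), ENNReal.ofReal (t⁻¹ * diffMul (t * z) ^ 2 +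
      t * (z * diffMul' (t * z)) ^ 2) ≤ 5 := by
  rcases hz.eq_or_lt with rfl | hz
  · simp [diffMul]
  have hpos : ∀ t : ℝ, (0 : ℝ) < 1 + (t * z) ^ 2 := fun t => by positivity
  have hbound : ∀ t ∈ Ioi (0 : ℝ), t⁻¹ * diffMul (t * z) ^ 2 + t * (z * diffMul' (t * z)) ^ 2 ≤
      10 * t * z ^ 2 / (1 + (t * z) ^ 2) ^ 2 := by
    intro t ht
    have ht : 0 < t := ht
    have htz : 0 ≤ t * z := by positivity
    have h1 : diffMul (t * z) ^ 2 ≤ (t * z / (1 + (t * z) ^ 2)) ^ 2 := by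
      rw [← sq_abs]; exact pow_le_pow_left₀ (abs_nonneg _) (abs_diffMul_le htz) 2
    have h2 : diffMul' (t * z) ^ 2 ≤ (3 / (1 + (t * z) ^ 2)) ^ 2 := by
      rw [← sq_abs]; exact pow_le_pow_left₀ (abs_nonneg _) (abs_diffMul'_le htz) 2
    calc _ ≤ t⁻¹ * (t * z / (1 + (t * z) ^ 2)) ^ 2 +
          t * (z ^ 2 * (3 / (1 + (t * z) ^ 2)) ^ 2) := by
          rw [mul_pow]; gcongr
      _ = _ := by
          have := (hpos t).ne'
          field_simp
          ring
  have hder : ∀ t ∈ Ici (0 : ℝ), HasDerivAt (fun t => -5 * (1 + (t * z) ^ 2)⁻¹)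
      (10 * t * z ^ 2 / (1 + (t * z) ^ 2) ^ 2) t := by
    intro t _
    have h1 : HasDerivAt (fun t : ℝ => 1 + (t * z) ^ 2) (2 * (t * z) * z) t := by
      simpa using (((hasDerivAt_id t).mul_const z).pow 2).const_add 1
    refine ((h1.inv (hpos t).ne').const_mul (-5)).congr_deriv ?_
    ring
  have hlim : Tendsto (fun t : ℝ => -5 * (1 + (t * z) ^ 2)⁻¹) atTop (𝓝 0) := by
    rw [show (0 : ℝ) = -5 * 0 by simp]
    refine Tendsto.const_mul _ (tendsto_inv_atTop_zero.comp ?_)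
    refine tendsto_atTop_add_const_left _ _ ?_
    exact (tendsto_pow_atTop (by norm_num)).comp (tendsto_id.atTop_mul_const hz)
  have hnn : ∀ t ∈ Ioi (0 : ℝ), 0 ≤ 10 * t * z ^ 2 / (1 + (t * z) ^ 2) ^ 2 := by
    intro t ht
    have ht : 0 < t := ht
    positivity
  have hint := integrableOn_Ioi_deriv_of_nonneg' hder hnn hlim
  have hval := integral_Ioi_of_hasDerivAt_of_nonneg' hder hnn hlim
  calc _ ≤ ∫⁻ t in Ioi (0 : ℝ), ENNReal.ofReal (10 * t * z ^ 2 / (1 + (t * z) ^ 2) ^ 2) :=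
        setLIntegral_mono' measurableSet_Ioi fun t ht => ENNReal.ofReal_le_ofReal (hbound t ht)
    _ = ENNReal.ofReal 5 := by
        rw [← ofReal_integral_eq_lintegral_ofReal hint
          ((ae_restrict_mem measurableSet_Ioi).mono hnn), hval]
        norm_num
    _ ≤ 5 := by simp

theorem ennreal_add_sq_le (a b : ℝ≥0∞) : (a + b) ^ 2 ≤ 2 * a ^ 2 + 2 * b ^ 2 := by
  rcases eq_or_ne a ∞ with rfl | ha
  · simp
  rcases eq_or_ne b ∞ with rfl | hb
  · simp
  lift a to ℝ≥0 using ha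
  lift b to ℝ≥0 using hb
  norm_cast
  have := add_sq_le (a := (a : ℝ)) (b := b)
  rw [mul_add] at this
  exact_mod_cast this

/-- A function vanishing at `0` is controlled by a square function: `(g²)' ≤ g² / t + t g'²`. -/
theorem enorm_sq_le_lintegral {g g' : ℝ → ℝ} (hg : ∀ t, HasDerivAt g (g' t) t)
    (hg' : Continuous g') (h0 : g 0 = 0) {T : ℝ} (hT : 0 < T) :
    ‖g T‖ₑ ^ 2 ≤ ∫⁻ t in Ioi (0 : ℝ),
      (ENNReal.ofReal t⁻¹ * ‖g t‖ₑ ^ 2 + ENNReal.ofReal t * ‖g' t‖ₑ ^ 2) := by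
  have hc : Continuous g := continuous_iff_continuousAt.mpr fun t => (hg t).continuousAt
  have h1 : ∫ t in (0 : ℝ)..T, 2 * g t * g' t = g T ^ 2 := by
    rw [intervalIntegral.integral_eq_sub_of_hasDerivAt (f := fun t => g t ^ 2)
      (fun t _ => ((hg t).pow 2).congr_deriv (by simp))
      (Continuous.intervalIntegrable (by fun_prop) _ _), h0]
    simp
  have hsq : ∀ x : ℝ, ‖x‖ₑ ^ 2 = ENNReal.ofReal (x ^ 2) := fun x => by
    rw [← ofReal_norm, ← ENNReal.ofReal_pow (norm_nonneg _), Real.norm_eq_abs, sq_abs]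
  have h2 : ‖g T‖ₑ ^ 2 = ‖∫ t in Ioc 0 T, 2 * g t * g' t‖ₑ := by
    rw [← intervalIntegral.integral_of_le hT.le, h1, enorm_pow]
  rw [h2]
  refine (enorm_integral_le_lintegral_enorm _).trans ?_
  refine (lintegral_mono_set Ioc_subset_Ioi_self).trans ?_
  refine setLIntegral_mono' measurableSet_Ioi fun t ht => ?_
  have ht : 0 < t := ht
  rw [hsq, hsq, ← ENNReal.ofReal_mul (by positivity), ← ENNReal.ofReal_mul ht.le,
    ← ENNReal.ofReal_add (by positivity) (by positivity), ← ofReal_norm, Real.norm_eq_abs]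
  refine ENNReal.ofReal_le_ofReal ?_
  have e : t⁻¹ * g t ^ 2 + t * g' t ^ 2 = t⁻¹ * (g t ^ 2 + (t * g' t) ^ 2) := by field_simp
  have e' : 2 * g t * g' t = t⁻¹ * (2 * g t * (t * g' t)) := by field_simp
  rw [e, e', abs_mul, abs_of_pos (inv_pos.mpr ht)]
  gcongr
  rw [abs_le]
  constructor <;> nlinarith [sq_nonneg (g t - t * g' t), sq_nonneg (g t + t * g' t)]

namespace IsJacobiSystem

open Polynomial

variable {a b k : ℝ} {μ : Measure ℝ} {s : ℝ → ℝ} {q : ℕ → ℝ[X]} {lam : ℕ → ℝ}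

theorem coeFn_sum_smul (h : IsJacobiSystem a b k μ s q lam) (S : Finset ℕ) (c : ℕ → ℝ) :
    (∑ n ∈ S, c n • h.toL2 (q n) : Lp ℝ 2 μ) =ᵐ[μ]
      fun θ => ∑ n ∈ S, c n * (s θ * (q n).eval (Real.cos θ)) := by
  have e : (∑ n ∈ S, c n • h.toL2 (q n) : Lp ℝ 2 μ) = h.toL2 (∑ n ∈ S, c n • q n) := by
    simp only [map_sum, map_smul]
  rw [e]
  filter_upwards [h.coeFn_toL2 (∑ n ∈ S, c n • q n)] with θ hθ
  rw [hθ, eval_finsetSum, Finset.mul_sum]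
  refine Finset.sum_congr rfl fun n _ => ?_
  rw [eval_smul, smul_eq_mul]; ring

theorem norm_sq_sum_smul_le (h : IsJacobiSystem a b k μ s q lam) (S : Finset ℕ) (c : ℕ → ℝ) :
    ‖∑ n ∈ S, c n • h.toL2 (q n)‖ ^ 2 ≤ ∑ n ∈ S, c n ^ 2 := by
  have := norm_sq_sum_smul_le_of_orthogonal (𝕜 := ℝ) (v := fun n => h.toL2 (q n)) (K := 1)
    (fun i j hij => h.orthonormal.2 hij) (fun i => by rw [h.orthonormal.1 i]; norm_num) S c
  simpa using this

theorem lintegral_sum_le (h : IsJacobiSystem a b k μ s q lam) (S : Finset ℕ) (c : ℕ → ℝ) :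
    ∫⁻ θ, ‖∑ n ∈ S, c n * (s θ * (q n).eval (Real.cos θ))‖ₑ ^ 2 ∂μ ≤
      ENNReal.ofReal (∑ n ∈ S, c n ^ 2) := by
  rw [lintegral_enorm_sq_eq, ← eLpNorm_congr_ae (h.coeFn_sum_smul S c), ← Lp.enorm_def,
    ← ofReal_norm, ← ENNReal.ofReal_pow (norm_nonneg _)]
  exact ENNReal.ofReal_le_ofReal (h.norm_sq_sum_smul_le S c)

/-- The maximal inequality for the resolvents of finite sums, over all times. -/
theorem exists_maximal_resolvent (h : IsJacobiSystem a b k μ s q lam) (S : Finset ℕ)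
    (c : ℕ → ℝ) : ∃ M : ℝ → ℝ≥0∞, AEMeasurable M μ ∧
      (∀ᵐ θ ∂μ, ∀ t, 0 < t →
        ‖∑ n ∈ S, c n * (1 + t * lam n)⁻¹ * (s θ * (q n).eval (Real.cos θ))‖ₑ ≤ M θ) ∧
      ∫⁻ θ, M θ ^ 2 ∂μ ≤ 64 * ENNReal.ofReal (∑ n ∈ S, c n ^ 2) := by
  obtain ⟨R, hR, hRe⟩ := h.exists_resolvent
  have : Nonempty (Ioi (0 : ℝ)) := ⟨⟨1, by simp⟩⟩
  set τ : ℕ → Ioi (0 : ℝ) := TopologicalSpace.denseSeq (Ioi (0 : ℝ)) with hτ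
  set f : Lp ℝ 2 μ := ∑ n ∈ S, c n • h.toL2 (q n) with hf
  obtain ⟨M, hMm, hM, hMi⟩ := hR.exists_maximal (t := fun i => (τ i : ℝ)) (fun i => (τ i).2) f
  refine ⟨M, hMm, ?_, hMi.trans ?_⟩
  · have hae : ∀ᵐ θ ∂μ, ∀ i, R (τ i) f θ =
        ∑ n ∈ S, c n * (1 + τ i * lam n)⁻¹ * (s θ * (q n).eval (Real.cos θ)) := by
      refine ae_all_iff.mpr fun i => ?_
      have e : R (τ i) f = ∑ n ∈ S, (c n * (1 + τ i * lam n)⁻¹) • h.toL2 (q n) := by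
        rw [hf, map_sum]
        refine Finset.sum_congr rfl fun n _ => ?_
        rw [map_smul, hRe _ (τ i).2, smul_smul]
      rw [e]
      exact h.coeFn_sum_smul S _
    filter_upwards [hae, hM] with θ h1 h2 t ht
    -- both sides are continuous in `t`, so it suffices to check a dense set of times
    have hcont : Continuous fun t : Ioi (0 : ℝ) =>
        ‖∑ n ∈ S, c n * (1 + t * lam n)⁻¹ * (s θ * (q n).eval (Real.cos θ))‖ₑ := by
      refine Continuous.enorm (continuous_finsetSum _ fun n _ => ?_)
      refine (continuous_const.mul (Continuous.inv₀ (by fun_prop) fun t => ?_)).mul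
        continuous_const
      have := mul_nonneg (le_of_lt (show (0 : ℝ) < t from t.2)) (h.lam_nonneg n)
      positivity
    have hcl : IsClosed {t : Ioi (0 : ℝ) |
        ‖∑ n ∈ S, c n * (1 + t * lam n)⁻¹ * (s θ * (q n).eval (Real.cos θ))‖ₑ ≤ M θ} :=
      isClosed_le hcont continuous_const
    exact (TopologicalSpace.denseRange_denseSeq (Ioi (0 : ℝ))).induction_on
      (p := fun t : Ioi (0 : ℝ) =>
        ‖∑ n ∈ S, c n * (1 + t * lam n)⁻¹ * (s θ * (q n).eval (Real.cos θ))‖ₑ ≤ M θ)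
      ⟨t, ht⟩ hcl fun i => (congrArg _ (h1 i)).symm.trans_le (h2 i)
  · gcongr
    rw [← ofReal_norm, ← ENNReal.ofReal_pow (norm_nonneg _)]
    exact ENNReal.ofReal_le_ofReal (h.norm_sq_sum_smul_le S c)

/-- The maximal inequality for the remainder `F(x) = e^{-x} - (1 + x²)⁻¹`: the square function that
dominates it is integrated in `θ` first, where orthogonality decouples the frequencies. -/
theorem exists_maximal_diff (h : IsJacobiSystem a b k μ s q lam) (S : Finset ℕ)
    (c : ℕ → ℝ) : ∃ M : ℝ → ℝ≥0∞, AEMeasurable M μ ∧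
      (∀ θ, ∀ t, 0 < t →
        ‖∑ n ∈ S, c n * diffMul (t * Real.sqrt (lam n)) * (s θ * (q n).eval (Real.cos θ))‖ₑ ≤ M θ) ∧
      ∫⁻ θ, M θ ^ 2 ∂μ ≤ 5 * ENNReal.ofReal (∑ n ∈ S, c n ^ 2) := by
  have := h.finite
  set z : ℕ → ℝ := fun n => Real.sqrt (lam n) with hz
  set g : ℝ → ℝ → ℝ := fun θ t =>
    ∑ n ∈ S, c n * diffMul (t * z n) * (s θ * (q n).eval (Real.cos θ)) with hg
  set g' : ℝ → ℝ → ℝ := fun θ t =>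
    ∑ n ∈ S, c n * (z n * diffMul' (t * z n)) * (s θ * (q n).eval (Real.cos θ)) with hg'
  set D : ℝ → ℝ → ℝ≥0∞ := fun θ t =>
    ENNReal.ofReal t⁻¹ * ‖g θ t‖ₑ ^ 2 + ENNReal.ofReal t * ‖g' θ t‖ₑ ^ 2 with hD
  have hsm := h.measurable
  have hdm := continuous_diffMul.measurable
  have hdm' := continuous_diffMul'.measurable
  have hgm : Measurable (Function.uncurry g) := by
    simp only [hg, Function.uncurry_def]
    refine Finset.measurable_sum _ fun n _ => ?_
    refine ((hdm.comp (measurable_snd.mul_const _)).const_mul _).mul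
      ((hsm.comp measurable_fst).mul ?_)
    exact (by fun_prop : Continuous fun p : ℝ × ℝ => (q n).eval (Real.cos p.1)).measurable
  have hgm' : Measurable (Function.uncurry g') := by
    simp only [hg', Function.uncurry_def]
    refine Finset.measurable_sum _ fun n _ => ?_
    refine (((hdm'.comp (measurable_snd.mul_const _)).const_mul _).const_mul _).mul
      ((hsm.comp measurable_fst).mul ?_)
    exact (by fun_prop : Continuous fun p : ℝ × ℝ => (q n).eval (Real.cos p.1)).measurable
  have hDm : Measurable (Function.uncurry D) := by
    have e : Function.uncurry D = fun p => ENNReal.ofReal p.2⁻¹ * ‖Function.uncurry g p‖ₑ ^ 2 +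
        ENNReal.ofReal p.2 * ‖Function.uncurry g' p‖ₑ ^ 2 := rfl
    rw [e]
    exact ((measurable_snd.inv.ennreal_ofReal).mul (hgm.enorm.pow_const 2)).add
      (measurable_snd.ennreal_ofReal.mul (hgm'.enorm.pow_const 2))
  have hIm : Measurable fun θ => ∫⁻ t in Ioi (0 : ℝ), D θ t := hDm.lintegral_prod_right
  refine ⟨fun θ => (∫⁻ t in Ioi (0 : ℝ), D θ t) ^ (1 / 2 : ℝ), (hIm.pow_const _).aemeasurable,
    fun θ t ht => ?_, ?_⟩
  · have hder : ∀ t, HasDerivAt (g θ) (g' θ t) t := by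
      intro t
      refine HasDerivAt.fun_sum fun n _ => ?_
      refine HasDerivAt.mul_const (HasDerivAt.const_mul _ ?_) _
      have h1 := (hasDerivAt_diffMul (t * z n)).comp t ((hasDerivAt_id t).mul_const (z n))
      exact h1.congr_deriv (by simp only [one_mul]; ring)
    have hcont : Continuous (g' θ) := by
      refine continuous_finsetSum _ fun n _ => ?_
      exact (continuous_const.mul (continuous_const.mul
        (continuous_diffMul'.comp (continuous_id.mul continuous_const)))).mul continuous_const
    have h0 : g θ 0 = 0 := by simp [hg, diffMul]
    have h1 := enorm_sq_le_lintegral hder hcont h0 ht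
    calc ‖g θ t‖ₑ = (‖g θ t‖ₑ ^ 2) ^ (1 / 2 : ℝ) := by
          rw [← ENNReal.rpow_natCast, ← ENNReal.rpow_mul]; norm_num
      _ ≤ _ := ENNReal.rpow_le_rpow h1 (by norm_num)
  · have e : ∀ x : ℝ≥0∞, (x ^ (1 / 2 : ℝ)) ^ 2 = x := fun x => by
      rw [← ENNReal.rpow_natCast, ← ENNReal.rpow_mul]; norm_num
    simp_rw [e]
    rw [lintegral_lintegral_swap hDm.aemeasurable]
    have hinner : ∀ t ∈ Ioi (0 : ℝ), ∫⁻ θ, D θ t ∂μ ≤ ∑ n ∈ S, ENNReal.ofReal (c n ^ 2) *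
        ENNReal.ofReal (t⁻¹ * diffMul (t * z n) ^ 2 + t * (z n * diffMul' (t * z n)) ^ 2) := by
      intro t ht
      have ht : 0 < t := ht
      have hti : 0 ≤ t⁻¹ := (inv_pos.mpr ht).le
      have m1 : Measurable fun θ => ‖g θ t‖ₑ ^ 2 :=
        (hgm.comp (measurable_id.prodMk measurable_const)).enorm.pow_const 2
      have m2 : Measurable fun θ => ‖g' θ t‖ₑ ^ 2 :=
        (hgm'.comp (measurable_id.prodMk measurable_const)).enorm.pow_const 2
      simp only [hD]
      rw [lintegral_add_left (m1.const_mul _), lintegral_const_mul _ m1, lintegral_const_mul _ m2]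
      calc _ ≤ ENNReal.ofReal t⁻¹ * ENNReal.ofReal (∑ n ∈ S, (c n * diffMul (t * z n)) ^ 2) +
            ENNReal.ofReal t *
              ENNReal.ofReal (∑ n ∈ S, (c n * (z n * diffMul' (t * z n))) ^ 2) := by
            gcongr
            · exact h.lintegral_sum_le S fun n => c n * diffMul (t * z n)
            · exact h.lintegral_sum_le S fun n => c n * (z n * diffMul' (t * z n))
        _ = _ := by
            rw [← ENNReal.ofReal_mul hti, ← ENNReal.ofReal_mul ht.le,
              ← ENNReal.ofReal_add (by positivity) (by positivity), Finset.mul_sum, Finset.mul_sum,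
              ← Finset.sum_add_distrib, ENNReal.ofReal_sum_of_nonneg (fun n _ => by positivity)]
            refine Finset.sum_congr rfl fun n _ => ?_
            rw [← ENNReal.ofReal_mul (sq_nonneg _)]
            congr 1
            ring
    refine (setLIntegral_mono' measurableSet_Ioi hinner).trans ?_
    rw [lintegral_finsetSum _ fun n _ => ?_, ENNReal.ofReal_sum_of_nonneg fun n _ => sq_nonneg _,
      Finset.mul_sum]
    · refine Finset.sum_le_sum fun n _ => ?_
      rw [lintegral_const_mul' _ _ ENNReal.ofReal_ne_top, mul_comm]
      gcongr
      exact lintegral_diffMul_le (Real.sqrt_nonneg _)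
    · refine Measurable.const_mul (Measurable.ennreal_ofReal ?_) _
      exact (measurable_inv.mul ((hdm.comp (measurable_id.mul_const _)).pow_const 2)).add
        (measurable_id.mul (((hdm'.comp (measurable_id.mul_const _)).const_mul _).pow_const 2))

/-- The maximal inequality for finite real sums; the resolvent time that belongs to `t` is `t²`. -/
theorem exists_maximal_real (h : IsJacobiSystem a b k μ s q lam) (S : Finset ℕ)
    (c : ℕ → ℝ) : ∃ M : ℝ → ℝ≥0∞, AEMeasurable M μ ∧
      (∀ᵐ θ ∂μ, ∀ t, 0 < t → ‖∑ n ∈ S, c n * Real.exp (-t * Real.sqrt (lam n)) *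
        (s θ * (q n).eval (Real.cos θ))‖ₑ ≤ M θ) ∧
      ∫⁻ θ, M θ ^ 2 ∂μ ≤ 138 * ENNReal.ofReal (∑ n ∈ S, c n ^ 2) := by
  obtain ⟨M₁, m1, h1, i1⟩ := h.exists_maximal_resolvent S c
  obtain ⟨M₂, m2, h2, i2⟩ := h.exists_maximal_diff S c
  refine ⟨fun θ => M₁ θ + M₂ θ, m1.add m2, ?_, ?_⟩
  · filter_upwards [h1] with θ h1 t ht
    have e : ∑ n ∈ S, c n * Real.exp (-t * Real.sqrt (lam n)) *
        (s θ * (q n).eval (Real.cos θ)) =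
        ∑ n ∈ S, c n * (1 + t ^ 2 * lam n)⁻¹ * (s θ * (q n).eval (Real.cos θ)) +
        ∑ n ∈ S, c n * diffMul (t * Real.sqrt (lam n)) * (s θ * (q n).eval (Real.cos θ)) := by
      rw [← Finset.sum_add_distrib]
      refine Finset.sum_congr rfl fun n _ => ?_
      rw [diffMul, mul_pow, Real.sq_sqrt (h.lam_nonneg n), neg_mul]
      ring
    rw [e]
    exact (enorm_add_le _ _).trans (add_le_add (h1 _ (by positivity)) (h2 θ t ht))
  · calc ∫⁻ θ, (M₁ θ + M₂ θ) ^ 2 ∂μ ≤ ∫⁻ θ, (2 * M₁ θ ^ 2 + 2 * M₂ θ ^ 2) ∂μ :=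
          lintegral_mono fun θ => ennreal_add_sq_le _ _
      _ = 2 * ∫⁻ θ, M₁ θ ^ 2 ∂μ + 2 * ∫⁻ θ, M₂ θ ^ 2 ∂μ := by
          rw [lintegral_add_left' ((m1.pow_const 2).const_mul 2),
            lintegral_const_mul' _ _ (by norm_num), lintegral_const_mul' _ _ (by norm_num)]
      _ ≤ 2 * (64 * ENNReal.ofReal (∑ n ∈ S, c n ^ 2)) +
          2 * (5 * ENNReal.ofReal (∑ n ∈ S, c n ^ 2)) := by gcongr
      _ = _ := by ring

/-- The maximal inequality for finite complex sums. -/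
theorem exists_maximal_complex (h : IsJacobiSystem a b k μ s q lam) (S : Finset ℕ)
    (c : ℕ → ℂ) : ∃ M : ℝ → ℝ≥0∞,
      (∀ᵐ θ ∂μ, ∀ t, 0 < t → ‖∑ n ∈ S, c n * (Real.exp (-t * Real.sqrt (lam n)) : ℝ) *
        ((s θ * (q n).eval (Real.cos θ) : ℝ) : ℂ)‖ₑ ≤ M θ) ∧
      ∫⁻ θ, M θ ^ 2 ∂μ ≤ 276 * ENNReal.ofReal (∑ n ∈ S, ‖c n‖ ^ 2) := by
  obtain ⟨M₁, m1, h1, i1⟩ := h.exists_maximal_real S fun n => (c n).re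
  obtain ⟨M₂, m2, h2, i2⟩ := h.exists_maximal_real S fun n => (c n).im
  refine ⟨fun θ => M₁ θ + M₂ θ, ?_, ?_⟩
  · filter_upwards [h1, h2] with θ h1 h2 t ht
    have e : ∑ n ∈ S, c n * (Real.exp (-t * Real.sqrt (lam n)) : ℝ) *
        ((s θ * (q n).eval (Real.cos θ) : ℝ) : ℂ) =
        ((∑ n ∈ S, (c n).re * Real.exp (-t * Real.sqrt (lam n)) *
          (s θ * (q n).eval (Real.cos θ)) : ℝ) : ℂ) +
        ((∑ n ∈ S, (c n).im * Real.exp (-t * Real.sqrt (lam n)) *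
          (s θ * (q n).eval (Real.cos θ)) : ℝ) : ℂ) * Complex.I := by
      rw [Complex.ofReal_sum, Complex.ofReal_sum, Finset.sum_mul, ← Finset.sum_add_distrib]
      refine Finset.sum_congr rfl fun n _ => ?_
      simp only [Complex.ofReal_mul]
      conv_lhs => rw [← Complex.re_add_im (c n)]
      ring
    rw [e]
    refine (enorm_add_le _ _).trans (add_le_add ((le_of_eq ?_).trans (h1 t ht))
      ((le_of_eq ?_).trans (h2 t ht)))
    · rw [← ofReal_norm, ← ofReal_norm, Complex.norm_real]
    · rw [← ofReal_norm, ← ofReal_norm, norm_mul, Complex.norm_I, mul_one, Complex.norm_real]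
  · calc ∫⁻ θ, (M₁ θ + M₂ θ) ^ 2 ∂μ ≤ ∫⁻ θ, (2 * M₁ θ ^ 2 + 2 * M₂ θ ^ 2) ∂μ :=
          lintegral_mono fun θ => ennreal_add_sq_le _ _
      _ = 2 * ∫⁻ θ, M₁ θ ^ 2 ∂μ + 2 * ∫⁻ θ, M₂ θ ^ 2 ∂μ := by
          rw [lintegral_add_left' ((m1.pow_const 2).const_mul 2),
            lintegral_const_mul' _ _ (by norm_num), lintegral_const_mul' _ _ (by norm_num)]
      _ ≤ 2 * (138 * ENNReal.ofReal (∑ n ∈ S, (c n).re ^ 2)) +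
          2 * (138 * ENNReal.ofReal (∑ n ∈ S, (c n).im ^ 2)) := by gcongr
      _ = 276 * (ENNReal.ofReal (∑ n ∈ S, (c n).re ^ 2) +
          ENNReal.ofReal (∑ n ∈ S, (c n).im ^ 2)) := by ring
      _ = _ := by
          rw [← ENNReal.ofReal_add (by positivity) (by positivity), ← Finset.sum_add_distrib]
          congr 2
          refine Finset.sum_congr rfl fun n _ => ?_
          rw [← Complex.normSq_eq_norm_sq, Complex.normSq_apply]; ring

end IsJacobiSystem

end SymJacobi

/-! ### Pointwise convergence and smoothness of the series -/

namespace SymJacobi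

open Polynomial

theorem sqrt_eigenval {α β : ℝ} (h : 0 ≤ α + β + 1) (n : ℕ) :
    Real.sqrt (eigenval α β n) = n + (α + β + 1) / 2 := by
  rw [eigenval, Real.sqrt_sq (by positivity)]

theorem memLp_sysFun {α β : ℝ} (hα : -1 / 2 ≤ α) (hβ : -1 / 2 ≤ β) (c : Bool) (n : ℕ) :
    MemLp (sysFun α β c n) 2 (muPlus α β) := by
  have := isFiniteMeasure_muPlus hα hβ
  cases c
  · refine (memLp_mul_poly (s := fun _ => 1) measurable_const (by simp)
      (nPoly α β n)).ae_eq ?_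
    filter_upwards [ae_mem_Ioo α β] with θ hθ
    rw [sysFun_false _ _ _ hθ, one_mul]
  · refine ((memLp_mul_poly (s := Real.sin) Real.measurable_sin Real.abs_sin_le_one
      (derivative (nPoly α β n))).const_mul (kap α β n ^ (-(1 / 2) : ℝ))).ae_eq ?_
    filter_upwards [ae_mem_Ioo α β] with θ hθ
    rw [sysFun_true _ _ _ hθ]

theorem integral_sysFun_sq_le {α β : ℝ} (hα : -1 / 2 ≤ α) (hβ : -1 / 2 ≤ β) (c : Bool) (n : ℕ) :
    ∫ θ, sysFun α β c n θ * sysFun α β c n θ ∂(muPlus α β) ≤ 1 / 2 := by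
  by_cases h : c = true ∧ n = 0
  · obtain ⟨rfl, rfl⟩ := h
    rw [integral_congr_ae (g := fun _ => 0)]
    · simp
    · filter_upwards [ae_mem_Ioo α β] with θ hθ
      rw [sysFun_true_zero hα hβ hθ, mul_zero]
  · exact (integral_sysFun_sq hα hβ c n fun hc hn => h ⟨hc, hn⟩).le

theorem muPlus_Icc_ne_zero {α β x y : ℝ} (hx : 0 < x) (hxy : x < y) (hy : y < Real.pi) :
    muPlus α β (Icc x y) ≠ 0 := by
  intro h0
  have hac : volume.restrict (Ioo 0 Real.pi) ≪ muPlus α β := by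
    rw [muPlus_eq]
    refine withDensity_absolutelyContinuous' (measurable_wt α β).ennreal_ofReal.aemeasurable ?_
    filter_upwards [ae_restrict_mem measurableSet_Ioo] with θ hθ
    simpa using wt_pos hθ
  have h1 := hac h0
  rw [Measure.restrict_apply measurableSet_Icc, inter_eq_left.mpr, Real.volume_Icc] at h1
  · simp only [ENNReal.ofReal_eq_zero] at h1
    linarith
  · exact fun θ hθ => ⟨hx.trans_le hθ.1, hθ.2.trans_lt hy⟩

/-- The system is bounded on compact subsets of `(0, π)`, uniformly in `n`: the energy
`E = Φ_{2n}² + Φ_{2n-1}²` satisfies `|E'| ≤ 2 B E` where `B` bounds the drift, and its integral is at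
most `1`. -/
theorem exists_sysFun_bound {α β : ℝ} (hα : -1 / 2 ≤ α) (hβ : -1 / 2 ≤ β) {x y : ℝ} (hx : 0 < x)
    (hxy : x ≤ y) (hy : y < Real.pi) :
    ∃ K : ℝ, ∀ c n, ∀ θ ∈ Icc x y, |sysFun α β c n θ| ≤ K := by
  have := isFiniteMeasure_muPlus hα hβ
  obtain ⟨y', hyy', hy'⟩ := exists_between hy
  have hsub : Icc x y' ⊆ Ioo 0 Real.pi := fun θ hθ => ⟨hx.trans_le hθ.1, hθ.2.trans_lt hy'⟩
  obtain ⟨B, hB⟩ := (isCompact_Icc (a := x) (b := y')).exists_bound_of_continuousOn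
    ((contDiffOn_drift α β (n := 0)).continuousOn.mono hsub)
  set B' := max B 0 with hB'
  have hBB : ∀ θ ∈ Icc x y', |drift α β θ| ≤ B' := fun θ hθ => (hB θ hθ).trans (le_max_left _ _)
  have hB0 : 0 ≤ B' := le_max_right _ _
  set m := (muPlus α β).real (Icc y y') with hm
  have hmpos : 0 < m := ENNReal.toReal_pos
    (muPlus_Icc_ne_zero (hx.trans_le hxy) hyy' hy') (measure_ne_top _ _)
  refine ⟨Real.sqrt (Real.exp (2 * B' * Real.pi) / m), fun c n θ hθ => ?_⟩
  set E : ℝ → ℝ := fun θ => sysFun α β false n θ * sysFun α β false n θ +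
    sysFun α β true n θ * sysFun α β true n θ with hE
  have hE0 : ∀ θ, 0 ≤ E θ := fun θ => add_nonneg (mul_self_nonneg _) (mul_self_nonneg _)
  have hder : ∀ θ ∈ Icc x y', HasDerivAt (fun θ => E θ * Real.exp (2 * B' * θ))
      ((-2 * drift α β θ * (sysFun α β true n θ * sysFun α β true n θ) + 2 * B' * E θ) *
        Real.exp (2 * B' * θ)) θ := by
    intro θ hθ
    have h1 := hasDerivAt_sysFun_false hα hβ n (hsub hθ)
    have h2 := hasDerivAt_sysFun_true hα hβ n (hsub hθ)
    have h3 : HasDerivAt (fun θ => Real.exp (2 * B' * θ)) (Real.exp (2 * B' * θ) * (2 * B')) θ :=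
      (Real.hasDerivAt_exp _).comp θ (by simpa using (hasDerivAt_id θ).const_mul (2 * B'))
    refine (((h1.mul h1).add (h2.mul h2)).mul h3).congr_deriv ?_
    simp only [hE, Pi.add_apply, Pi.mul_apply]
    ring
  have hmono : MonotoneOn (fun θ => E θ * Real.exp (2 * B' * θ)) (Icc x y') := by
    refine monotoneOn_of_deriv_nonneg (convex_Icc _ _)
      (fun θ hθ => (hder θ hθ).continuousAt.continuousWithinAt)
      (fun θ hθ => (hder θ (interior_subset hθ)).differentiableAt.differentiableWithinAt)
      fun θ hθ => ?_
    have hθ' := interior_subset hθ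
    rw [(hder θ hθ').deriv]
    refine mul_nonneg ?_ (Real.exp_pos _).le
    have h1 := abs_le.mp (hBB θ hθ')
    have h2 := mul_self_nonneg (sysFun α β true n θ)
    have h3 := mul_self_nonneg (sysFun α β false n θ)
    simp only [hE]
    nlinarith [mul_nonneg (sub_nonneg.mpr h1.2) h2, mul_nonneg hB0 h3]
  have hcomp : ∀ θ' ∈ Icc y y', E θ ≤ Real.exp (2 * B' * Real.pi) * E θ' := by
    intro θ' hθ'
    have h1 := hmono (a := θ) (b := θ') ⟨hθ.1, hθ.2.trans hyy'.le⟩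
      ⟨hxy.trans hθ'.1, hθ'.2⟩ (hθ.2.trans hθ'.1)
    dsimp only at h1
    have h2 : E θ ≤ E θ * Real.exp (2 * B' * θ) :=
      le_mul_of_one_le_right (hE0 θ) (Real.one_le_exp
        (mul_nonneg (by positivity) (hx.le.trans hθ.1)))
    have h3 : Real.exp (2 * B' * θ') ≤ Real.exp (2 * B' * Real.pi) :=
      Real.exp_le_exp.mpr (by gcongr; exact hθ'.2.trans hy'.le)
    calc E θ ≤ E θ' * Real.exp (2 * B' * θ') := h2.trans h1
      _ ≤ E θ' * Real.exp (2 * B' * Real.pi) := by gcongr; exact hE0 θ'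
      _ = _ := mul_comm _ _
  have hint1 := (memLp_sysFun hα hβ false n).integrable_mul (memLp_sysFun hα hβ false n)
  have hint2 := (memLp_sysFun hα hβ true n).integrable_mul (memLp_sysFun hα hβ true n)
  have hEint : Integrable E (muPlus α β) := hint1.add hint2
  have hEle : ∫ θ, E θ ∂(muPlus α β) ≤ 1 := by
    have e : ∫ θ, E θ ∂(muPlus α β) =
        ∫ θ, sysFun α β false n θ * sysFun α β false n θ ∂(muPlus α β) +
        ∫ θ, sysFun α β true n θ * sysFun α β true n θ ∂(muPlus α β) :=
      integral_add hint1 hint2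
    rw [e]
    linarith [integral_sysFun_sq_le hα hβ false n, integral_sysFun_sq_le hα hβ true n]
  have hmain : m * E θ ≤ Real.exp (2 * B' * Real.pi) := by
    calc m * E θ = ∫ _ in Icc y y', E θ ∂(muPlus α β) := by
          rw [setIntegral_const, smul_eq_mul]
      _ ≤ ∫ θ' in Icc y y', Real.exp (2 * B' * Real.pi) * E θ' ∂(muPlus α β) :=
          setIntegral_mono_on (integrable_const _).integrableOn
            (hEint.const_mul _).integrableOn measurableSet_Icc hcomp
      _ = Real.exp (2 * B' * Real.pi) * ∫ θ' in Icc y y', E θ' ∂(muPlus α β) :=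
          integral_const_mul _ _
      _ ≤ Real.exp (2 * B' * Real.pi) * 1 := by
          gcongr
          exact (setIntegral_le_integral hEint (ae_of_all _ hE0)).trans hEle
      _ = _ := mul_one _
  refine Real.le_sqrt_of_sq_le ?_
  rw [le_div_iff₀ hmpos, sq_abs, mul_comm]
  refine le_trans (mul_le_mul_of_nonneg_left ?_ hmpos.le) hmain
  have h2 := mul_self_nonneg (sysFun α β true n θ)
  have h3 := mul_self_nonneg (sysFun α β false n θ)
  simp only [hE]
  cases c <;> nlinarith

/-- The sign in the first order system that the two halves of the symmetrized system satisfy. -/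
def sgn : Bool → ℝ
  | false => -1
  | true => 1

/-- The zero order term in the first order system. -/
noncomputable def driftOf (α β : ℝ) : Bool → ℝ → ℝ
  | false, _ => 0
  | true, θ => drift α β θ

theorem hasDerivAt_sysFun {α β : ℝ} (hα : -1 / 2 ≤ α) (hβ : -1 / 2 ≤ β) (c : Bool) (n : ℕ) {θ : ℝ}
    (h : θ ∈ Ioo 0 Real.pi) : HasDerivAt (sysFun α β c n)
      (sgn c * Real.sqrt (kap α β n) * sysFun α β (!c) n θ - driftOf α β c θ * sysFun α β c n θ)
      θ := by
  cases c
  · exact (hasDerivAt_sysFun_false hα hβ n h).congr_deriv (by simp [sgn, driftOf])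
  · exact (hasDerivAt_sysFun_true hα hβ n h).congr_deriv (by simp [sgn, driftOf])

theorem contDiffOn_driftOf (α β : ℝ) (c : Bool) {n : WithTop ℕ∞} :
    ContDiffOn ℝ n (driftOf α β c) (Ioo 0 Real.pi) := by
  cases c
  · exact contDiffOn_const
  · exact contDiffOn_drift α β

/-- Sequences of at most polynomial growth. -/
def PolyBdd (a : ℕ → ℂ) : Prop := ∃ (K : ℝ) (m : ℕ), ∀ n, ‖a n‖ ≤ K * ((n : ℝ) + 1) ^ m

theorem PolyBdd.mul {a : ℕ → ℂ} (ha : PolyBdd a) {b : ℕ → ℂ} (hb : PolyBdd b) :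
    PolyBdd fun n => b n * a n := by
  obtain ⟨K, m, h⟩ := ha
  obtain ⟨K', m', h'⟩ := hb
  refine ⟨K' * K, m' + m, fun n => ?_⟩
  rw [norm_mul]
  calc _ ≤ (K' * ((n : ℝ) + 1) ^ m') * (K * ((n : ℝ) + 1) ^ m) :=
        mul_le_mul (h' n) (h n) (norm_nonneg _) ((norm_nonneg _).trans (h' n))
    _ = _ := by ring

theorem polyBdd_sqrt_eigenval {α β : ℝ} (h : 0 ≤ α + β + 1) (d : ℕ) :
    PolyBdd fun n => -((Real.sqrt (eigenval α β (n + d)) : ℝ) : ℂ) := by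
  refine ⟨d + (α + β + 1) / 2 + 1, 1, fun n => ?_⟩
  rw [norm_neg, Complex.norm_real, Real.norm_of_nonneg (Real.sqrt_nonneg _), sqrt_eigenval h]
  push_cast
  have h1 : (0 : ℝ) ≤ d := by positivity
  have h2 : (0 : ℝ) ≤ n := by positivity
  nlinarith [mul_nonneg h1 h2, mul_nonneg h h2]

theorem sqrt_kap_le {α β : ℝ} (n : ℕ) :
    Real.sqrt (kap α β n) ≤ Real.sqrt (eigenval α β n) := by
  refine Real.sqrt_le_sqrt ?_
  rw [← eigenval_sub]
  have : 0 ≤ eigenval α β 0 := sq_nonneg _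
  linarith

theorem polyBdd_sqrt_kap {α β : ℝ} (h : 0 ≤ α + β + 1) (d : ℕ) :
    PolyBdd fun n => ((Real.sqrt (kap α β (n + d)) : ℝ) : ℂ) := by
  obtain ⟨K, m, hK⟩ := polyBdd_sqrt_eigenval h d
  refine ⟨K, m, fun n => le_trans ?_ (hK n)⟩
  rw [norm_neg, Complex.norm_real, Complex.norm_real, Real.norm_of_nonneg (Real.sqrt_nonneg _),
    Real.norm_of_nonneg (Real.sqrt_nonneg _)]
  exact sqrt_kap_le _

theorem polyBdd_neg_sqrt_kap {α β : ℝ} (h : 0 ≤ α + β + 1) (d : ℕ) :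
    PolyBdd fun n => -((Real.sqrt (kap α β (n + d)) : ℝ) : ℂ) := by
  obtain ⟨K, m, hK⟩ := polyBdd_sqrt_kap h d
  exact ⟨K, m, fun n => by rw [norm_neg]; exact hK n⟩

/-- The terms of the series `∑ e^{-t √λ_{n+d}} a_n Ψ_{n+d}(θ)`, where `Ψ_n` is `Φ_{2n}` or
`Φ_{2n-1}`. The shift `d` lets the odd half of the system start at `Φ_1`. -/
noncomputable def serTerm (α β : ℝ) (c : Bool) (d : ℕ) (a : ℕ → ℂ) (t θ : ℝ) (n : ℕ) : ℂ :=
  ((Real.exp (-t * Real.sqrt (eigenval α β (n + d))) : ℝ) : ℂ) * a n *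
    ((sysFun α β c (n + d) θ : ℝ) : ℂ)

/-- The sum of the series with terms `serTerm`. -/
noncomputable def ser (α β : ℝ) (c : Bool) (d : ℕ) (a : ℕ → ℂ) (t θ : ℝ) : ℂ :=
  ∑' n, serTerm α β c d a t θ n

/-- The terms are dominated by a convergent series, locally uniformly in `(t, θ)`. -/
theorem exists_majorant {α β : ℝ} (hα : -1 / 2 ≤ α) (hβ : -1 / 2 ≤ β) (d : ℕ) {a : ℕ → ℂ}
    (ha : PolyBdd a) {t₀ x y : ℝ} (ht₀ : 0 < t₀) (hx : 0 < x) (hxy : x ≤ y) (hy : y < Real.pi) :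
    ∃ u : ℕ → ℝ, Summable u ∧ ∀ c n t θ, t₀ ≤ t → θ ∈ Icc x y →
      ‖serTerm α β c d a t θ n‖ ≤ u n := by
  obtain ⟨K, hK⟩ := exists_sysFun_bound hα hβ hx hxy hy
  obtain ⟨K', m, hK'⟩ := ha
  have hs := (summable_nat_add_iff 1).mpr (Real.summable_pow_mul_exp_neg_nat_mul m ht₀)
  refine ⟨fun n => (K' * Real.exp t₀ * K) * (((n + 1 : ℕ) : ℝ) ^ m *
    Real.exp (-t₀ * ((n + 1 : ℕ) : ℝ))), hs.mul_left _, fun c n t θ ht hθ => ?_⟩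
  have h1 : Real.exp (-t * Real.sqrt (eigenval α β (n + d))) ≤ Real.exp (-t₀ * n) := by
    refine Real.exp_le_exp.mpr ?_
    rw [sqrt_eigenval (by linarith : 0 ≤ α + β + 1)]
    push_cast
    have h1 : (0 : ℝ) ≤ d := by positivity
    have h2 : (0 : ℝ) ≤ n := by positivity
    nlinarith [mul_nonneg (sub_nonneg.mpr ht) h2, mul_nonneg (ht₀.le.trans ht) h1,
      mul_nonneg (ht₀.le.trans ht) (by linarith : 0 ≤ α + β + 1)]
  have e : Real.exp (-t₀ * n) = Real.exp t₀ * Real.exp (-t₀ * ((n + 1 : ℕ) : ℝ)) := by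
    rw [← Real.exp_add]; congr 1; push_cast; ring
  have h2 := hK c (n + d) θ hθ
  have h3 := hK' n
  have hK0 := (abs_nonneg _).trans h2
  rw [serTerm, norm_mul, norm_mul, Complex.norm_real, Complex.norm_real,
    Real.norm_of_nonneg (Real.exp_pos _).le, Real.norm_eq_abs]
  calc _ ≤ Real.exp (-t₀ * n) * (K' * ((n : ℝ) + 1) ^ m) * K :=
        mul_le_mul (mul_le_mul h1 h3 (norm_nonneg _) (Real.exp_pos _).le) h2 (abs_nonneg _)
          (mul_nonneg (Real.exp_pos _).le ((norm_nonneg _).trans h3))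
    _ = _ := by rw [e]; push_cast; ring

theorem summable_serTerm {α β : ℝ} (hα : -1 / 2 ≤ α) (hβ : -1 / 2 ≤ β) (c : Bool) (d : ℕ)
    {a : ℕ → ℂ} (ha : PolyBdd a) {t θ : ℝ} (ht : 0 < t) (hθ : θ ∈ Ioo 0 Real.pi) :
    Summable (serTerm α β c d a t θ) := by
  obtain ⟨u, hu, h⟩ := exists_majorant hα hβ d ha ht hθ.1 le_rfl hθ.2
  exact Summable.of_norm_bounded hu fun n => h c n t θ le_rfl ⟨le_rfl, le_rfl⟩

/-- The linear map `(τ, η) ↦ τ v + η w`. -/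
noncomputable def gradMap (v w : ℂ) : ℝ × ℝ →L[ℝ] ℂ :=
  (ContinuousLinearMap.fst ℝ ℝ ℝ).smulRight v + (ContinuousLinearMap.snd ℝ ℝ ℝ).smulRight w

theorem norm_gradMap_le (v w : ℂ) : ‖gradMap v w‖ ≤ ‖v‖ + ‖w‖ := by
  refine (norm_add_le _ _).trans (add_le_add ?_ ?_)
  · rw [ContinuousLinearMap.norm_smulRight_apply]
    exact mul_le_of_le_one_left (norm_nonneg _) (ContinuousLinearMap.norm_fst_le ..)
  · rw [ContinuousLinearMap.norm_smulRight_apply]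
    exact mul_le_of_le_one_left (norm_nonneg _) (ContinuousLinearMap.norm_snd_le ..)

theorem hasSum_gradMap {v w : ℕ → ℂ} {V W : ℂ} (hv : HasSum v V) (hw : HasSum w W) :
    HasSum (fun n => gradMap (v n) (w n)) (gradMap V W) :=
  (hv.mapL (ContinuousLinearMap.smulRightL ℝ (ℝ × ℝ) ℂ (ContinuousLinearMap.fst ℝ ℝ ℝ))).add
    (hw.mapL (ContinuousLinearMap.smulRightL ℝ (ℝ × ℝ) ℂ (ContinuousLinearMap.snd ℝ ℝ ℝ)))

/-- The class of series `ser` is closed under differentiation. -/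
theorem hasFDerivAt_ser {α β : ℝ} (hα : -1 / 2 ≤ α) (hβ : -1 / 2 ≤ β) (c : Bool) (d : ℕ)
    {a : ℕ → ℂ} (ha : PolyBdd a) {p : ℝ × ℝ} (hp : p ∈ Ioi (0 : ℝ) ×ˢ Ioo 0 Real.pi) :
    HasFDerivAt (fun p : ℝ × ℝ => ser α β c d a p.1 p.2)
      (gradMap (ser α β c d (fun n => -((Real.sqrt (eigenval α β (n + d)) : ℝ) : ℂ) * a n) p.1 p.2)
        ((sgn c : ℂ) * ser α β (!c) d (fun n => ((Real.sqrt (kap α β (n + d)) : ℝ) : ℂ) * a n)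
          p.1 p.2 - (driftOf α β c p.2 : ℂ) * ser α β c d a p.1 p.2)) p := by
  obtain ⟨t, θ⟩ := p
  obtain ⟨ht, hθ⟩ := hp
  have ht : 0 < t := ht
  have hθ : θ ∈ Ioo 0 Real.pi := hθ
  have hAB : 0 ≤ α + β + 1 := by linarith
  set a₁ : ℕ → ℂ := fun n => -((Real.sqrt (eigenval α β (n + d)) : ℝ) : ℂ) * a n with ha₁
  set a₂ : ℕ → ℂ := fun n => ((Real.sqrt (kap α β (n + d)) : ℝ) : ℂ) * a n with ha₂
  have hb₁ : PolyBdd a₁ := ha.mul (polyBdd_sqrt_eigenval hAB d)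
  have hb₂ : PolyBdd a₂ := ha.mul (polyBdd_sqrt_kap hAB d)
  obtain ⟨x, hx0, hxθ⟩ := exists_between hθ.1
  obtain ⟨y, hθy, hyπ⟩ := exists_between hθ.2
  obtain ⟨t₀, ht₀, ht₀t⟩ := exists_between ht
  have hxy : x ≤ y := (hxθ.trans hθy).le
  obtain ⟨u₀, hu₀, hm₀⟩ := exists_majorant hα hβ d ha ht₀ hx0 hxy hyπ
  obtain ⟨u₁, hu₁, hm₁⟩ := exists_majorant hα hβ d hb₁ ht₀ hx0 hxy hyπ
  obtain ⟨u₂, hu₂, hm₂⟩ := exists_majorant hα hβ d hb₂ ht₀ hx0 hxy hyπ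
  have hsub : Icc x y ⊆ Ioo 0 Real.pi := fun θ hθ => ⟨hx0.trans_le hθ.1, hθ.2.trans_lt hyπ⟩
  obtain ⟨B, hB⟩ := (isCompact_Icc (a := x) (b := y)).exists_bound_of_continuousOn
    ((contDiffOn_driftOf α β c (n := 0)).continuousOn.mono hsub)
  set U : Set (ℝ × ℝ) := Ioi t₀ ×ˢ Ioo x y with hU
  have hder : ∀ n, ∀ p ∈ U, HasFDerivAt (fun p : ℝ × ℝ => serTerm α β c d a p.1 p.2 n)
      (gradMap (serTerm α β c d a₁ p.1 p.2 n) ((sgn c : ℂ) * serTerm α β (!c) d a₂ p.1 p.2 n -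
        (driftOf α β c p.2 : ℂ) * serTerm α β c d a p.1 p.2 n)) p := by
    intro n p hp
    have h1 : HasDerivAt (fun t : ℝ => Real.exp (-t * Real.sqrt (eigenval α β (n + d))))
        (Real.exp (-p.1 * Real.sqrt (eigenval α β (n + d))) *
          (-Real.sqrt (eigenval α β (n + d)))) p.1 :=
      (Real.hasDerivAt_exp _).comp p.1 (by
        simpa using (hasDerivAt_neg p.1).mul_const (Real.sqrt (eigenval α β (n + d))))
    have h2 := hasDerivAt_sysFun hα hβ c (n + d) (hsub ⟨hp.2.1.le, hp.2.2.le⟩)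
    have h3 := (h1.ofReal_comp.hasFDerivAt.comp p hasFDerivAt_fst).mul_const (a n)
    have h4 := h2.ofReal_comp.hasFDerivAt.comp p hasFDerivAt_snd
    refine (h3.mul h4).congr_fderiv (ContinuousLinearMap.ext fun v => ?_)
    simp only [gradMap, serTerm, ha₁, ha₂, add_apply, smul_apply,
      ContinuousLinearMap.comp_apply, ContinuousLinearMap.smulRight_apply, smul_eq_mul,
      Function.comp_apply, ContinuousLinearMap.coe_fst', ContinuousLinearMap.coe_snd',
      Complex.real_smul, ContinuousLinearMap.toSpanSingleton_apply]
    push_cast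
    ring
  have hbd : ∀ n, ∀ p ∈ U, ‖gradMap (serTerm α β c d a₁ p.1 p.2 n)
      ((sgn c : ℂ) * serTerm α β (!c) d a₂ p.1 p.2 n -
        (driftOf α β c p.2 : ℂ) * serTerm α β c d a p.1 p.2 n)‖ ≤ u₁ n + (u₂ n + B * u₀ n) := by
    intro n p hp
    have hp2 : p.2 ∈ Icc x y := ⟨hp.2.1.le, hp.2.2.le⟩
    have hp1 : t₀ ≤ p.1 := le_of_lt hp.1
    refine (norm_gradMap_le _ _).trans (add_le_add (hm₁ c n _ _ hp1 hp2) ?_)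
    refine (norm_sub_le _ _).trans (add_le_add ?_ ?_)
    · rw [norm_mul, Complex.norm_real]
      refine le_trans (mul_le_of_le_one_left (norm_nonneg _) ?_) (hm₂ (!c) n _ _ hp1 hp2)
      cases c <;> simp [sgn]
    · rw [norm_mul, Complex.norm_real]
      exact mul_le_mul (hB _ hp2) (hm₀ c n _ _ hp1 hp2) (norm_nonneg _)
        ((norm_nonneg _).trans (hB _ hp2))
  have hpU : ((t, θ) : ℝ × ℝ) ∈ U := ⟨ht₀t, hxθ, hθy⟩
  have hmain := hasFDerivAt_tsum_of_isPreconnected (hu₁.add (hu₂.add (hu₀.mul_left B)))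
    (isOpen_Ioi.prod isOpen_Ioo) ((convex_Ioi t₀).prod (convex_Ioo x y)).isPreconnected
    hder hbd hpU (summable_serTerm hα hβ c d ha ht hθ) hpU
  refine hmain.congr_fderiv ?_
  refine HasSum.tsum_eq (hasSum_gradMap (summable_serTerm hα hβ c d hb₁ ht hθ).hasSum ?_)
  exact ((summable_serTerm hα hβ (!c) d hb₂ ht hθ).hasSum.mul_left _).sub
    ((summable_serTerm hα hβ c d ha ht hθ).hasSum.mul_left _)

/-- By induction on the order of smoothness, as the first derivatives are series of the same kind. -/
theorem contDiffOn_ser {α β : ℝ} (hα : -1 / 2 ≤ α) (hβ : -1 / 2 ≤ β) (c : Bool) (d : ℕ)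
    {a : ℕ → ℂ} (ha : PolyBdd a) :
    ContDiffOn ℝ ((⊤ : ℕ∞) : WithTop ℕ∞) (fun p : ℝ × ℝ => ser α β c d a p.1 p.2)
      (Ioi (0 : ℝ) ×ˢ Ioo 0 Real.pi) := by
  have hopen : IsOpen (Ioi (0 : ℝ) ×ˢ Ioo 0 Real.pi) := isOpen_Ioi.prod isOpen_Ioo
  have hAB : 0 ≤ α + β + 1 := by linarith
  refine contDiffOn_infty.mpr fun k => ?_
  induction k generalizing c a with
  | zero =>
    exact contDiffOn_zero.mpr fun p hp =>
      (hasFDerivAt_ser hα hβ c d ha hp).continuousAt.continuousWithinAt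
  | succ k ih =>
    rw [Nat.cast_add, Nat.cast_one, contDiffOn_succ_iff_fderiv_of_isOpen hopen]
    refine ⟨fun p hp => (hasFDerivAt_ser hα hβ c d ha hp).differentiableAt.differentiableWithinAt,
      fun h => absurd h (by simp), ?_⟩
    refine ContDiffOn.congr ?_ fun p hp => (hasFDerivAt_ser hα hβ c d ha hp).fderiv
    have h1 := ih c (ha.mul (polyBdd_sqrt_eigenval hAB d))
    have h2 := ih (!c) (ha.mul (polyBdd_sqrt_kap hAB d))
    have h3 := ih c ha
    have h4 : ContDiffOn ℝ k (fun p : ℝ × ℝ => (driftOf α β c p.2 : ℂ))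
        (Ioi (0 : ℝ) ×ˢ Ioo 0 Real.pi) :=
      Complex.ofRealCLM.contDiff.comp_contDiffOn
        ((contDiffOn_driftOf α β c).comp contDiffOn_snd fun p hp => hp.2)
    exact ((ContinuousLinearMap.smulRightL ℝ (ℝ × ℝ) ℂ
        (ContinuousLinearMap.fst ℝ ℝ ℝ)).contDiff.comp_contDiffOn h1).add
      ((ContinuousLinearMap.smulRightL ℝ (ℝ × ℝ) ℂ
        (ContinuousLinearMap.snd ℝ ℝ ℝ)).contDiff.comp_contDiffOn
          ((contDiffOn_const.mul h2).sub (h4.mul h3)))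

theorem hasDerivAt_ser_time {α β : ℝ} (hα : -1 / 2 ≤ α) (hβ : -1 / 2 ≤ β) (c : Bool) (d : ℕ)
    {a : ℕ → ℂ} (ha : PolyBdd a) {t θ : ℝ} (ht : 0 < t) (hθ : θ ∈ Ioo 0 Real.pi) :
    HasDerivAt (fun t => ser α β c d a t θ)
      (ser α β c d (fun n => -((Real.sqrt (eigenval α β (n + d)) : ℝ) : ℂ) * a n) t θ) t := by
  have h1 := hasFDerivAt_ser hα hβ c d ha (p := (t, θ)) ⟨ht, hθ⟩
  have h2 := h1.comp_hasDerivAt t ((hasDerivAt_id t).prodMk (hasDerivAt_const t θ))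
  refine h2.congr_deriv ?_
  simp [gradMap]

theorem hasDerivAt_ser_space {α β : ℝ} (hα : -1 / 2 ≤ α) (hβ : -1 / 2 ≤ β) (c : Bool) (d : ℕ)
    {a : ℕ → ℂ} (ha : PolyBdd a) {t θ : ℝ} (ht : 0 < t) (hθ : θ ∈ Ioo 0 Real.pi) :
    HasDerivAt (ser α β c d a t)
      ((sgn c : ℂ) * ser α β (!c) d (fun n => ((Real.sqrt (kap α β (n + d)) : ℝ) : ℂ) * a n) t θ -
        (driftOf α β c θ : ℂ) * ser α β c d a t θ) θ := by
  have h1 := hasFDerivAt_ser hα hβ c d ha (p := (t, θ)) ⟨ht, hθ⟩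
  have h2 := h1.comp_hasDerivAt θ ((hasDerivAt_const θ t).prodMk (hasDerivAt_id θ))
  refine h2.congr_deriv ?_
  simp [gradMap]

end SymJacobi

/-! ### Iterated derivatives of the series -/

namespace SymJacobi

/-- `deltaEven` for `c = false` and `deltaOdd` for `c = true`. -/
noncomputable def deltaSeq (α β : ℝ) (c : Bool) (N : ℕ) (g : ℝ → ℂ) : ℝ → ℂ :=
  if c then deltaOdd α β N g else deltaEven α β N g

/-- The half of the system reached from the half `c` after `N` derivatives. -/
def par (c : Bool) (N : ℕ) : Bool := if Even N then c else !c

theorem par_zero (c : Bool) : par c 0 = c := by simp [par]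

theorem par_succ (c : Bool) (N : ℕ) : par c (N + 1) = !(par c N) := by
  by_cases h : Even N <;> simp [par, h, Nat.even_add_one]

/-- A sequence of functions that are successively related by `δ` and `δ*` on `(0, π)`, the half `c`
telling which of the two acts first, gives the iterated derivatives of its first member. -/
theorem deltaSeq_eq {α β : ℝ} {c : Bool} {x : ℕ → ℝ → ℂ}
    (hx : ∀ N, ∀ θ ∈ Ioo 0 Real.pi, HasDerivAt (x N)
      (-(sgn (par c N) : ℂ) * x (N + 1) θ - (driftOf α β (par c N) θ : ℂ) * x N θ) θ)
    (N : ℕ) : ∀ θ ∈ Ioo 0 Real.pi, deltaSeq α β c N (x 0) θ = x N θ := by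
  induction N with
  | zero => intro θ _; cases c <;> rfl
  | succ N ih =>
    intro θ hθ
    have he : deltaSeq α β c N (x 0) =ᶠ[𝓝 θ] x N := by
      filter_upwards [isOpen_Ioo.mem_nhds hθ] with y hy using ih y hy
    have hd := he.deriv_eq.trans (hx N θ hθ).deriv
    have e : deltaSeq α β c (N + 1) (x 0) θ = if par c N then
        deltaStar α β (deltaSeq α β c N (x 0)) θ else delta (deltaSeq α β c N (x 0)) θ := by
      cases c <;> by_cases h : Even N <;> simp [deltaSeq, deltaEven, deltaOdd, par, h]
    rw [e]
    cases h : par c N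
    · simp only [Bool.false_eq_true, if_false, delta]
      rw [hd, h]
      simp [sgn, driftOf]
    · simp only [if_true, deltaStar]
      rw [hd, he.eq_of_nhds, h]
      simp only [sgn, driftOf, drift]
      push_cast
      ring

theorem deltaSeq_sysFun {α β : ℝ} (hα : -1 / 2 ≤ α) (hβ : -1 / 2 ≤ β) (c : Bool) (N n : ℕ) {θ : ℝ}
    (hθ : θ ∈ Ioo 0 Real.pi) :
    deltaSeq α β c N (fun x => ((sysFun α β c n x : ℝ) : ℂ)) θ =
      (((-Real.sqrt (kap α β n)) ^ N * sysFun α β (par c N) n θ : ℝ) : ℂ) := by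
  refine (congrArg (fun g => deltaSeq α β c N g θ) ?_).trans
    (deltaSeq_eq (α := α) (β := β) (c := c) (x := fun N θ =>
      (((-Real.sqrt (kap α β n)) ^ N * sysFun α β (par c N) n θ : ℝ) : ℂ)) (fun N θ hθ => ?_) N θ hθ)
  · funext x; simp [par_zero]
  · refine (((hasDerivAt_sysFun hα hβ (par c N) n hθ).const_mul
      ((-Real.sqrt (kap α β n)) ^ N)).ofReal_comp).congr_deriv ?_
    rw [par_succ]
    push_cast
    ring

theorem polyBdd_pow_mul {a b : ℕ → ℂ} (ha : PolyBdd a) (hb : PolyBdd b) (N : ℕ) :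
    PolyBdd fun n => b n ^ N * a n := by
  induction N with
  | zero => simpa using ha
  | succ N ih => simpa only [pow_succ', mul_assoc] using ih.mul hb

theorem deltaSeq_ser {α β : ℝ} (hα : -1 / 2 ≤ α) (hβ : -1 / 2 ≤ β) (c : Bool) (N d : ℕ) {a : ℕ → ℂ}
    (ha : PolyBdd a) {t θ : ℝ} (ht : 0 < t) (hθ : θ ∈ Ioo 0 Real.pi) :
    deltaSeq α β c N (ser α β c d a t) θ =
      ser α β (par c N) d (fun n => (-((Real.sqrt (kap α β (n + d)) : ℝ) : ℂ)) ^ N * a n) t θ := by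
  have hb := polyBdd_neg_sqrt_kap (by linarith : 0 ≤ α + β + 1) d
  refine (congrArg (fun g => deltaSeq α β c N g θ) ?_).trans
    (deltaSeq_eq (α := α) (β := β) (c := c) (x := fun N θ => ser α β (par c N) d
      (fun n => (-((Real.sqrt (kap α β (n + d)) : ℝ) : ℂ)) ^ N * a n) t θ) (fun N θ hθ => ?_) N θ hθ)
  · funext x; simp [par_zero]
  · refine (hasDerivAt_ser_space hα hβ (par c N) d (polyBdd_pow_mul ha hb N) ht hθ).congr_deriv ?_
    rw [par_succ]
    congr 1
    simp only [ser, ← tsum_mul_left]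
    refine tsum_congr fun n => ?_
    simp only [serTerm]
    ring

theorem iteratedDeriv_ser {α β : ℝ} (hα : -1 / 2 ≤ α) (hβ : -1 / 2 ≤ β) (c : Bool) (M d : ℕ)
    {a : ℕ → ℂ} (ha : PolyBdd a) {θ : ℝ} (hθ : θ ∈ Ioo 0 Real.pi) : ∀ t : ℝ, 0 < t →
    iteratedDeriv M (fun t => ser α β c d a t θ) t = ser α β c d
      (fun n => (-((Real.sqrt (eigenval α β (n + d)) : ℝ) : ℂ)) ^ M * a n) t θ := by
  induction M with
  | zero => intro t _; simp
  | succ M ih =>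
    intro t ht
    have he : iteratedDeriv M (fun t => ser α β c d a t θ) =ᶠ[𝓝 t] fun t => ser α β c d
        (fun n => (-((Real.sqrt (eigenval α β (n + d)) : ℝ) : ℂ)) ^ M * a n) t θ := by
      filter_upwards [isOpen_Ioi.mem_nhds ht] with s hs using ih s hs
    have hb := polyBdd_sqrt_eigenval (by linarith : 0 ≤ α + β + 1) d
    rw [iteratedDeriv_succ, he.deriv_eq,
      (hasDerivAt_ser_time hα hβ c d (polyBdd_pow_mul ha hb M) ht hθ).deriv]
    simp only [pow_succ', mul_assoc]

/-- The mixed derivatives of the Poisson type series. -/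
theorem iteratedDeriv_deltaSeq_ser {α β : ℝ} (hα : -1 / 2 ≤ α) (hβ : -1 / 2 ≤ β) (c : Bool)
    (M N d : ℕ) {a : ℕ → ℂ} (ha : PolyBdd a) {t θ : ℝ} (ht : 0 < t) (hθ : θ ∈ Ioo 0 Real.pi) :
    iteratedDeriv M (fun s => deltaSeq α β c N (ser α β c d a s) θ) t =
      ser α β (par c N) d (fun n => (-((Real.sqrt (eigenval α β (n + d)) : ℝ) : ℂ)) ^ M *
        ((-((Real.sqrt (kap α β (n + d)) : ℝ) : ℂ)) ^ N * a n)) t θ := by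
  have hb := polyBdd_neg_sqrt_kap (by linarith : 0 ≤ α + β + 1) d
  rw [← iteratedDeriv_ser hα hβ (par c N) M d (polyBdd_pow_mul ha hb N) hθ t ht]
  refine Filter.EventuallyEq.iteratedDeriv_eq M ?_
  filter_upwards [isOpen_Ioi.mem_nhds ht] with s hs using deltaSeq_ser hα hβ c N d ha hs hθ

end SymJacobi

/-! ### Riesz transforms and multipliers -/

namespace SymJacobi

open Polynomial

/-- The orthonormal systems `√2 Φ_{2n}` and `√2 Φ_{2n+1}` are Jacobi systems. The second one is
`sin θ` times polynomials of type `(α + 1, β + 1)`. -/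
theorem exists_isJacobiSystem {α β : ℝ} (hα : -1 / 2 ≤ α) (hβ : -1 / 2 ≤ β) (c : Bool) :
    ∃ (a b k : ℝ) (s : ℝ → ℝ) (q : ℕ → ℝ[X]),
      IsJacobiSystem a b k (muPlus α β) s q (fun n => eigenval α β (n + c.toNat)) ∧
      ∀ n, ∀ θ ∈ Ioo 0 Real.pi, s θ * (q n).eval (Real.cos θ) =
        Real.sqrt 2 * sysFun α β c (n + c.toNat) θ := by
  have hAB : 0 ≤ α + β + 1 := by linarith
  have h2 : Real.sqrt 2 ≠ 0 := by positivity
  -- orthonormality, in either case, from the corresponding property of the system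
  have horth : ∀ (s : ℝ → ℝ) (q : ℕ → ℝ[X]), (∀ n, ∀ θ ∈ Ioo 0 Real.pi,
      s θ * (q n).eval (Real.cos θ) = Real.sqrt 2 * sysFun α β c (n + c.toNat) θ) → ∀ n m,
      ∫ θ, s θ * (q n).eval (Real.cos θ) * (s θ * (q m).eval (Real.cos θ)) ∂(muPlus α β) =
        if n = m then 1 else 0 := by
    intro s q hq n m
    have e : ∫ θ, s θ * (q n).eval (Real.cos θ) * (s θ * (q m).eval (Real.cos θ)) ∂(muPlus α β) =
        ∫ θ, 2 * (sysFun α β c (n + c.toNat) θ * sysFun α β c (m + c.toNat) θ) ∂(muPlus α β) := by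
      refine integral_congr_ae ?_
      filter_upwards [ae_mem_Ioo α β] with θ hθ
      rw [hq n θ hθ, hq m θ hθ]
      linear_combination sysFun α β c (n + c.toNat) θ * sysFun α β c (m + c.toNat) θ *
        Real.mul_self_sqrt (zero_le_two (α := ℝ))
    rw [e, integral_const_mul]
    split_ifs with h
    · rw [h, integral_sysFun_sq hα hβ c _ (by rintro rfl; simp)]
      norm_num
    · rw [integral_sysFun_mul hα hβ c (by omega), mul_zero]
  have hjac : ∀ (a b r : ℝ) (p : ℝ[X]), jacOp a b (C r * p) = C r * jacOp a b p := by
    intro a b r p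
    simpa using jacOp_sum a b {()} (fun _ => r) (fun _ => p)
  cases c
  · have hq : ∀ n, ∀ θ ∈ Ioo 0 Real.pi, (1 : ℝ) * (C (Real.sqrt 2) * nPoly α β n).eval (Real.cos θ) =
        Real.sqrt 2 * sysFun α β false (n + false.toNat) θ := by
      intro n θ hθ
      simp [sysFun_false _ _ _ hθ]
    refine ⟨α, β, eigenval α β 0, fun _ => 1, fun n => C (Real.sqrt 2) * nPoly α β n,
      ⟨by linarith, by linarith, sq_nonneg _, fun _ => sq_nonneg _, isFiniteMeasure_muPlus hα hβ,
        ae_mem_Ioo α β, measurable_const, fun _ _ => one_pos, fun _ => by simp, fun n => ?_,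
        fun n => ?_, horth _ _ hq⟩, hq⟩
    · rw [degree_C_mul h2, degree_eq_natDegree (nPoly_ne_zero hα hβ n), natDegree_nPoly hα hβ]
    · have e : eigenval α β 0 - eigenval α β (n + false.toNat) = -kap α β n := by
        rw [← eigenval_sub, Bool.toNat_false, add_zero]; ring
      rw [hjac, jacOp_nPoly, e]
      ring
  · have hr : ∀ n, Real.sqrt 2 * kap α β (n + 1) ^ (-(1 / 2) : ℝ) ≠ 0 := fun n => by
      have := one_le_kap hAB (Nat.succ_ne_zero n)
      have : (0 : ℝ) < kap α β (n + 1) := by linarith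
      positivity
    have hq : ∀ n, ∀ θ ∈ Ioo 0 Real.pi, Real.sin θ *
        (C (Real.sqrt 2 * kap α β (n + 1) ^ (-(1 / 2) : ℝ)) *
          derivative (nPoly α β (n + 1))).eval (Real.cos θ) =
        Real.sqrt 2 * sysFun α β true (n + true.toNat) θ := by
      intro n θ hθ
      rw [Bool.toNat_true, sysFun_true _ _ _ hθ, eval_mul, eval_C]
      ring
    refine ⟨α + 1, β + 1, eigenval α β 0 + (α + β + 2), Real.sin, fun n =>
      C (Real.sqrt 2 * kap α β (n + 1) ^ (-(1 / 2) : ℝ)) * derivative (nPoly α β (n + 1)),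
      ⟨by linarith, by linarith, add_nonneg (sq_nonneg _) (by linarith), fun _ => sq_nonneg _,
        isFiniteMeasure_muPlus hα hβ, ae_mem_Ioo α β, Real.measurable_sin,
        fun θ hθ => Real.sin_pos_of_pos_of_lt_pi hθ.1 hθ.2, Real.abs_sin_le_one, fun n => ?_,
        fun n => ?_, horth _ _ hq⟩, hq⟩
    · rw [degree_C_mul (hr n), degree_derivative (by rw [natDegree_nPoly hα hβ]; omega),
        natDegree_nPoly hα hβ, Nat.add_sub_cancel]
    · have e : eigenval α β 0 + (α + β + 2) - eigenval α β (n + true.toNat) =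
          -kap α β (n + 1) + (α + β + 2) := by
        rw [← eigenval_sub, Bool.toNat_true]; ring
      rw [hjac, jacOp_derivative, jacOp_nPoly, derivative_C_mul, e, C_add (a := -kap α β (n + 1))]
      ring

theorem memLp_sysFun_ofReal {α β : ℝ} (hα : -1 / 2 ≤ α) (hβ : -1 / 2 ≤ β) (c : Bool) (n : ℕ) :
    MemLp (fun θ => ((sysFun α β c n θ : ℝ) : ℂ)) 2 (muPlus α β) :=
  (memLp_sysFun hα hβ c n).ofReal

/-- The members of the symmetrized system as elements of `L²`. -/
noncomputable def sysVec {α β : ℝ} (hα : -1 / 2 ≤ α) (hβ : -1 / 2 ≤ β) (c : Bool) (n : ℕ) :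
    L2 α β := (memLp_sysFun_ofReal hα hβ c n).toLp

theorem coeFn_sysVec {α β : ℝ} (hα : -1 / 2 ≤ α) (hβ : -1 / 2 ≤ β) (c : Bool) (n : ℕ) :
    sysVec hα hβ c n =ᵐ[muPlus α β] fun θ => ((sysFun α β c n θ : ℝ) : ℂ) :=
  MemLp.coeFn_toLp _

theorem inner_sysVec {α β : ℝ} (hα : -1 / 2 ≤ α) (hβ : -1 / 2 ≤ β) (c : Bool) (n : ℕ)
    (f : L2 α β) : inner ℂ (sysVec hα hβ c n) f =
      ∫ θ, f θ * conj ((sysFun α β c n θ : ℝ) : ℂ) ∂(muPlus α β) := by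
  rw [L2.inner_def]
  refine integral_congr_ae ?_
  filter_upwards [coeFn_sysVec hα hβ c n] with θ h
  rw [h, RCLike.inner_apply]

theorem coeff_even {α β : ℝ} (hα : -1 / 2 ≤ α) (hβ : -1 / 2 ≤ β) (f : L2 α β) (n : ℕ) :
    coeff α β f (2 * n) = inner ℂ (sysVec hα hβ false n) f := by
  rw [inner_sysVec, coeff, Phi_even]

theorem coeff_odd {α β : ℝ} (hα : -1 / 2 ≤ α) (hβ : -1 / 2 ≤ β) (f : L2 α β) (n : ℕ) :
    coeff α β f (2 * n + 1) = inner ℂ (sysVec hα hβ true (n + 1)) f := by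
  rw [inner_sysVec, coeff, Phi_odd]

theorem inner_sysVec_sysVec {α β : ℝ} (hα : -1 / 2 ≤ α) (hβ : -1 / 2 ≤ β) (c : Bool) (n m : ℕ) :
    inner ℂ (sysVec hα hβ c n) (sysVec hα hβ c m) =
      ((∫ θ, sysFun α β c n θ * sysFun α β c m θ ∂(muPlus α β) : ℝ) : ℂ) := by
  rw [inner_sysVec]
  refine (integral_congr_ae ?_).trans integral_ofReal
  filter_upwards [coeFn_sysVec hα hβ c m] with θ h
  rw [h, Complex.conj_ofReal]
  push_cast
  exact mul_comm _ _

theorem norm_sq_sysVec_le {α β : ℝ} (hα : -1 / 2 ≤ α) (hβ : -1 / 2 ≤ β) (c : Bool) (n : ℕ) :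
    ‖sysVec hα hβ c n‖ ^ 2 ≤ 1 := by
  have h := inner_self_eq_norm_sq_to_K (𝕜 := ℂ) (sysVec hα hβ c n)
  rw [inner_sysVec_sysVec] at h
  have h2 : ∫ θ, sysFun α β c n θ * sysFun α β c n θ ∂(muPlus α β) = ‖sysVec hα hβ c n‖ ^ 2 := by
    refine Complex.ofReal_injective (h.trans ?_)
    rw [Complex.ofReal_pow]
    rfl
  rw [← h2]
  linarith [integral_sysFun_sq_le hα hβ c n]

theorem inner_sysVec_of_ne {α β : ℝ} (hα : -1 / 2 ≤ α) (hβ : -1 / 2 ≤ β) (c : Bool) {n m : ℕ}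
    (h : n ≠ m) : inner ℂ (sysVec hα hβ c n) (sysVec hα hβ c m) = 0 := by
  rw [inner_sysVec_sysVec, integral_sysFun_mul hα hβ c h, Complex.ofReal_zero]

theorem bessel_sysVec {α β : ℝ} (hα : -1 / 2 ≤ α) (hβ : -1 / 2 ≤ β) (c : Bool) (d : ℕ)
    (f : L2 α β) (S : Finset ℕ) :
    ∑ i ∈ S, ‖inner ℂ (sysVec hα hβ c (i + d)) f‖ ^ 2 ≤ ‖f‖ ^ 2 :=
  sum_norm_sq_inner_le (fun _ _ hij => inner_sysVec_of_ne hα hβ c (by omega))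
    (fun _ => norm_sq_sysVec_le hα hβ c _) f S

theorem polyBdd_inner {α β : ℝ} (hα : -1 / 2 ≤ α) (hβ : -1 / 2 ≤ β) (c : Bool) (d : ℕ)
    (f : L2 α β) : PolyBdd fun n => inner ℂ (sysVec hα hβ c (n + d)) f := by
  refine ⟨‖f‖, 0, fun n => ?_⟩
  have h1 := bessel_sysVec hα hβ c d f {n}
  rw [Finset.sum_singleton] at h1
  simpa using le_of_sq_le_sq h1 (norm_nonneg _)

/-- An operator that acts diagonally, with bounded coefficients, from one half of the system to the
same or the other half is bounded. -/
theorem seriesBoundedOnL2_of_diagonal {α β : ℝ} (hα : -1 / 2 ≤ α) (hβ : -1 / 2 ≤ β) (c c' : Bool)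
    (d : ℕ) {u : L2 α β → ℕ → ℝ → ℂ} {m : ℕ → ℂ} {K : ℝ} (hm : ∀ n, ‖m n‖ ≤ K)
    (hu : ∀ f n, ∀ θ ∈ Ioo 0 Real.pi, u f n θ = m n * inner ℂ (sysVec hα hβ c (n + d)) f *
      ((sysFun α β c' (n + d) θ : ℝ) : ℂ)) : SeriesBoundedOnL2 α β u := by
  obtain ⟨T, hT, -⟩ := exists_clm_hasSum (𝕜 := ℂ) (e := fun n => sysVec hα hβ c (n + d))
    (v := fun n => m n • sysVec hα hβ c' (n + d)) (K := K ^ 2) (bessel_sysVec hα hβ c d)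
    (norm_sq_sum_smul_le_of_orthogonal (fun i j hij => by
      change inner ℂ (m i • sysVec hα hβ c' (i + d)) (m j • sysVec hα hβ c' (j + d)) = 0
      rw [inner_smul_left, inner_smul_right, inner_sysVec_of_ne hα hβ c' (by omega)]
      simp) (fun i => by
      rw [norm_smul, mul_pow]
      have h1 := norm_sq_sysVec_le hα hβ c' (i + d)
      have h2 := pow_le_pow_left₀ (norm_nonneg _) (hm i) 2
      nlinarith [sq_nonneg ‖m i‖, sq_nonneg ‖sysVec hα hβ c' (i + d)‖]))
  refine ⟨T, fun f => ?_⟩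
  have hae : ∀ n, u f n =ᵐ[muPlus α β]
      (inner ℂ (sysVec hα hβ c (n + d)) f • m n • sysVec hα hβ c' (n + d) : L2 α β) := by
    intro n
    rw [smul_smul]
    filter_upwards [ae_mem_Ioo α β, coeFn_sysVec hα hβ c' (n + d),
      Lp.coeFn_smul (inner ℂ (sysVec hα hβ c (n + d)) f * m n) (sysVec hα hβ c' (n + d))]
      with θ h1 h2 h3
    rw [h3, Pi.smul_apply, h2, hu f n θ h1, smul_eq_mul]
    ring
  have hmem : ∀ n, MemLp (u f n) 2 (muPlus α β) := fun n =>
    (Lp.memLp _).ae_eq (hae n).symm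
  refine ⟨hmem, ?_⟩
  convert hT f using 2 with n
  refine Lp.ext ((MemLp.coeFn_toLp (hmem n)).trans (hae n))

/-- The coefficients of the Riesz transforms are bounded. If `λ_n = 0`, the factor `0 ^ (-N / 2)` is
zero, so that the term drops out. -/
theorem norm_riesz_le {α β : ℝ} {N : ℕ} (hN : 1 ≤ N) (n : ℕ) :
    ‖((eigenval α β n ^ (-(N : ℝ) / 2) * (-Real.sqrt (kap α β n)) ^ N : ℝ) : ℂ)‖ ≤ 1 := by
  have hl : 0 ≤ eigenval α β n := sq_nonneg _
  rw [Complex.norm_real, norm_mul, norm_pow, norm_neg, Real.norm_of_nonneg (Real.sqrt_nonneg _),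
    Real.norm_of_nonneg (Real.rpow_nonneg hl _)]
  rcases hl.eq_or_lt with h | h
  · have : (N : ℝ) ≠ 0 := by positivity
    rw [← h, Real.zero_rpow (div_ne_zero (neg_ne_zero.mpr this) two_ne_zero), zero_mul]
    exact zero_le_one
  · have e : eigenval α β n ^ (-(N : ℝ) / 2) = (Real.sqrt (eigenval α β n) ^ N)⁻¹ := by
      rw [Real.sqrt_eq_rpow, ← Real.rpow_natCast, ← Real.rpow_mul hl, ← Real.rpow_neg hl]
      congr 1
      ring
    have hs : 0 < Real.sqrt (eigenval α β n) := Real.sqrt_pos.mpr h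
    rw [e, inv_mul_le_iff₀ (by positivity), mul_one]
    exact pow_le_pow_left₀ (Real.sqrt_nonneg _) (sqrt_kap_le n) N

theorem riesz_even {α β : ℝ} (hα : -1 / 2 ≤ α) (hβ : -1 / 2 ≤ β) {N : ℕ} (hN : 1 ≤ N) :
    SeriesBoundedOnL2 α β (rieszEvenTerm α β N) := by
  refine seriesBoundedOnL2_of_diagonal hα hβ false (par false N) 0 (K := 1)
    (m := fun n => ((eigenval α β n ^ (-(N : ℝ) / 2) * (-Real.sqrt (kap α β n)) ^ N : ℝ) : ℂ))
    (fun n => norm_riesz_le hN n)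
    fun f n θ hθ => ?_
  have := deltaSeq_sysFun hα hβ false N n hθ
  simp only [deltaSeq, Bool.false_eq_true, if_false] at this
  rw [rieszEvenTerm, Phi_even, this, coeff_even hα hβ]
  push_cast
  simp only [add_zero]
  ring

theorem riesz_odd {α β : ℝ} (hα : -1 / 2 ≤ α) (hβ : -1 / 2 ≤ β) {N : ℕ} (hN : 1 ≤ N) :
    SeriesBoundedOnL2 α β (rieszOddTerm α β N) := by
  refine seriesBoundedOnL2_of_diagonal hα hβ true (par true N) 1 (K := 1)
    (m := fun n => ((eigenval α β (n + 1) ^ (-(N : ℝ) / 2) *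
      (-Real.sqrt (kap α β (n + 1))) ^ N : ℝ) : ℂ))
    (fun n => norm_riesz_le hN (n + 1)) fun f n θ hθ => ?_
  have := deltaSeq_sysFun hα hβ true N (n + 1) hθ
  simp only [deltaSeq, if_true] at this
  rw [rieszOddTerm, Phi_odd, this, coeff_odd hα hβ]
  push_cast
  ring

/-- Multipliers of Laplace and of Laplace-Stieltjes transform type are bounded. -/
theorem exists_multiplier_bound {α β : ℝ} {m : ℝ → ℂ}
    (hm : IsLaplaceMultiplier α β m ∨ IsLaplaceStieltjesMultiplier α β m) :
    ∃ K : ℝ, ∀ z : ℝ, |(α + β + 1) / 2| ≤ z → ‖m z‖ ≤ K := by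
  rcases hm with ⟨φ, hφm, ⟨K, hK⟩, hm⟩ | ⟨ρ, h, hhm, hh, hfin, hm⟩
  · refine ⟨K, fun z hz => ?_⟩
    have hz0 : 0 ≤ z := (abs_nonneg _).trans hz
    have hK0 : 0 ≤ K := (norm_nonneg _).trans (hK 1 one_pos)
    rw [hm z hz]
    rcases hz0.eq_or_lt with rfl | hz0
    · simpa using hK0
    have hbound : ∀ᵐ t ∂(volume.restrict (Ioi (0 : ℝ))),
        ‖((z * Real.exp (-t * z) : ℝ) : ℂ) * φ t‖ ≤ K * (z * Real.exp (-z * t)) := by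
      filter_upwards [ae_restrict_mem measurableSet_Ioi] with t ht
      rw [norm_mul, Complex.norm_real, Real.norm_of_nonneg (by positivity),
        show -t * z = -z * t by ring, mul_comm]
      exact mul_le_mul_of_nonneg_right (hK t ht) (by positivity)
    have hint : IntegrableOn (fun t => K * (z * Real.exp (-z * t))) (Ioi 0) :=
      ((exp_neg_integrableOn_Ioi 0 hz0).const_mul z).const_mul K
    refine (norm_integral_le_of_norm_le hint hbound).trans (le_of_eq ?_)
    rw [integral_const_mul, integral_const_mul, integral_exp_mul_Ioi (by linarith)]
    simp
    field_simp
  · refine ⟨∫ t in Ioi (0 : ℝ), Real.exp (-t * (|α + β + 1| / 2)) ∂ρ, fun z hz => ?_⟩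
    rw [hm z hz]
    have hint : Integrable (fun t => Real.exp (-t * (|α + β + 1| / 2))) (ρ.restrict (Ioi 0)) := by
      refine ⟨Continuous.aestronglyMeasurable (by fun_prop), ?_⟩
      rw [hasFiniteIntegral_iff_ofReal (ae_of_all _ fun t => (Real.exp_pos _).le)]
      exact hfin
    refine norm_integral_le_of_norm_le hint ?_
    filter_upwards [ae_restrict_mem measurableSet_Ioi] with t ht
    have ht : 0 < t := ht
    rw [norm_mul, hh, mul_one, Complex.norm_real, Real.norm_of_nonneg (Real.exp_pos _).le]
    refine Real.exp_le_exp.mpr ?_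
    rw [abs_div, abs_two] at hz
    nlinarith

theorem abs_le_sqrt_eigenval {α β : ℝ} (h : 0 ≤ α + β + 1) (n : ℕ) :
    |(α + β + 1) / 2| ≤ Real.sqrt (eigenval α β n) := by
  rw [sqrt_eigenval h, abs_of_nonneg (by linarith)]
  have : (0 : ℝ) ≤ n := by positivity
  linarith

theorem mult_even {α β : ℝ} (hα : -1 / 2 ≤ α) (hβ : -1 / 2 ≤ β) {m : ℝ → ℂ}
    (hm : IsLaplaceMultiplier α β m ∨ IsLaplaceStieltjesMultiplier α β m) :
    SeriesBoundedOnL2 α β (multEvenTerm α β m) := by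
  obtain ⟨K, hK⟩ := exists_multiplier_bound hm
  refine seriesBoundedOnL2_of_diagonal hα hβ false false 0
    (m := fun n => m (Real.sqrt (eigenval α β n)))
    (fun n => hK _ (abs_le_sqrt_eigenval (by linarith) n)) fun f n θ hθ => ?_
  rw [multEvenTerm, Phi_even, coeff_even hα hβ]
  rfl

theorem mult_odd {α β : ℝ} (hα : -1 / 2 ≤ α) (hβ : -1 / 2 ≤ β) {m : ℝ → ℂ}
    (hm : IsLaplaceMultiplier α β m ∨ IsLaplaceStieltjesMultiplier α β m) :
    SeriesBoundedOnL2 α β (multOddTerm α β m) := by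
  obtain ⟨K, hK⟩ := exists_multiplier_bound hm
  refine seriesBoundedOnL2_of_diagonal hα hβ true true 1
    (m := fun n => m (Real.sqrt (eigenval α β (n + 1))))
    (fun n => hK _ (abs_le_sqrt_eigenval (by linarith) _)) fun f n θ hθ => ?_
  rw [multOddTerm, Phi_odd, coeff_odd hα hβ]

/-- The Poisson type series of `f`, for the even (`c = false`) or the odd half of the system. The
shift `c.toNat` makes the odd half start at `Φ_1`. -/
noncomputable def poisson {α β : ℝ} (hα : -1 / 2 ≤ α) (hβ : -1 / 2 ≤ β) (c : Bool) (f : L2 α β)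
    (t θ : ℝ) : ℂ :=
  ser α β c c.toNat (fun n => inner ℂ (sysVec hα hβ c (n + c.toNat)) f) t θ

theorem poissonEvenTerm_eq {α β : ℝ} (hα : -1 / 2 ≤ α) (hβ : -1 / 2 ≤ β) (f : L2 α β) (t θ : ℝ) :
    poissonEvenTerm α β f t θ = serTerm α β false 0
      (fun n => inner ℂ (sysVec hα hβ false (n + 0)) f) t θ := by
  funext n
  rw [poissonEvenTerm, serTerm, Phi_even, coeff_even hα hβ]
  rfl

theorem poissonOddTerm_eq {α β : ℝ} (hα : -1 / 2 ≤ α) (hβ : -1 / 2 ≤ β) (f : L2 α β) (t θ : ℝ) :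
    poissonOddTerm α β f t θ = serTerm α β true 1
      (fun n => inner ℂ (sysVec hα hβ true (n + 1)) f) t θ := by
  funext n
  rw [poissonOddTerm, serTerm, Phi_odd, coeff_odd hα hβ]

theorem poissonEven_eq {α β : ℝ} (hα : -1 / 2 ≤ α) (hβ : -1 / 2 ≤ β) :
    poissonEven α β = poisson hα hβ false := by
  funext f t θ
  rw [poissonEven, poissonEvenTerm_eq hα hβ]
  rfl

theorem poissonOdd_eq {α β : ℝ} (hα : -1 / 2 ≤ α) (hβ : -1 / 2 ≤ β) :
    poissonOdd α β = poisson hα hβ true := by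
  funext f t θ
  rw [poissonOdd, poissonOddTerm_eq hα hβ]
  rfl

theorem smoothSeries_even {α β : ℝ} (hα : -1 / 2 ≤ α) (hβ : -1 / 2 ≤ β) :
    SmoothSeries α β (poissonEvenTerm α β) := fun f => by
  have hb := polyBdd_inner hα hβ false 0 f
  refine ⟨fun t ht θ hθ => ?_, ?_⟩
  · rw [poissonEvenTerm_eq hα hβ]
    exact summable_serTerm hα hβ _ _ hb ht hθ
  · simp only [poissonEvenTerm_eq hα hβ]
    exact contDiffOn_ser hα hβ _ _ hb

theorem smoothSeries_odd {α β : ℝ} (hα : -1 / 2 ≤ α) (hβ : -1 / 2 ≤ β) :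
    SmoothSeries α β (poissonOddTerm α β) := fun f => by
  have hb := polyBdd_inner hα hβ true 1 f
  refine ⟨fun t ht θ hθ => ?_, ?_⟩
  · rw [poissonOddTerm_eq hα hβ]
    exact summable_serTerm hα hβ _ _ hb ht hθ
  · simp only [poissonOddTerm_eq hα hβ]
    exact contDiffOn_ser hα hβ _ _ hb

end SymJacobi

/-! ### Operators with values in Bochner spaces -/

namespace SymJacobi

section Tensor

variable {E : Type*} [NormedAddCommGroup E] [NormedSpace ℂ E]

/-- The elementary tensor `θ ↦ ψ(θ) k` in a Bochner space. -/
noncomputable def tens {μ : Measure ℝ} (ψ : Lp ℂ 2 μ) (k : E) : Lp E 2 μ :=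
  (ContinuousLinearMap.toSpanSingleton ℂ k).compLp ψ

theorem coeFn_tens {μ : Measure ℝ} (ψ : Lp ℂ 2 μ) (k : E) :
    tens ψ k =ᵐ[μ] fun θ => ψ θ • k := by
  filter_upwards [(ContinuousLinearMap.toSpanSingleton ℂ k).coeFn_compLp ψ] with θ h
  rw [tens, h, ContinuousLinearMap.toSpanSingleton_apply]

theorem norm_tens_le {μ : Measure ℝ} (ψ : Lp ℂ 2 μ) (k : E) : ‖tens ψ k‖ ≤ ‖k‖ * ‖ψ‖ := by
  refine ((ContinuousLinearMap.toSpanSingleton ℂ k).norm_compLp_le ψ).trans (le_of_eq ?_)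
  rw [ContinuousLinearMap.norm_toSpanSingleton]

variable {α β : ℝ} (hα : -1 / 2 ≤ α) (hβ : -1 / 2 ≤ β)

theorem coeFn_sum_tens (c : Bool) (d : ℕ) (a : ℕ → ℂ) (k : ℕ → E) (S : Finset ℕ) :
    (∑ n ∈ S, a n • tens (sysVec hα hβ c (n + d)) (k n) : Lp E 2 (muPlus α β)) =ᵐ[muPlus α β]
      fun θ => ∑ n ∈ S, (a n * ((sysFun α β c (n + d) θ : ℝ) : ℂ)) • k n := by
  refine (Lp.coeFn_fun_finsetSum _ _).trans ?_
  have h : ∀ n, ∀ᵐ θ ∂(muPlus α β), (a n • tens (sysVec hα hβ c (n + d)) (k n) :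
      Lp E 2 (muPlus α β)) θ = (a n * ((sysFun α β c (n + d) θ : ℝ) : ℂ)) • k n := by
    intro n
    filter_upwards [Lp.coeFn_smul (a n) (tens (sysVec hα hβ c (n + d)) (k n)),
      coeFn_tens (sysVec hα hβ c (n + d)) (k n), coeFn_sysVec hα hβ c (n + d)] with θ h1 h2 h3
    rw [h1, Pi.smul_apply, h2, h3, smul_smul]
  filter_upwards [ae_all_iff.mpr h] with θ h
  exact Finset.sum_congr rfl fun n _ => h n

/-- Along a subsequence, the partial sums of a series convergent in the Bochner space converge
pointwise almost everywhere. -/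
theorem exists_seq_tendsto_of_hasSum (c : Bool) (d : ℕ) {a : ℕ → ℂ} {k : ℕ → E}
    {F : Lp E 2 (muPlus α β)}
    (h : HasSum (fun n => a n • tens (sysVec hα hβ c (n + d)) (k n)) F) :
    ∃ ns : ℕ → ℕ, StrictMono ns ∧ ∀ᵐ θ ∂(muPlus α β), Tendsto (fun j =>
      ∑ n ∈ Finset.range (ns j), (a n * ((sysFun α β c (n + d) θ : ℝ) : ℂ)) • k n) atTop
        (𝓝 (F θ)) := by
  obtain ⟨ns, hns, hlim⟩ :=
    (tendstoInMeasure_of_tendsto_Lp h.tendsto_sum_nat).exists_seq_tendsto_ae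
  refine ⟨ns, hns, ?_⟩
  filter_upwards [hlim, ae_all_iff.mpr fun j => coeFn_sum_tens hα hβ c d a k (Finset.range (ns j))]
    with θ h1 h2
  simpa only [h2] using h1

/-- The norm of a bounded operator with values in a Bochner space is a bounded nonlinear operator. -/
theorem boundedOnL2_of_clm {S : L2 α β → ℝ → ℝ≥0∞} (T : L2 α β →L[ℂ] Lp E 2 (muPlus α β))
    (h : ∀ f, ∀ᵐ θ ∂(muPlus α β), S f θ = ‖T f θ‖ₑ) : BoundedOnL2 α β S := by
  refine ⟨‖T‖₊, fun f => ⟨(Lp.memLp (T f)).enorm.ae_eq (EventuallyEq.symm (h f)), ?_⟩⟩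
  rw [eLpNorm_congr_ae (h f), eLpNorm_enorm, ← Lp.enorm_def, ← Lp.enorm_def]
  exact T.le_opENorm f

end Tensor

/-! ### The maximal operators -/

/-- Uniform limits of functions that converge along `l` converge along `l`. -/
theorem isClosed_setOf_exists_tendsto {X : Type*} [TopologicalSpace X] (l : Filter X) [l.NeBot] :
    IsClosed {g : X →ᵇ ℂ | ∃ a : ℂ, Tendsto g l (𝓝 a)} := by
  refine isClosed_of_closure_subset fun g hg => ?_
  rw [Metric.mem_closure_iff] at hg
  refine cauchy_map_iff_exists_tendsto.mp ?_
  rw [Metric.cauchy_iff]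
  refine ⟨inferInstance, fun ε hε => ?_⟩
  obtain ⟨h, ⟨a, ha⟩, hd⟩ := hg (ε / 4) (by positivity)
  have hb := Metric.tendsto_nhds.mp ha (ε / 4) (by positivity)
  refine ⟨Metric.ball a (ε / 2), ?_, fun x hx y hy => ?_⟩
  · rw [mem_map]
    filter_upwards [hb] with x hx
    have h1 := (BoundedContinuousFunction.dist_coe_le_dist x (f := g) (g := h)).trans_lt hd
    have h2 := dist_triangle (g x) (h x) a
    rw [mem_preimage, Metric.mem_ball]
    linarith
  · rw [Metric.mem_ball] at hx hy
    have := dist_triangle_right x y a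
    linarith

instance neBot_comap_zero :
    (comap (Subtype.val : Ioi (0 : ℝ) → ℝ) (𝓝[>] (0 : ℝ))).NeBot := by
  rw [comap_neBot_iff]
  intro t ht
  obtain ⟨x, hx, hx'⟩ := (Filter.nonempty_of_mem (inter_mem ht self_mem_nhdsWithin))
  exact ⟨⟨x, hx'⟩, hx⟩

instance neBot_comap_atTop :
    (comap (Subtype.val : Ioi (0 : ℝ) → ℝ) atTop).NeBot := by
  rw [comap_neBot_iff]
  intro t ht
  obtain ⟨x, hx, hx'⟩ := (Filter.nonempty_of_mem (inter_mem ht (Ioi_mem_atTop (0 : ℝ))))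
  exact ⟨⟨x, hx'⟩, hx⟩

instance completeSpace_XSpace : CompleteSpace XSpace := by
  have : IsClosed (XSpace : Set (Ioi (0 : ℝ) →ᵇ ℂ)) :=
    (isClosed_setOf_exists_tendsto (comap Subtype.val (𝓝[>] (0 : ℝ)))).inter
      (isClosed_setOf_exists_tendsto (comap Subtype.val (atTop : Filter ℝ)))
  exact this.completeSpace_coe

/-- The function `t ↦ e^{-tz}`, for `z ≥ 0`, as an element of `XSpace`. -/
noncomputable def expX {z : ℝ} (hz : 0 ≤ z) : XSpace :=
  ⟨BoundedContinuousFunction.ofNormedAddCommGroup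
      (fun t : Ioi (0 : ℝ) => ((Real.exp (-(t : ℝ) * z) : ℝ) : ℂ)) (by fun_prop) 1 fun t => by
        rw [Complex.norm_real, Real.norm_of_nonneg (Real.exp_pos _).le, Real.exp_le_one_iff]
        have : (0 : ℝ) < t := t.2
        nlinarith, by
    have hc : Continuous fun t : ℝ => ((Real.exp (-t * z) : ℝ) : ℂ) := by fun_prop
    refine ⟨⟨_, ((hc.tendsto 0).mono_left nhdsWithin_le_nhds).comp tendsto_comap⟩, ?_⟩
    suffices h : ∃ b : ℂ, Tendsto (fun t : ℝ => ((Real.exp (-t * z) : ℝ) : ℂ)) atTop (𝓝 b) by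
      obtain ⟨b, hb⟩ := h
      exact ⟨b, hb.comp tendsto_comap⟩
    rcases hz.eq_or_lt with rfl | hz
    · exact ⟨1, by simp⟩
    · refine ⟨((0 : ℝ) : ℂ), (Complex.continuous_ofReal.tendsto 0).comp
        (Real.tendsto_exp_atBot.comp ?_)⟩
      exact tendsto_neg_atTop_atBot.atBot_mul_const hz⟩

theorem sum_smul_expX_apply {z : ℕ → ℝ} (hz : ∀ n, 0 ≤ z n) (S : Finset ℕ) (b : ℕ → ℂ)
    (t : Ioi (0 : ℝ)) : ((∑ n ∈ S, b n • expX (hz n) : XSpace) : Ioi (0 : ℝ) →ᵇ ℂ) t =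
      ∑ n ∈ S, b n * ((Real.exp (-(t : ℝ) * z n) : ℝ) : ℂ) := by
  rw [AddSubmonoidClass.coe_finsetSum, BoundedContinuousFunction.coe_sum, Finset.sum_apply]
  rfl

theorem enorm_le_of_forall {g : Ioi (0 : ℝ) →ᵇ ℂ} {K : ℝ≥0∞} (h : ∀ t, ‖g t‖ₑ ≤ K) :
    ‖g‖ₑ ≤ K := by
  rcases eq_or_ne K ∞ with rfl | hK
  · exact le_top
  · lift K to ℝ≥0 using hK
    rw [enorm_eq_nnnorm, ENNReal.coe_le_coe, ← NNReal.coe_le_coe, coe_nnnorm]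
    refine (BoundedContinuousFunction.norm_le K.2).mpr fun t => ?_
    have := h t
    rw [enorm_eq_nnnorm, ENNReal.coe_le_coe, ← NNReal.coe_le_coe, coe_nnnorm] at this
    exact this

/-- For a bounded continuous function on `(0, ∞)` the essential supremum of the modulus is the
norm. -/
theorem eLpNorm_top_eq_enorm (g : Ioi (0 : ℝ) →ᵇ ℂ) {F : ℝ → ℂ} (h : ∀ t : Ioi (0 : ℝ), g t = F t) :
    eLpNorm F ∞ (volume.restrict (Ioi 0)) = ‖g‖ₑ := by
  have hF : ContinuousOn F (Ioi 0) := by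
    rw [continuousOn_iff_continuous_domRestrict]
    convert g.continuous using 1
    funext t
    exact (h t).symm
  refine le_antisymm ?_ (enorm_le_of_forall fun t => ?_)
  · rw [eLpNorm_exponent_top]
    refine eLpNormEssSup_le_of_ae_enorm_bound ?_
    filter_upwards [ae_restrict_mem measurableSet_Ioi] with t ht
    rw [← h ⟨t, ht⟩]
    simpa only [enorm_eq_nnnorm, ENNReal.coe_le_coe] using g.nnnorm_coe_le_nnnorm ⟨t, ht⟩
  -- if the value at `t` exceeded the essential supremum, it would do so on a neighbourhood of `t`
  · rw [h t]
    by_contra! hlt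
    obtain ⟨u, hu, hut⟩ := mem_nhdsWithin_iff_exists_mem_nhds_inter.mp
      ((hF t t.2).enorm.eventually (lt_mem_nhds hlt))
    have h0 : ∀ᵐ s ∂(volume.restrict (Ioi (0 : ℝ))), s ∉ u := by
      filter_upwards [enorm_ae_le_eLpNormEssSup F (volume.restrict (Ioi (0 : ℝ))),
        ae_restrict_mem measurableSet_Ioi] with s hs hs0 hsu
      rw [eLpNorm_exponent_top] at hut
      exact absurd (hut ⟨hsu, hs0⟩) (not_lt.mpr hs)
    rw [ae_restrict_iff' measurableSet_Ioi, ae_iff] at h0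
    have h1 : {s : ℝ | ¬(s ∈ Ioi (0 : ℝ) → s ∉ u)} ∈ 𝓝 (t : ℝ) := by
      filter_upwards [hu, isOpen_Ioi.mem_nhds t.2] with s h1 h2 h3 using h3 h2 h1
    exact (Measure.measure_pos_of_mem_nhds volume h1).ne' h0

/-- The maximal inequality for finite sums, as a bound in the Bochner space. -/
theorem norm_sq_sum_tens_expX_le {α β : ℝ} (hα : -1 / 2 ≤ α) (hβ : -1 / 2 ≤ β) (c : Bool)
    (S : Finset ℕ) (a : ℕ → ℂ) :
    ‖(∑ n ∈ S, a n • tens (sysVec hα hβ c (n + c.toNat))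
      (expX (Real.sqrt_nonneg (eigenval α β (n + c.toNat)))) : Lp XSpace 2 (muPlus α β))‖ ^ 2 ≤
      276 * ∑ n ∈ S, ‖a n‖ ^ 2 := by
  obtain ⟨_, _, _, s, q, hsys, hq⟩ := exists_isJacobiSystem hα hβ c
  have hr : ((Real.sqrt 2 : ℝ) : ℂ) ≠ 0 := by
    exact_mod_cast (by positivity : Real.sqrt 2 ≠ 0)
  -- the Jacobi system is normalized, while `‖Φ_n‖² = 1 / 2`
  obtain ⟨M, hM, hM2⟩ := hsys.exists_maximal_complex S fun n => a n / ((Real.sqrt 2 : ℝ) : ℂ)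
  have hsum : ∑ n ∈ S, ‖a n / ((Real.sqrt 2 : ℝ) : ℂ)‖ ^ 2 ≤ ∑ n ∈ S, ‖a n‖ ^ 2 := by
    refine Finset.sum_le_sum fun n _ => ?_
    rw [norm_div, div_pow, Complex.norm_real, Real.norm_of_nonneg (Real.sqrt_nonneg _),
      Real.sq_sqrt zero_le_two]
    linarith [sq_nonneg ‖a n‖]
  set F : Lp XSpace 2 (muPlus α β) := ∑ n ∈ S, a n • tens (sysVec hα hβ c (n + c.toNat))
    (expX (Real.sqrt_nonneg (eigenval α β (n + c.toNat)))) with hF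
  have hae : ∀ᵐ θ ∂(muPlus α β), ‖F θ‖ₑ ≤ M θ := by
    filter_upwards [coeFn_sum_tens hα hβ c c.toNat a
      (fun n => expX (Real.sqrt_nonneg (eigenval α β (n + c.toNat)))) S, hM, ae_mem_Ioo α β]
      with θ h1 h2 h3
    change ‖((F θ : XSpace) : Ioi (0 : ℝ) →ᵇ ℂ)‖ₑ ≤ M θ
    refine enorm_le_of_forall fun t => le_trans (le_of_eq ?_) (h2 t t.2)
    rw [h1, sum_smul_expX_apply]
    congr 1
    refine Finset.sum_congr rfl fun n _ => ?_
    rw [hq n θ h3]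
    push_cast
    field_simp
  have h1 : ‖F‖ₑ ^ 2 ≤ ENNReal.ofReal (276 * ∑ n ∈ S, ‖a n‖ ^ 2) := by
    rw [Lp.enorm_def, ← lintegral_enorm_sq_eq]
    refine (lintegral_mono_ae (hae.mono fun θ h => pow_le_pow_left' h 2)).trans (hM2.trans ?_)
    rw [ENNReal.ofReal_mul (by norm_num)]
    refine mul_le_mul' (by simp) (ENNReal.ofReal_le_ofReal hsum)
  rw [← ofReal_norm, ← ENNReal.ofReal_pow (norm_nonneg _)] at h1
  exact (ENNReal.ofReal_le_ofReal_iff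
    (mul_nonneg (by norm_num) (Finset.sum_nonneg fun _ _ => sq_nonneg _))).mp h1

/-- The Poisson type operators are bounded into the Bochner space of `XSpace` valued functions. -/
theorem boundedIntoX_poisson {α β : ℝ} (hα : -1 / 2 ≤ α) (hβ : -1 / 2 ≤ β) (c : Bool) :
    BoundedIntoX α β (poisson hα hβ c) := by
  obtain ⟨T, hT, -⟩ := exists_clm_hasSum (𝕜 := ℂ) (bessel_sysVec hα hβ c c.toNat)
    (norm_sq_sum_tens_expX_le hα hβ c)
  refine ⟨T, fun f => ?_⟩
  obtain ⟨ns, hns, hlim⟩ := exists_seq_tendsto_of_hasSum hα hβ c c.toNat (hT f)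
  filter_upwards [hlim, ae_mem_Ioo α β] with θ h1 hθ t
  have h2 := (summable_serTerm hα hβ c c.toNat (polyBdd_inner hα hβ c c.toNat f) t.2
    hθ).hasSum.tendsto_sum_nat.comp hns.tendsto_atTop
  have h3 := ((BoundedContinuousFunction.evalCLM ℂ t (β := ℂ)).continuous.tendsto _).comp
    ((continuous_subtype_val.tendsto _).comp h1)
  refine tendsto_nhds_unique h3 (h2.congr fun j => ?_)
  simp only [Function.comp_apply]
  refine Eq.trans (Finset.sum_congr rfl fun n _ => ?_) (sum_smul_expX_apply _ _ _ t).symm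
  rw [serTerm]
  ring

theorem BoundedIntoX.boundedOnL2 {α β : ℝ} {F : L2 α β → ℝ → ℝ → ℂ} (h : BoundedIntoX α β F) :
    BoundedOnL2 α β fun f θ => eLpNorm (fun t => F f t θ) ∞ (volume.restrict (Ioi 0)) := by
  obtain ⟨T, hT⟩ := h
  refine boundedOnL2_of_clm T fun f => ?_
  filter_upwards [hT f] with θ h
  exact eLpNorm_top_eq_enorm _ h

end SymJacobi

/-! ### The square functions -/

namespace SymJacobi

theorem inner_tens {E : Type*} [NormedAddCommGroup E] [InnerProductSpace ℂ E] {μ : Measure ℝ}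
    (ψ ψ' : Lp ℂ 2 μ) (k k' : E) :
    inner ℂ (tens ψ k) (tens ψ' k') = inner ℂ ψ ψ' * inner ℂ k k' := by
  rw [L2.inner_def, L2.inner_def, ← integral_mul_const]
  refine integral_congr_ae ?_
  filter_upwards [coeFn_tens ψ k, coeFn_tens ψ' k'] with θ h1 h2
  rw [h1, h2, inner_smul_left, inner_smul_right, RCLike.inner_apply]
  ring

theorem lintegral_pow_mul_exp_le {p : ℕ} (hp : 0 < p) {z : ℝ} (hz : 0 < z) :
    ∫⁻ t in Ioi (0 : ℝ), ENNReal.ofReal (t ^ (p - 1) * (z ^ p * Real.exp (-t * z) ^ 2)) ≤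
      ENNReal.ofReal (Real.Gamma p) := by
  have hp' : (0 : ℝ) < p := by exact_mod_cast hp
  have hG : 0 < Real.Gamma p := Real.Gamma_pos_of_pos hp'
  have h := Real.integral_rpow_mul_exp_neg_mul_Ioi hp' (by linarith : 0 < 2 * z)
  -- an integral that is not zero is not a junk value
  have hint : IntegrableOn (fun t : ℝ => t ^ ((p : ℝ) - 1) * Real.exp (-(2 * z * t))) (Ioi 0) := by
    refine not_imp_comm.1 integral_undef ?_
    rw [h]
    positivity
  have e : ∀ t ∈ Ioi (0 : ℝ), t ^ (p - 1) * (z ^ p * Real.exp (-t * z) ^ 2) =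
      z ^ p * (t ^ ((p : ℝ) - 1) * Real.exp (-(2 * z * t))) := by
    intro t ht
    rw [show (p : ℝ) - 1 = ((p - 1 : ℕ) : ℝ) by rw [Nat.cast_sub hp, Nat.cast_one],
      Real.rpow_natCast, ← Real.exp_nat_mul, show ((2 : ℕ) : ℝ) * (-t * z) = -(2 * z * t) by push_cast; ring]
    ring
  rw [setLIntegral_congr_fun measurableSet_Ioi (fun t ht => congrArg ENNReal.ofReal (e t ht)),
    ← ofReal_integral_eq_lintegral_ofReal (hint.const_mul _)
      (by
        filter_upwards [ae_restrict_mem measurableSet_Ioi] with t ht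
        have ht : 0 < t := ht
        simp only [Pi.zero_apply]
        positivity), integral_const_mul, h]
  refine ENNReal.ofReal_le_ofReal ?_
  rw [Real.rpow_natCast, ← mul_assoc, ← mul_pow]
  refine mul_le_of_le_one_left hG.le (pow_le_one₀ (by positivity) ?_)
  rw [mul_one_div, div_le_one (by positivity)]
  linarith

/-- The function of `t` that multiplies the eigenfunctions in the mixed derivatives of the
Poisson type series, `z` and `κ` standing for the square roots of `λ_n` and `λ_n - λ_0`. -/
noncomputable def sqKernel (M N : ℕ) (z κ : ℝ) (t : ℝ) : ℂ :=
  (-(z : ℂ)) ^ M * (-(κ : ℂ)) ^ N * ((Real.exp (-t * z) : ℝ) : ℂ)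

/-- The bound is uniform in the frequency by scaling in `t`. At zero frequency the kernel vanishes,
because `M + N > 0`. -/
theorem lintegral_sqKernel_le {M N : ℕ} (h : 0 < M + N) {z κ : ℝ} (hκ : 0 ≤ κ) (hz : κ ≤ z) :
    ∫⁻ t, ‖sqKernel M N z κ t‖ₑ ^ 2 ∂(sqMeasure M N) ≤
      ENNReal.ofReal (Real.Gamma (2 * M + 2 * N : ℕ)) := by
  have hz0 := hκ.trans hz
  have hnorm : ∀ t, ‖sqKernel M N z κ t‖ = z ^ M * κ ^ N * Real.exp (-t * z) := by
    intro t
    rw [sqKernel, norm_mul, norm_mul, norm_pow, norm_pow, norm_neg, norm_neg, Complex.norm_real,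
      Complex.norm_real, Complex.norm_real, Real.norm_of_nonneg hz0, Real.norm_of_nonneg hκ,
      Real.norm_of_nonneg (Real.exp_pos _).le]
  rcases hz0.eq_or_lt with rfl | hz0
  · obtain rfl : κ = 0 := le_antisymm hz hκ
    have h0 : ∀ t, ‖sqKernel M N 0 0 t‖ₑ ^ 2 = 0 := by
      intro t
      rw [← ofReal_norm, hnorm, ← pow_add, zero_pow h.ne']
      simp
    simp [h0]
  · rw [sqMeasure, lintegral_withDensity_eq_lintegral_mul₀ (by fun_prop)
      (by unfold sqKernel; fun_prop)]
    refine le_trans (setLIntegral_mono' measurableSet_Ioi fun t ht => ?_)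
      (lintegral_pow_mul_exp_le (p := 2 * M + 2 * N) (by omega) hz0)
    have ht : 0 < t := ht
    rw [Pi.mul_apply, ← ofReal_norm, hnorm, ← ENNReal.ofReal_pow (by positivity),
      ← ENNReal.ofReal_mul (by positivity)]
    refine ENNReal.ofReal_le_ofReal (mul_le_mul_of_nonneg_left ?_ (by positivity))
    rw [mul_pow, mul_pow, ← pow_mul, ← pow_mul, pow_add, mul_comm M, mul_comm N]
    gcongr

theorem memLp_sqKernel {M N : ℕ} (h : 0 < M + N) {z κ : ℝ} (hκ : 0 ≤ κ) (hz : κ ≤ z) :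
    MemLp (sqKernel M N z κ) 2 (sqMeasure M N) := by
  refine ⟨Continuous.aestronglyMeasurable (by unfold sqKernel; fun_prop), ?_⟩
  have h1 := (lintegral_sqKernel_le h hκ hz).trans_lt ENNReal.ofReal_lt_top
  rw [lintegral_enorm_sq_eq] at h1
  exact lt_top_iff_ne_top.mpr fun h2 => by simp [h2] at h1

/-- The kernels of the square functions as elements of `L²(t^{2M+2N-1} dt)`. -/
noncomputable def sqVec (α β : ℝ) {M N : ℕ} (h : 0 < M + N) (n : ℕ) : Lp ℂ 2 (sqMeasure M N) :=
  (memLp_sqKernel h (Real.sqrt_nonneg (kap α β n)) (sqrt_kap_le (α := α) (β := β) n)).toLp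

theorem norm_sq_sqVec_le (α β : ℝ) {M N : ℕ} (h : 0 < M + N) (n : ℕ) :
    ‖sqVec α β h n‖ ^ 2 ≤ Real.Gamma (2 * M + 2 * N : ℕ) := by
  have h1 := lintegral_sqKernel_le h (Real.sqrt_nonneg (kap α β n))
    (sqrt_kap_le (α := α) (β := β) n)
  rw [lintegral_enorm_sq_eq, ← Lp.enorm_toLp (memLp_sqKernel h (Real.sqrt_nonneg (kap α β n))
    (sqrt_kap_le (α := α) (β := β) n)), ← ofReal_norm, ← ENNReal.ofReal_pow (norm_nonneg _)] at h1
  exact (ENNReal.ofReal_le_ofReal_iff (Real.Gamma_nonneg_of_nonneg (by positivity))).mp h1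

/-- The mixed derivatives of the Poisson type operators are bounded into the Bochner space: the
terms of the series are orthogonal there. -/
theorem boundedIntoL2t_deltaSeq_poisson {α β : ℝ} (hα : -1 / 2 ≤ α) (hβ : -1 / 2 ≤ β) (c : Bool)
    {M N : ℕ} (h : 0 < M + N) : BoundedIntoL2t α β M N fun f θ t =>
      iteratedDeriv M (fun s => deltaSeq α β c N (poisson hα hβ c f s) θ) t := by
  obtain ⟨T, hT, -⟩ := exists_clm_hasSum (𝕜 := ℂ) (bessel_sysVec hα hβ c c.toNat)
    (norm_sq_sum_smul_le_of_orthogonal (𝕜 := ℂ)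
      (v := fun n => tens (sysVec hα hβ (par c N) (n + c.toNat)) (sqVec α β h (n + c.toNat)))
      (K := Real.Gamma (2 * M + 2 * N : ℕ)) (fun i j hij => by
        refine (inner_tens _ _ _ _).trans ?_
        rw [inner_sysVec_of_ne hα hβ _ (by omega), zero_mul])
      fun n => by
        refine (pow_le_pow_left₀ (norm_nonneg _) (norm_tens_le _ _) 2).trans ?_
        rw [mul_pow]
        have h1 := norm_sq_sqVec_le α β h (n + c.toNat)
        have h2 := norm_sq_sysVec_le hα hβ (par c N) (n + c.toNat)
        nlinarith [sq_nonneg ‖sqVec α β h (n + c.toNat)‖])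
  refine ⟨T, fun f => ?_⟩
  obtain ⟨ns, hns, hlim⟩ := exists_seq_tendsto_of_hasSum hα hβ (par c N) c.toNat (hT f)
  filter_upwards [hlim, ae_mem_Ioo α β] with θ h1 hθ
  -- at fixed `θ` pass to a further subsequence that converges for almost every `t`
  obtain ⟨ms, hms, hlim'⟩ := (tendstoInMeasure_of_tendsto_Lp h1).exists_seq_tendsto_ae
  have hpos : ∀ᵐ t ∂(sqMeasure M N), 0 < t :=
    (withDensity_absolutelyContinuous _ _).ae_le (ae_restrict_mem measurableSet_Ioi)
  have hterm : ∀ n, ∀ᵐ t ∂(sqMeasure M N),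
      ((inner ℂ (sysVec hα hβ c (n + c.toNat)) f *
        ((sysFun α β (par c N) (n + c.toNat) θ : ℝ) : ℂ)) • sqVec α β h (n + c.toNat) :
          Lp ℂ 2 (sqMeasure M N)) t =
      serTerm α β (par c N) c.toNat
        (fun n => (-((Real.sqrt (eigenval α β (n + c.toNat)) : ℝ) : ℂ)) ^ M *
          ((-((Real.sqrt (kap α β (n + c.toNat)) : ℝ) : ℂ)) ^ N *
            inner ℂ (sysVec hα hβ c (n + c.toNat)) f)) t θ n := by
    intro n
    filter_upwards [Lp.coeFn_smul (inner ℂ (sysVec hα hβ c (n + c.toNat)) f *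
        ((sysFun α β (par c N) (n + c.toNat) θ : ℝ) : ℂ)) (sqVec α β h (n + c.toNat)),
      MemLp.coeFn_toLp (memLp_sqKernel h (Real.sqrt_nonneg (kap α β (n + c.toNat)))
        (sqrt_kap_le (α := α) (β := β) (n + c.toNat)))] with t h1 h2
    rw [h1, Pi.smul_apply, sqVec, h2, sqKernel, serTerm, smul_eq_mul]
    ring
  filter_upwards [hlim', hpos, ae_all_iff.mpr hterm, ae_all_iff.mpr fun j =>
    Lp.coeFn_fun_finsetSum (Finset.range (ns (ms j))) fun n =>
      ((inner ℂ (sysVec hα hβ c (n + c.toNat)) f *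
        ((sysFun α β (par c N) (n + c.toNat) θ : ℝ) : ℂ)) • sqVec α β h (n + c.toNat) :
          Lp ℂ 2 (sqMeasure M N))] with t h2 ht h3 h4
  have hb := polyBdd_inner hα hβ c c.toNat f
  have hAB : 0 ≤ α + β + 1 := by linarith
  have hbκ := polyBdd_neg_sqrt_kap hAB c.toNat
  have h5 := (summable_serTerm hα hβ (par c N) c.toNat
    (polyBdd_pow_mul (polyBdd_pow_mul hb hbκ N) (polyBdd_sqrt_eigenval hAB c.toNat) M) ht
    hθ).hasSum.tendsto_sum_nat.comp (hns.comp hms).tendsto_atTop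
  have h6 := iteratedDeriv_deltaSeq_ser hα hβ c M N c.toNat hb ht hθ
  refine (tendsto_nhds_unique h2 (h5.congr fun j => ?_)).trans h6.symm
  rw [h4 j]
  exact Finset.sum_congr rfl fun n _ => (h3 n).symm

theorem BoundedIntoL2t.boundedOnL2 {α β : ℝ} {M N : ℕ} {F : L2 α β → ℝ → ℝ → ℂ}
    (h : BoundedIntoL2t α β M N F) :
    BoundedOnL2 α β fun f θ => eLpNorm (F f θ) 2 (sqMeasure M N) := by
  obtain ⟨T, hT⟩ := h
  refine boundedOnL2_of_clm T fun f => ?_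
  filter_upwards [hT f] with θ h
  rw [Lp.enorm_def, eLpNorm_congr_ae h]

theorem boundedIntoL2t_sqEvenFun {α β : ℝ} (hα : -1 / 2 ≤ α) (hβ : -1 / 2 ≤ β) {M N : ℕ}
    (h : 0 < M + N) : BoundedIntoL2t α β M N (sqEvenFun α β M N) := by
  have := boundedIntoL2t_deltaSeq_poisson hα hβ false h
  rw [← poissonEven_eq hα hβ] at this
  exact this

theorem boundedIntoL2t_sqOddFun {α β : ℝ} (hα : -1 / 2 ≤ α) (hβ : -1 / 2 ≤ β) {M N : ℕ}
    (h : 0 < M + N) : BoundedIntoL2t α β M N (sqOddFun α β M N) := by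
  have := boundedIntoL2t_deltaSeq_poisson hα hβ true h
  rw [← poissonOdd_eq hα hβ] at this
  exact this

end SymJacobi

theorem proposition2p4 (α β : ℝ) (hα : -1 / 2 ≤ α) (hβ : -1 / 2 ≤ β) :
    -- the series that define the semigroups make sense pointwise, with smooth sums
    (SmoothSeries α β (poissonEvenTerm α β) ∧ SmoothSeries α β (poissonOddTerm α β)) ∧
    -- Riesz transforms
    (∀ N : ℕ, 1 ≤ N →
      SeriesBoundedOnL2 α β (rieszEvenTerm α β N) ∧
      SeriesBoundedOnL2 α β (rieszOddTerm α β N)) ∧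
    -- multipliers of Laplace and of Laplace-Stieltjes transform type
    (∀ m : ℝ → ℂ, IsLaplaceMultiplier α β m ∨ IsLaplaceStieltjesMultiplier α β m →
      SeriesBoundedOnL2 α β (multEvenTerm α β m) ∧
      SeriesBoundedOnL2 α β (multOddTerm α β m)) ∧
    -- maximal operators
    (BoundedOnL2 α β (maxEven α β) ∧ BoundedOnL2 α β (maxOdd α β)) ∧
    -- mixed square functions
    (∀ M N : ℕ, 0 < M + N →
      BoundedOnL2 α β (sqEven α β M N) ∧ BoundedOnL2 α β (sqOdd α β M N)) ∧
    -- the maximal operators as vector-valued operators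
    (BoundedIntoX α β (poissonEven α β) ∧ BoundedIntoX α β (poissonOdd α β)) ∧
    -- the square functions as vector-valued operators
    (∀ M N : ℕ, 0 < M + N →
      BoundedIntoL2t α β M N (sqEvenFun α β M N) ∧
      BoundedIntoL2t α β M N (sqOddFun α β M N)) := by
  have hX : BoundedIntoX α β (poissonEven α β) ∧ BoundedIntoX α β (poissonOdd α β) := by
    rw [poissonEven_eq hα hβ, poissonOdd_eq hα hβ]
    exact ⟨boundedIntoX_poisson hα hβ false, boundedIntoX_poisson hα hβ true⟩
  exact ⟨⟨smoothSeries_even hα hβ, smoothSeries_odd hα hβ⟩,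
    fun N hN => ⟨riesz_even hα hβ hN, riesz_odd hα hβ hN⟩,
    fun m hm => ⟨mult_even hα hβ hm, mult_odd hα hβ hm⟩,
    ⟨hX.1.boundedOnL2, hX.2.boundedOnL2⟩,
    fun M N h => ⟨(boundedIntoL2t_sqEvenFun hα hβ h).boundedOnL2,
      (boundedIntoL2t_sqOddFun hα hβ h).boundedOnL2⟩, hX,
    fun M N h => ⟨boundedIntoL2t_sqEvenFun hα hβ h, boundedIntoL2t_sqOddFun hα hβ h⟩⟩
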